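/- Let $\kappa$ be a positive semidefinite kernel on $\mathbb{R}^d$ with $\kappa(\mathbf{x},\mathbf{x})=1$ for all $\mathbf{x}$, let $\mathcal{H}$ be its reproducing kernel Hilbert space, and let $(\mathbf{x}_t,y_t)_{t=1}^T$, $T\ge 2$, be examples with $\mathbf{x}_t\in\mathbb{R}^d$, $|y_t|\le Y$. Let $U>0$, $0\le Y\le U$, and let $\lambda_1\ge\dots\ge\lambda_T$ be the eigenvalues of the kernel matrix $\mathbf{K}_T=(\kappa(\mathbf{x}_s,\mathbf{x}_t))_{s,t}$. *The algorithm NONS-ALD with parameters $\mu,\alpha,U,Y$.* Put $\eta=\frac{1}{4(U^2+Y^2)}$. For a finite list $S$ of $j$ instances with kernel matrix $\mathbf{K}_S=\mathbf{U}_S\Sigma_S\mathbf{U}_S^\top$ (singular value decomposition, any choice) and $\mathbf{k}_S(\mathbf{x})=(\kappa(\mathbf{z},\mathbf{x}))_{\mathbf{z}\in S}$, let $\mathbf{M}_S=\Sigma_S^{-1/2}\mathbf{U}_S^\top$ and $\phi_S(\mathbf{x})=\mathbf{M}_S\mathbf{k}_S(\mathbf{x})\in\mathbb{R}^j$. The algorithm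 keeps $S$ (initially empty, $j=0$), $\mathbf{A}\in\mathbb{R}^{j\times j}$ and $\tilde{\mathbf{w}}\in\mathbb{R}^j$. In round $t$: 1. It receives $\mathbf{x}_t$ and lets $\mathbf{w}$ be the minimizer of $(\mathbf{u}-\tilde{\mathbf{w}})^\top\mathbf{A}(\mathbf{u}-\tilde{\mathbf{w}})$ over all $\mathbf{u}\in\mathbb{R}^j$ with $|\mathbf{u}^\top\phi_S(\mathbf{x}_t)|\le U$. 2. It computes $\alpha_t=\kappa(\mathbf{x}_t,\mathbf{x}_t)-\mathbf{k}_S(\mathbf{x}_t)^\top\mathbf{K}_S^{-1}\mathbf{k}_S(\mathbf{x}_t)$. If $\alpha_t>\alpha$, it puts $S'=S\cup\{\mathbf{x}_t\}$ and $\mathbf{Q}=\mathbf{M}_{S'}\,(\kappa(\mathbf{z}',\mathbf{z}))_{\mathbf{z}'\in S',\mathbf{z}\in S}\,\mathbf{M}_S^\top$, and replaces $\mathbf{A}$ by $\mu\mathbf{I}+\mathbf{Q}(\mathbf{A}-\mu\mathbf{I})\mathbf{Q}^\top$, $\mathbf{w}$ by $\mathbf{Q}\mathbf{w}$ and $S$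 by $S'$ (so that $\mathbf{A}=\mu$ and $\mathbf{w}=0$ when the first instance is added). 3. It predicts $\hat y_t=\mathbf{w}^\top\phi_S(\mathbf{x}_t)$, receives $y_t$, and with $\nabla=2(\hat y_t-y_t)\phi_S(\mathbf{x}_t)$ replaces $\mathbf{A}$ by $\mathbf{A}+\eta\nabla\nabla^\top$ and then puts $\tilde{\mathbf{w}}=\mathbf{w}-\mathbf{A}^{-1}\nabla$. *Statement.* Assume that the eigenvalues decay exponentially: $\lambda_i\le R_0r^i$ for $i=1,\dots,T$, where $0<r<1$ and $R_0=\Theta(T)$, that is, $c_1T\le R_0\le c_2T$ with constants $0<c_1\le c_2$. Let $\alpha=\frac{\ln^4T}{T^4}$ and let $\mu>0$ be a constant. Then, with a constant $C$ that depends only on $r,c_1,c_2,\mu,U,Y$ (in particular not on $T$, $d$, $\kappa$ or the examples): (a) for every $f\in\mathcal{H}$ with $\|f\|_{\mathcal{H}}\le U$, $$\mathrm{Reg}(f)=\sum_{t=1}^T\bigl[(\hat y_t-y_t)^2-(f(\mathbf{x}_t)-y_t)^2\bigr]\le C\bigl(\|f\|_{\mathcal{H}}^2+\ln^2T\bigr);$$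 (b) NONS-ALD can be carried out in space at most $C(d\ln T+\ln^2T)$ and with average time per round at most $C(d\ln T+\ln^2T)$, that is, in $O(\ln^2T)$ for both when the dimension $d$ is a constant. Here a program works with real numbers in exact arithmetic; the schoolbook numbers of scalar operations are charged for the operations on matrices, $d+1$ time steps for an evaluation of $\kappa$ and $n^3$ for a singular value decomposition of an $n\times n$ matrix (plus one step for each instruction); space is the largest number of memory cells in use (one for each stored real number and one for each register). One fixed program, which receives $\mu,\alpha,U,Y$ as inputs, does this for all data, and holds $S,\mathbf{A},\tilde{\mathbf{w}}$ in memory after each round. -/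

import Mathlib

noncomputable section

namespace NonsALD

open Matrix

/-! ### Kernels, kernel matrices, singular value decompositions -/

/-- The real-valued reproducing kernel `κ(a, b)` of a reproducing kernel Hilbert space `H` of
real functions on `X`. -/
def scalarKernel (H : Type*) {X : Type*} [NormedAddCommGroup H] [InnerProductSpace ℝ H]
    [CompleteSpace H] [RKHS ℝ H X ℝ] (a b : X) : ℝ :=
  RKHS.kernel H a b 1

/-- The matrix `(κ(p i, q k))` of two finite families of points. -/
def crossGram {X : Type*} (κ : X → X → ℝ) {m n : ℕ} (p : Fin m → X) (q : Fin n → X) :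
    Matrix (Fin m) (Fin n) ℝ :=
  Matrix.of fun i k => κ (p i) (q k)

/-- The kernel matrix `K_S` of a finite family of points. -/
def gram {X : Type*} (κ : X → X → ℝ) {n : ℕ} (p : Fin n → X) : Matrix (Fin n) (Fin n) ℝ :=
  crossGram κ p p

/-- The vector `Φ_Sᵀ φ(a) = (κ(p i, a))_i`. -/
def kvec {X : Type*} (κ : X → X → ℝ) {n : ℕ} (p : Fin n → X) (a : X) : Fin n → ℝ :=
  fun i => κ (p i) a

theorem gram_isHermitian (H : Type*) {X : Type*} [NormedAddCommGroup H] [InnerProductSpace ℝ H]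
    [CompleteSpace H] [RKHS ℝ H X ℝ] {n : ℕ} (p : Fin n → X) :
    (gram (scalarKernel H) p).IsHermitian := by
  ext i k
  have h : inner ℝ (RKHS.kernel H (p k) (p i) (1 : ℝ)) (1 : ℝ) =
      inner ℝ (RKHS.kernel H (p i) (p k) (1 : ℝ)) (1 : ℝ) := by
    rw [RKHS.kernel_inner H (p k) (p i) (1 : ℝ) 1, RKHS.kernel_inner H (p i) (p k) (1 : ℝ) 1]
    exact real_inner_comm _ _
  simpa [gram, crossGram, scalarKernel] using h

/-- A routine for the singular value decomposition `K = U Σ Uᵀ` (`U` orthogonal, `Σ` diagonal)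
of positive semidefinite matrices. The decomposition is not unique; everything below is meant
for an arbitrary such routine. -/
structure SVDRoutine where
  U : (n : ℕ) → Matrix (Fin n) (Fin n) ℝ → Matrix (Fin n) (Fin n) ℝ
  sigma : (n : ℕ) → Matrix (Fin n) (Fin n) ℝ → Fin n → ℝ
  orthogonal : ∀ (n : ℕ) (K : Matrix (Fin n) (Fin n) ℝ), K.PosSemidef → (U n K)ᵀ * U n K = 1
  decomposition : ∀ (n : ℕ) (K : Matrix (Fin n) (Fin n) ℝ), K.PosSemidef →
    K = U n K * diagonal (sigma n K) * (U n K)ᵀ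

open Classical in
/-- Such routines exist, by the spectral theorem. -/
instance : Inhabited SVDRoutine where
  default :=
    { U := fun _ K => if h : K.IsHermitian then (h.eigenvectorUnitary : Matrix _ _ ℝ) else 1
      sigma := fun _ K => if h : K.IsHermitian then h.eigenvalues else 0
      orthogonal := by
        intro n K hK
        have h := hK.isHermitian
        simp only [h, dif_pos]
        have := Unitary.star_mul_self_of_mem h.eigenvectorUnitary.2
        simpa [star_eq_conjTranspose] using this
      decomposition := by
        intro n K hK
        have h := hK.isHermitian
        simp only [h, dif_pos]
        have := h.spectral_theorem
        simpa [star_eq_conjTranspose, Unitary.conjStarAlgAut_apply, Function.comp_def] using this }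

/-! ### The algorithm NONS-ALD -/

/-- `Σ^{-1/2} Uᵀ` for the decomposition `K_S = U Σ Uᵀ`, so that
`𝒫_S^{1/2} = Σ^{-1/2} Uᵀ Φ_Sᵀ`. -/
def whiten (svd : SVDRoutine) {X : Type*} (κ : X → X → ℝ) {n : ℕ} (p : Fin n → X) :
    Matrix (Fin n) (Fin n) ℝ :=
  diagonal (fun i => (Real.sqrt (svd.sigma n (gram κ p) i))⁻¹) * (svd.U n (gram κ p))ᵀ

/-- The explicit (Nyström) feature vector `φ_j(a) = 𝒫_{S(j)}^{1/2} φ(a)`. -/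
def feature (svd : SVDRoutine) {X : Type*} (κ : X → X → ℝ) {n : ℕ} (p : Fin n → X) (a : X) :
    Fin n → ℝ :=
  whiten svd κ p *ᵥ kvec κ p a

/-- The matrix `𝒫_{S'}^{1/2} (𝒫_S^{1/2})ᵀ`, where `p'` lists `S'` and `p` lists `S`. -/
def transition (svd : SVDRoutine) {X : Type*} (κ : X → X → ℝ) {m n : ℕ} (p' : Fin m → X)
    (p : Fin n → X) : Matrix (Fin m) (Fin n) ℝ :=
  whiten svd κ p' * crossGram κ p' p * (whiten svd κ p)ᵀ

/-- The projection error `α_t = κ(a, a) - φ(a)ᵀ Φ_S β*` with `β* = K_S⁻¹ Φ_Sᵀ φ(a)`. -/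
def aldError {X : Type*} (κ : X → X → ℝ) {n : ℕ} (p : Fin n → X) (a : X) : ℝ :=
  κ a a - kvec κ p a ⬝ᵥ ((gram κ p)⁻¹ *ᵥ kvec κ p a)

/-- `‖v‖²_A = vᵀ A v`. -/
def sqNorm {n : ℕ} (A : Matrix (Fin n) (Fin n) ℝ) (v : Fin n → ℝ) : ℝ :=
  v ⬝ᵥ (A *ᵥ v)

/-- `w` is a minimizer of `‖u - w₀‖²_A` over all `u` with `|uᵀ φ| ≤ U`. -/
def IsProjection {n : ℕ} (A : Matrix (Fin n) (Fin n) ℝ) (φ : Fin n → ℝ) (U : ℝ)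
    (w₀ w : Fin n → ℝ) : Prop :=
  |w ⬝ᵥ φ| ≤ U ∧ ∀ u : Fin n → ℝ, |u ⬝ᵥ φ| ≤ U → sqNorm A (w - w₀) ≤ sqNorm A (u - w₀)

open Classical in
/-- The projection of `w₀` onto `{u | |uᵀ φ| ≤ U}` in the norm `‖·‖_A` (for positive definite `A`
and `0 ≤ U` it exists and is unique; where there is none, the value is `w₀`). -/
def project {n : ℕ} (A : Matrix (Fin n) (Fin n) ℝ) (φ : Fin n → ℝ) (U : ℝ) (w₀ : Fin n → ℝ) :
    Fin n → ℝ :=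
  if h : ∃ w, IsProjection A φ U w₀ w then h.choose else w₀

/-- What the learner stores between two rounds: the buffer `S(j)` (listed by `pts`), the matrix
`A_j(t)` and the not yet projected weight vector `w̃_j(t+1)`. -/
structure State (X : Type*) where
  j : ℕ
  pts : Fin j → X
  A : Matrix (Fin j) (Fin j) ℝ
  w : Fin j → ℝ

/-- The parameters `μ`, `α`, `U`, `Y` of the algorithm. -/
structure Params where
  μ : ℝ
  α : ℝ
  U : ℝ
  Y : ℝ

/-- The step size `η_t = 1 / (4 (U² + Y²))`. -/
def Params.η (par : Params) : ℝ := 1 / (4 * (par.U ^ 2 + par.Y ^ 2))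

section Algorithm

variable (svd : SVDRoutine) {X : Type*} (κ : X → X → ℝ) (par : Params)

/-- The initial state `S(0) = ∅`, `j = 0`. (The first instance always enters the buffer when
`α < 1 = κ(x, x)`, and `State.grow` then gives `w_1(1) = 0`, `A_1(0) = μ`.) -/
def State.initial (X : Type*) : State X where
  j := 0
  pts := Fin.elim0
  A := 0
  w := 0

/-- On receipt of the instance `a`: replace `w̃` by its projection onto `𝕎_t` in the norm
of `A`. -/
def State.projected (s : State X) (a : X) : State X where
  j := s.j
  pts := s.pts
  A := s.A
  w := project s.A (feature svd κ s.pts a) par.U s.w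

/-- Add the instance `a` to the buffer and transport `A` and `w` to the new feature space:
`A_j = μ I + Q (A_{j-1} - μ I) Qᵀ` and `w_j = Q w_{j-1}` with
`Q = 𝒫_{S(j)}^{1/2} (𝒫_{S(j-1)}^{1/2})ᵀ`. -/
def State.grow (s : State X) (a : X) : State X :=
  let pts' : Fin (s.j + 1) → X := Fin.snoc s.pts a
  let Q := transition svd κ pts' s.pts
  { j := s.j + 1
    pts := pts'
    A := par.μ • (1 : Matrix _ _ ℝ) + Q * (s.A - par.μ • (1 : Matrix _ _ ℝ)) * Qᵀ
    w := Q *ᵥ s.w }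

open Classical in
/-- The state with which the prediction at the instance `a` is made: project, and grow the buffer
if the ALD condition `α_t ≤ α` fails. -/
def State.ready (s : State X) (a : X) : State X :=
  if par.α < aldError κ s.pts a then (s.projected svd κ par a).grow svd κ par a
  else s.projected svd κ par a

/-- The prediction `w_j(t)ᵀ φ_j(a)`. -/
def State.predict (s : State X) (a : X) : ℝ :=
  s.w ⬝ᵥ feature svd κ s.pts a

/-- The Newton step at the example `(a, b)`: `∇ = 2 (ŷ - b) φ_j(a)`, `A ← A + η ∇ ∇ᵀ`,
`w̃ ← w - A⁻¹ ∇`. -/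
def State.newton (s : State X) (a : X) (b : ℝ) : State X :=
  let g : Fin s.j → ℝ := (2 * (s.predict svd κ a - b)) • feature svd κ s.pts a
  let A' := s.A + par.η • vecMulVec g g
  { j := s.j
    pts := s.pts
    A := A'
    w := s.w - A'⁻¹ *ᵥ g }

/-- The state after the first `t` rounds on the examples `(x 0, y 0), (x 1, y 1), …`. -/
def stateAt (x : ℕ → X) (y : ℕ → ℝ) : ℕ → State X
  | 0 => State.initial X
  | t + 1 => ((stateAt x y t).ready svd κ par (x t)).newton svd κ par (x t) (y t)

/-- The prediction `ŷ_t` of NONS-ALD; rounds are numbered from `0`. -/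
def prediction (x : ℕ → X) (y : ℕ → ℝ) (t : ℕ) : ℝ :=
  ((stateAt svd κ par x y t).ready svd κ par (x t)).predict svd κ (x t)

end Algorithm

/-- The regret over `T` rounds of the predictions `p` against the function `f`, for the square
loss. -/
def regret {X : Type*} (x : ℕ → X) (y : ℕ → ℝ) (T : ℕ) (p : ℕ → ℝ) (f : X → ℝ) : ℝ :=
  ∑ t ∈ Finset.range T, ((p t - y t) ^ 2 - (f (x t) - y t) ^ 2)

/-! ### Machine model

A machine has finitely many registers, each of which holds a real matrix of arbitrary size.
Exact real arithmetic is used. An instruction assigns the result of one operation to a register;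
it is charged its schoolbook number of scalar operations, plus one. An evaluation of the kernel
on two points of `ℝ^d` is charged `d + 1`, the decomposition of an `n × n` matrix `n ^ 3`. -/

/-- A matrix together with its size. -/
structure Mat where
  r : ℕ
  c : ℕ
  val : Matrix (Fin r) (Fin c) ℝ

/-- Entries outside of the matrix are read as `0`. -/
def Mat.entry (M : Mat) (i k : ℕ) : ℝ :=
  if h : i < M.r ∧ k < M.c then M.val ⟨i, h.1⟩ ⟨k, h.2⟩ else 0

/-- The `r × c` matrix with entries `f i k`. -/
def Mat.ofFn (r c : ℕ) (f : ℕ → ℕ → ℝ) : Mat := ⟨r, c, Matrix.of fun i k => f i k⟩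

/-- A real number as a `1 × 1` matrix. -/
def Mat.scalar (a : ℝ) : Mat := ⟨1, 1, Matrix.of fun _ _ => a⟩

/-- A vector as a column. -/
def Mat.ofVec {n : ℕ} (v : Fin n → ℝ) : Mat := ⟨n, 1, Matrix.of fun i _ => v i⟩

/-- A finite family of points of `ℝ^d` as the columns of a matrix. -/
def Mat.ofPoints {d n : ℕ} (p : Fin n → EuclideanSpace ℝ (Fin d)) : Mat :=
  ⟨d, n, Matrix.of fun i k => p k i⟩

/-- The `k`-th column as a point of `ℝ^d`. -/
def Mat.point (M : Mat) (d : ℕ) (k : ℕ) : EuclideanSpace ℝ (Fin d) :=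
  WithLp.toLp 2 fun i => M.entry i k

/-- The number of stored reals. -/
def Mat.size (M : Mat) : ℕ := M.r * M.c

/-- The operations of a machine with `n` registers. -/
inductive Op (n : ℕ) where
  /-- a natural number, as a `1 × 1` matrix -/
  | num (k : ℕ)
  /-- a copy -/
  | copy (a : Fin n)
  /-- the empty matrix with as many rows as `a` and no column -/
  | empty (a : Fin n)
  /-- the identity matrix with as many rows as `a` -/
  | one (a : Fin n)
  /-- the sum -/
  | add (a b : Fin n)
  /-- the difference -/
  | sub (a b : Fin n)
  /-- the matrix product -/
  | mul (a b : Fin n)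
  /-- the multiple of `a` by the scalar `s` -/
  | smul (s a : Fin n)
  /-- the transpose -/
  | transpose (a : Fin n)
  /-- the reciprocal of each entry (`0` for the entry `0`) -/
  | inv (a : Fin n)
  /-- the square root of each entry -/
  | sqrt (a : Fin n)
  /-- the diagonal matrix of a column -/
  | diag (a : Fin n)
  /-- the columns of `a` followed by those of `b` -/
  | hcat (a b : Fin n)
  /-- the kernel values of the columns of `a` against those of `b` -/
  | kernel (a b : Fin n)
  /-- the orthogonal factor of the decomposition of `a` -/
  | svdU (a : Fin n)
  /-- the column of diagonal entries of the decomposition of `a` -/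
  | svdSigma (a : Fin n)

/-- A square matrix with as many rows as `M`, as an input of the decomposition. -/
def Mat.square (M : Mat) : Matrix (Fin M.r) (Fin M.r) ℝ :=
  Matrix.of fun i k => M.entry i k

/-- The result of an operation; `R` gives the contents of the registers. -/
def Op.eval (svd : SVDRoutine) {d : ℕ}
    (κ : EuclideanSpace ℝ (Fin d) → EuclideanSpace ℝ (Fin d) → ℝ) {n : ℕ} (R : Fin n → Mat) :
    Op n → Mat
  | .num k => Mat.scalar k
  | .copy a => R a
  | .empty a => Mat.ofFn (R a).r 0 fun _ _ => 0
  | .one a => Mat.ofFn (R a).r (R a).r fun i k => if i = k then 1 else 0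
  | .add a b => Mat.ofFn (R a).r (R a).c fun i k => (R a).entry i k + (R b).entry i k
  | .sub a b => Mat.ofFn (R a).r (R a).c fun i k => (R a).entry i k - (R b).entry i k
  | .mul a b => Mat.ofFn (R a).r (R b).c fun i k =>
      ∑ l ∈ Finset.range (R a).c, (R a).entry i l * (R b).entry l k
  | .smul s a => Mat.ofFn (R a).r (R a).c fun i k => (R s).entry 0 0 * (R a).entry i k
  | .transpose a => Mat.ofFn (R a).c (R a).r fun i k => (R a).entry k i
  | .inv a => Mat.ofFn (R a).r (R a).c fun i k => ((R a).entry i k)⁻¹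
  | .sqrt a => Mat.ofFn (R a).r (R a).c fun i k => Real.sqrt ((R a).entry i k)
  | .diag a => Mat.ofFn (R a).r (R a).r fun i k => if i = k then (R a).entry i 0 else 0
  | .hcat a b => Mat.ofFn (R a).r ((R a).c + (R b).c) fun i k =>
      if k < (R a).c then (R a).entry i k else (R b).entry i (k - (R a).c)
  | .kernel a b => Mat.ofFn (R a).c (R b).c fun i k => κ ((R a).point d i) ((R b).point d k)
  | .svdU a => ⟨(R a).r, (R a).r, svd.U (R a).r (R a).square⟩
  | .svdSigma a => Mat.ofVec (svd.sigma (R a).r (R a).square)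

/-- The number of time steps charged for an operation. -/
def Op.cost (d : ℕ) {n : ℕ} (R : Fin n → Mat) : Op n → ℕ
  | .num _ => 1
  | .copy a => (R a).size + 1
  | .empty _ => 1
  | .one a => (R a).r * (R a).r + 1
  | .add a _ => (R a).size + 1
  | .sub a _ => (R a).size + 1
  | .mul a b => (R a).r * (R b).c * (2 * (R a).c + 1) + 1
  | .smul _ a => (R a).size + 1
  | .transpose a => (R a).size + 1
  | .inv a => (R a).size + 1
  | .sqrt a => (R a).size + 1
  | .diag a => (R a).r * (R a).r + 1
  | .hcat a b => (R a).r * ((R a).c + (R b).c) + 1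
  | .kernel a b => (R a).c * (R b).c * (d + 1) + 1
  | .svdU a => (R a).r ^ 3 + 1
  | .svdSigma a => (R a).r ^ 3 + 1

/-- Blocks of code: assignments, sequencing, and branching on the sign of a scalar. -/
inductive Code (n : ℕ) where
  | skip
  | set (dst : Fin n) (op : Op n)
  | seq (p q : Code n)
  | ifPos (a : Fin n) (p q : Code n)

/-- A configuration: the registers, the number of time steps so far, and the largest number of
memory cells in use so far. -/
structure Config (n : ℕ) where
  reg : Fin n → Mat
  time : ℕ
  space : ℕ

/-- The number of memory cells in use: the stored reals, and one cell for each register. -/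
def cells {n : ℕ} (R : Fin n → Mat) : ℕ := ∑ i, ((R i).size + 1)

/-- Load an input into a register. -/
def Config.load {n : ℕ} (cfg : Config n) (a : Fin n) (M : Mat) : Config n where
  reg := Function.update cfg.reg a M
  time := cfg.time + (M.size + 1)
  space := max cfg.space (cells cfg.reg + M.size)

open Classical in
/-- The effect of a block of code. While an assignment is carried out, the old contents of the
registers and the new value are both in memory. -/
def Code.exec (svd : SVDRoutine) {d : ℕ}
    (κ : EuclideanSpace ℝ (Fin d) → EuclideanSpace ℝ (Fin d) → ℝ) {n : ℕ} :
    Code n → Config n → Config n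
  | .skip, cfg => cfg
  | .set dst op, cfg =>
      { reg := Function.update cfg.reg dst (op.eval svd κ cfg.reg)
        time := cfg.time + op.cost d cfg.reg
        space := max cfg.space (cells cfg.reg + (op.eval svd κ cfg.reg).size) }
  | .seq p q, cfg => q.exec svd κ (p.exec svd κ cfg)
  | .ifPos a p q, cfg =>
      if 0 < (cfg.reg a).entry 0 0 then
        p.exec svd κ { reg := cfg.reg, time := cfg.time + 1, space := cfg.space }
      else q.exec svd κ { reg := cfg.reg, time := cfg.time + 1, space := cfg.space }

/-- An online program. The block `init` is run once. In each round, the instance is loaded into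
`xReg`, `predictCode` is run, the prediction is read off `outReg`, the label is loaded into `yReg`,
and `updateCode` is run. The parameters are loaded at the start. The registers `bufReg`, `covReg`,
`weightReg` are those in which the program keeps the buffer, the matrix `A` and the weight
vector. -/
structure Program where
  n : ℕ
  muReg : Fin n
  alphaReg : Fin n
  radReg : Fin n
  boundReg : Fin n
  xReg : Fin n
  yReg : Fin n
  outReg : Fin n
  bufReg : Fin n
  covReg : Fin n
  weightReg : Fin n
  init : Code n
  predictCode : Code n
  updateCode : Code n

section Run

variable (P : Program) (svd : SVDRoutine) {d : ℕ}
  (κ : EuclideanSpace ℝ (Fin d) → EuclideanSpace ℝ (Fin d) → ℝ) (par : Params)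

/-- The configuration at the start of the first round. -/
def Program.start : Config P.n :=
  P.init.exec svd κ
    (((((({ reg := fun _ => ⟨0, 0, 0⟩, time := 0, space := P.n } : Config P.n).load
      P.muReg (Mat.scalar par.μ)).load
      P.alphaReg (Mat.scalar par.α)).load
      P.radReg (Mat.scalar par.U)).load
      P.boundReg (Mat.scalar par.Y)))

/-- The first half of a round: the configuration in which the prediction has been made. -/
def Program.halfRound (cfg : Config P.n) (a : EuclideanSpace ℝ (Fin d)) : Config P.n :=
  P.predictCode.exec svd κ (cfg.load P.xReg (Mat.ofPoints fun _ : Fin 1 => a))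

/-- The configuration after the first `t` rounds. -/
def Program.configAt (x : ℕ → EuclideanSpace ℝ (Fin d)) (y : ℕ → ℝ) : ℕ → Config P.n
  | 0 => P.start svd κ par
  | t + 1 =>
      P.updateCode.exec svd κ
        ((P.halfRound svd κ (Program.configAt x y t) (x t)).load P.yReg (Mat.scalar (y t)))

/-- The prediction that the program makes in round `t`. -/
def Program.output (x : ℕ → EuclideanSpace ℝ (Fin d)) (y : ℕ → ℝ) (t : ℕ) : ℝ :=
  ((P.halfRound svd κ (P.configAt svd κ par x y t) (x t)).reg P.outReg).entry 0 0

/-- The program carries out NONS-ALD for `T` rounds on the given examples: it makes the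
same predictions, and after each round its registers hold the buffer, the matrix `A_j(t)` and
the vector `w̃_j(t+1)` of the algorithm. -/
def Program.Implements (x : ℕ → EuclideanSpace ℝ (Fin d)) (y : ℕ → ℝ) (T : ℕ) : Prop :=
  ∀ t < T, P.output svd κ par x y t = prediction svd κ par x y t ∧
    (P.configAt svd κ par x y (t + 1)).reg P.bufReg =
      Mat.ofPoints (stateAt svd κ par x y (t + 1)).pts ∧
    (P.configAt svd κ par x y (t + 1)).reg P.covReg =
      ⟨_, _, (stateAt svd κ par x y (t + 1)).A⟩ ∧
    (P.configAt svd κ par x y (t + 1)).reg P.weightReg =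
      Mat.ofVec (stateAt svd κ par x y (t + 1)).w

/-- The number of time steps used in `T` rounds. -/
def Program.time (x : ℕ → EuclideanSpace ℝ (Fin d)) (y : ℕ → ℝ) (T : ℕ) : ℕ :=
  (P.configAt svd κ par x y T).time

/-- The largest number of memory cells in use during `T` rounds. -/
def Program.space (x : ℕ → EuclideanSpace ℝ (Fin d)) (y : ℕ → ℝ) (T : ℕ) : ℕ :=
  (P.configAt svd κ par x y T).space

end Run

end NonsALD

end

/-!
The regret bound rests on the potential `‖w - u‖²_A + μ (‖f‖² - ‖u‖²)`, where `u` are the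
coordinates (`coords`) of the projection of `f` onto the span of the buffer. Projecting the weight
vector does not increase it (`potential_projected_le`, by the obtuse angle property). When the
buffer grows, the transition matrix `Q` is an isometry (`transition_transpose_mul_self`), the
coordinates of `f` restrict along it, and both the potential and the determinant of `A` relative to
that of `μ I` are preserved (`potential_grow`, `logDet_grow`). In the Newton step, the curvature of
the square loss pays for the linearization, and the remaining term `∇ᵀ A⁻¹ ∇` is bounded by the
growth of `ln det A` (`potential_newton_le`). Comparing with `u` instead of `f` costs `O(√α)` in
each round (`sq_coords_sub_le`). Altogether the regret is `O(‖f‖² + j ln T + T √α)` for the final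
size `j` of the buffer, and `T √α ≤ ln² T`.

The size of the buffer is `O(ln T)`. The Schur complement of a new point in the kernel matrix of the
buffer is its projection error, which exceeds `α`; hence the determinant of this matrix is at least
`α ^ j` (`det_gram_snoc`, `Invariant`). On the other hand the matrix is a principal submatrix of
the full kernel matrix, so that Cauchy interlacing (`eigenvalues₀_submatrix_le`) bounds its
determinant by `∏ i ≤ j, R₀ r ^ i`. Comparing the logarithms gives `j = O(ln T)`
(`Invariant.card_le`).

The program keeps, besides the state of the algorithm, the whitening matrix and the inverse of `A`.
A round in which the buffer does not grow then takes only a linear number of kernel evaluations and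
matrix operations of quadratic cost: the projection has a closed form (`project_eq`), and the
inverse is updated by the Sherman–Morrison formula (`inv_add_vecMulVec`). In a round with growth
these matrices are recomputed in cubic time, but there are at most `j` such rounds, and their total
`O(ln⁴ T + d ln³ T)` is `O(T (ln² T + d ln T))` because `ln² T ≤ 4 T`. The values computed by the
program are followed through `Code.regs` (`Stores`, `roundReady`). Its time and space are bounded
through static shapes of the registers: a decidable check (`Code.wellTyped`) bounds each instruction
in terms of the dimension and the largest size of the buffer (`Config.Bounded.exec`,
`bounded_configAt`).
-/

noncomputable section

namespace NonsALD

open Matrix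

/-! ### Kernel matrices in a reproducing kernel Hilbert space -/

section Kernel

variable {H : Type*} {X : Type*} [NormedAddCommGroup H] [InnerProductSpace ℝ H]
  [CompleteSpace H] [RKHS ℝ H X ℝ]

variable (H) in
/-- The feature `φ(a) = κ(a, ·)` of a point `a`, as an element of the Hilbert space. -/
def featureMap (a : X) : H := RKHS.kerFun H a (1 : ℝ)

/-- The values of a function at a finite family of points. -/
def values (f : H) {n : ℕ} (p : Fin n → X) : Fin n → ℝ := fun i => f (p i)

theorem inner_featureMap (f : H) (a : X) : inner ℝ f (featureMap H a) = f a := by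
  simp [featureMap, RKHS.inner_kerFun]

theorem scalarKernel_eq_inner (a b : X) :
    scalarKernel H a b = inner ℝ (featureMap H a) (featureMap H b) := by
  have h := RKHS.kernel_inner H a b (1 : ℝ) 1
  rw [real_inner_comm]
  simpa [scalarKernel, featureMap, -RKHS.kerFun_inner, -RKHS.inner_kerFun] using h

theorem featureMap_apply (a b : X) : featureMap H a b = scalarKernel H b a := by
  rw [← inner_featureMap, scalarKernel_eq_inner, real_inner_comm]

theorem scalarKernel_comm (a b : X) : scalarKernel H a b = scalarKernel H b a := by
  rw [scalarKernel_eq_inner, scalarKernel_eq_inner, real_inner_comm]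

theorem values_featureMap {n : ℕ} (p : Fin n → X) (a : X) :
    values (featureMap H a) p = kvec (scalarKernel H) p a := by
  ext i
  simp [values, kvec, featureMap_apply]

/-- The linear combination of the features of `p` with coefficients `β`. -/
def combination (H : Type*) {X : Type*} [NormedAddCommGroup H] [InnerProductSpace ℝ H]
    [CompleteSpace H] [RKHS ℝ H X ℝ] {n : ℕ} (p : Fin n → X) (β : Fin n → ℝ) : H :=
  ∑ i, β i • featureMap H (p i)

theorem inner_combination (f : H) {n : ℕ} (p : Fin n → X) (β : Fin n → ℝ) :
    inner ℝ f (combination H p β) = values f p ⬝ᵥ β := by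
  simp [combination, inner_sum, inner_smul_right, inner_featureMap, dotProduct, values, mul_comm]

theorem values_combination {m n : ℕ} (q : Fin m → X) (p : Fin n → X) (β : Fin n → ℝ) :
    values (combination H p β) q = crossGram (scalarKernel H) q p *ᵥ β := by
  ext i
  rw [values, ← inner_featureMap, real_inner_comm, inner_combination, values_featureMap]
  simp [mulVec, crossGram, kvec, dotProduct, scalarKernel_comm]

theorem norm_combination_sq {n : ℕ} (p : Fin n → X) (β : Fin n → ℝ) :
    ‖combination H p β‖ ^ 2 = β ⬝ᵥ (gram (scalarKernel H) p *ᵥ β) := by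
  rw [← real_inner_self_eq_norm_sq, inner_combination, values_combination, dotProduct_comm, gram]

theorem gram_posSemidef {n : ℕ} (p : Fin n → X) : (gram (scalarKernel H) p).PosSemidef := by
  refine PosSemidef.of_dotProduct_mulVec_nonneg (gram_isHermitian H p) fun β => ?_
  simp [← norm_combination_sq]

theorem norm_featureMap_sq (a : X) : ‖featureMap H a‖ ^ 2 = scalarKernel H a a := by
  rw [← real_inner_self_eq_norm_sq, scalarKernel_eq_inner]

/-- The squared distance of a feature to the span of the features of `p` is the projection
error of the approximate linear dependence test. -/
theorem norm_residual_sq {n : ℕ} (p : Fin n → X) (hp : (gram (scalarKernel H) p).PosDef)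
    (a : X) :
    ‖featureMap H a - combination H p
      ((gram (scalarKernel H) p)⁻¹ *ᵥ kvec (scalarKernel H) p a)‖ ^ 2
      = aldError (scalarKernel H) p a := by
  have hdet : IsUnit (gram (scalarKernel H) p).det := hp.det_pos.ne'.isUnit
  rw [norm_sub_sq_real, norm_combination_sq, inner_combination, values_featureMap,
    mulVec_mulVec, mul_nonsing_inv _ hdet, one_mulVec, norm_featureMap_sq, aldError,
    dotProduct_comm (_ *ᵥ _)]
  ring

/-- Replacing a feature by its projection onto the span of the features of `p` changes the value
of `f` by at most `‖f‖` times the distance. -/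
theorem abs_apply_sub_le {n : ℕ} (p : Fin n → X) (hp : (gram (scalarKernel H) p).PosDef)
    (f : H) (a : X) :
    |f a - values f p ⬝ᵥ ((gram (scalarKernel H) p)⁻¹ *ᵥ kvec (scalarKernel H) p a)|
      ≤ ‖f‖ * √(aldError (scalarKernel H) p a) := by
  rw [← norm_residual_sq p hp, Real.sqrt_sq (norm_nonneg _), ← inner_featureMap f a,
    ← inner_combination, ← inner_sub_right]
  exact abs_real_inner_le_norm _ _

/-- The orthogonal projection of `f` onto the span of the features of `p` has norm at most
`‖f‖`. -/
theorem values_dotProduct_inv_le {n : ℕ} (p : Fin n → X)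
    (hp : (gram (scalarKernel H) p).PosDef) (f : H) :
    values f p ⬝ᵥ ((gram (scalarKernel H) p)⁻¹ *ᵥ values f p) ≤ ‖f‖ ^ 2 := by
  have hdet : IsUnit (gram (scalarKernel H) p).det := hp.det_pos.ne'.isUnit
  set g := combination H p ((gram (scalarKernel H) p)⁻¹ *ᵥ values f p) with hg
  have h1 : inner ℝ f g = values f p ⬝ᵥ ((gram (scalarKernel H) p)⁻¹ *ᵥ values f p) :=
    inner_combination _ _ _
  have h2 : ‖g‖ ^ 2 = values f p ⬝ᵥ ((gram (scalarKernel H) p)⁻¹ *ᵥ values f p) := by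
    rw [hg, norm_combination_sq, mulVec_mulVec, mul_nonsing_inv _ hdet, one_mulVec,
      dotProduct_comm]
  have h3 : ‖f - g‖ ^ 2 = ‖f‖ ^ 2 - 2 * inner ℝ f g + ‖g‖ ^ 2 := norm_sub_sq_real f g
  nlinarith [sq_nonneg ‖f - g‖]

variable {κ : X → X → ℝ}

/-- The Schur complement of the old kernel matrix in the new one is the projection error. -/
theorem det_gram_snoc {n : ℕ} (p : Fin n → X) (hp : (gram (scalarKernel H) p).PosDef) (a : X) :
    (gram (scalarKernel H) (Fin.snoc p a : Fin (n + 1) → X)).det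
      = (gram (scalarKernel H) p).det * aldError (scalarKernel H) p a := by
  have : Invertible (gram (scalarKernel H) p) :=
    Matrix.invertibleOfIsUnitDet _ hp.det_pos.ne'.isUnit
  have h : (gram (scalarKernel H) (Fin.snoc p a : Fin (n + 1) → X)).submatrix
      finSumFinEquiv finSumFinEquiv
      = fromBlocks (gram (scalarKernel H) p)
        (Matrix.of fun i (_ : Fin 1) => kvec (scalarKernel H) p a i)
        (Matrix.of fun (_ : Fin 1) i => kvec (scalarKernel H) p a i)
        (Matrix.of fun _ _ => scalarKernel H a a) := by
    have hl : ∀ k : Fin 1, Fin.natAdd n k = Fin.last n := fun k => by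
      rw [Subsingleton.elim k 0]; rfl
    have hc : ∀ i : Fin n, Fin.castAdd 1 i = Fin.castSucc i := fun _ => rfl
    ext i k
    rcases i with i | i <;> rcases k with k | k <;>
      simp [gram, crossGram, kvec, hl, hc, scalarKernel_comm]
  rw [← Matrix.det_submatrix_equiv_self finSumFinEquiv, h, det_fromBlocks₁₁, det_fin_one]
  congr 1
  rw [invOf_eq_nonsing_inv, Matrix.mul_assoc]
  simp [aldError, Matrix.mul_apply, dotProduct, mulVec]

end Kernel

/-! ### Whitening and transition matrices -/

section Whitening

variable (svd : SVDRoutine)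

theorem SVDRoutine.mul_transpose {n : ℕ} {K : Matrix (Fin n) (Fin n) ℝ} (hK : K.PosSemidef) :
    svd.U n K * (svd.U n K)ᵀ = 1 :=
  mul_eq_one_comm.mp (svd.orthogonal n K hK)

theorem SVDRoutine.sigma_pos {n : ℕ} {K : Matrix (Fin n) (Fin n) ℝ} (hK : K.PosDef)
    (i : Fin n) : 0 < svd.sigma n K i := by
  have ho := svd.orthogonal n K hK.posSemidef
  have hd : (svd.U n K)ᵀ * K * svd.U n K = diagonal (svd.sigma n K) := by
    conv_lhs =>
      arg 1
      arg 2
      rw [svd.decomposition n K hK.posSemidef]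
    rw [show (svd.U n K)ᵀ * (svd.U n K * diagonal (svd.sigma n K) * (svd.U n K)ᵀ) * svd.U n K
      = ((svd.U n K)ᵀ * svd.U n K) * diagonal (svd.sigma n K) * ((svd.U n K)ᵀ * svd.U n K) by
        simp only [Matrix.mul_assoc], ho, Matrix.one_mul, Matrix.mul_one]
  have hinj : Function.Injective (svd.U n K).mulVec := by
    intro v w hvw
    have := congrArg ((svd.U n K)ᵀ *ᵥ ·) hvw
    simpa [mulVec_mulVec, ho] using this
  have h := hK.conjTranspose_mul_mul_same hinj
  rw [conjTranspose_eq_transpose_of_trivial, hd] at h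
  exact posDef_diagonal_iff.mp h i

/-- The inverse of a positive definite matrix from its singular value decomposition; this is how
the program inverts matrices. -/
theorem SVDRoutine.inv_eq {n : ℕ} {K : Matrix (Fin n) (Fin n) ℝ} (hK : K.PosDef) :
    K⁻¹ = svd.U n K * diagonal (fun i => (svd.sigma n K i)⁻¹) * (svd.U n K)ᵀ := by
  refine inv_eq_right_inv ?_
  conv_lhs =>
    arg 1
    rw [svd.decomposition n K hK.posSemidef]
  have hd : diagonal (svd.sigma n K) * diagonal (fun i => (svd.sigma n K i)⁻¹) = 1 := by
    rw [diagonal_mul_diagonal, ← diagonal_one]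
    congr 1
    ext i
    exact mul_inv_cancel₀ (svd.sigma_pos hK i).ne'
  calc _ = svd.U n K * (diagonal (svd.sigma n K) * ((svd.U n K)ᵀ * svd.U n K)
        * diagonal (fun i => (svd.sigma n K i)⁻¹)) * (svd.U n K)ᵀ := by
        simp only [Matrix.mul_assoc]
    _ = 1 := by
        rw [svd.orthogonal n K hK.posSemidef, Matrix.mul_one, hd, Matrix.mul_one,
          svd.mul_transpose hK.posSemidef]

variable {X : Type*} {κ : X → X → ℝ}

theorem whiten_transpose_mul {n : ℕ} {p : Fin n → X} (hp : (gram κ p).PosDef) :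
    (whiten svd κ p)ᵀ * whiten svd κ p = (gram κ p)⁻¹ := by
  have hd : diagonal (fun i => (√(svd.sigma n (gram κ p) i))⁻¹)
      * diagonal (fun i => (√(svd.sigma n (gram κ p) i))⁻¹)
      = diagonal (fun i => (svd.sigma n (gram κ p) i)⁻¹) := by
    rw [diagonal_mul_diagonal]
    congr 1
    ext i
    rw [← mul_inv, Real.mul_self_sqrt (svd.sigma_pos hp i).le]
  rw [whiten, transpose_mul, transpose_transpose, diagonal_transpose, Matrix.mul_assoc,
    ← Matrix.mul_assoc (diagonal _) (diagonal _), hd, svd.inv_eq hp, Matrix.mul_assoc]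

theorem whiten_mul_gram_mul {n : ℕ} {p : Fin n → X} (hp : (gram κ p).PosDef) :
    whiten svd κ p * gram κ p * (whiten svd κ p)ᵀ = 1 := by
  have hdet : IsUnit (gram κ p).det := hp.det_pos.ne'.isUnit
  refine mul_eq_one_comm.mp ?_
  rw [← Matrix.mul_assoc, whiten_transpose_mul svd hp, nonsing_inv_mul _ hdet]

theorem whiten_mulVec_dotProduct {n : ℕ} {p : Fin n → X} (hp : (gram κ p).PosDef)
    (v v' : Fin n → ℝ) :
    (whiten svd κ p *ᵥ v) ⬝ᵥ (whiten svd κ p *ᵥ v') = v ⬝ᵥ ((gram κ p)⁻¹ *ᵥ v') := by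
  rw [← whiten_transpose_mul svd hp, ← mulVec_mulVec, mulVec_transpose, dotProduct_comm v,
    ← dotProduct_mulVec, dotProduct_comm]

/-- The matrix of the inclusion of the old buffer into the new one. -/
def inclusion (n : ℕ) : Matrix (Fin (n + 1)) (Fin n) ℝ :=
  Matrix.of fun i k => if i = k.castSucc then 1 else 0

theorem inclusion_transpose_mulVec {n : ℕ} (v : Fin (n + 1) → ℝ) :
    (inclusion n)ᵀ *ᵥ v = fun i => v i.castSucc := by
  ext i
  simp [inclusion, mulVec, dotProduct]

theorem mul_inclusion {m n : ℕ} (M : Matrix (Fin m) (Fin (n + 1)) ℝ) :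
    M * inclusion n = M.submatrix id Fin.castSucc := by
  ext i k
  simp [inclusion, Matrix.mul_apply]

theorem inclusion_transpose_mul {m n : ℕ} (M : Matrix (Fin (n + 1)) (Fin m) ℝ) :
    (inclusion n)ᵀ * M = M.submatrix Fin.castSucc id := by
  ext i k
  simp [inclusion, Matrix.mul_apply]

theorem crossGram_snoc {n : ℕ} (p : Fin n → X) (a : X) :
    crossGram κ (Fin.snoc p a : Fin (n + 1) → X) p
      = gram κ (Fin.snoc p a : Fin (n + 1) → X) * inclusion n := by
  rw [mul_inclusion]
  ext i k
  simp [gram, crossGram]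

theorem inclusion_gram_inclusion {n : ℕ} (p : Fin n → X) (a : X) :
    (inclusion n)ᵀ * gram κ (Fin.snoc p a : Fin (n + 1) → X) * inclusion n = gram κ p := by
  rw [inclusion_transpose_mul, mul_inclusion]
  ext i k
  simp [gram, crossGram]

theorem transition_transpose {n : ℕ} {p : Fin n → X} {a : X}
    (hs : (gram κ (Fin.snoc p a : Fin (n + 1) → X))ᵀ = gram κ (Fin.snoc p a : Fin (n + 1) → X)) :
    (transition svd κ (Fin.snoc p a : Fin (n + 1) → X) p)ᵀ
      = whiten svd κ p * (inclusion n)ᵀ * gram κ (Fin.snoc p a : Fin (n + 1) → X)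
        * (whiten svd κ (Fin.snoc p a : Fin (n + 1) → X))ᵀ := by
  rw [transition, crossGram_snoc]
  simp only [transpose_mul, transpose_transpose, hs, Matrix.mul_assoc]

/-- The transition matrix restricts coordinates with respect to the new buffer to coordinates with
respect to the old one. -/
theorem transition_transpose_mul_whiten {n : ℕ} {p : Fin n → X} {a : X}
    (hp : (gram κ (Fin.snoc p a : Fin (n + 1) → X)).PosDef) :
    (transition svd κ (Fin.snoc p a : Fin (n + 1) → X) p)ᵀ
      * whiten svd κ (Fin.snoc p a : Fin (n + 1) → X) = whiten svd κ p * (inclusion n)ᵀ := by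
  have hdet : IsUnit (gram κ (Fin.snoc p a : Fin (n + 1) → X)).det := hp.det_pos.ne'.isUnit
  have hs : (gram κ (Fin.snoc p a : Fin (n + 1) → X))ᵀ = gram κ (Fin.snoc p a : Fin (n + 1) → X) :=
    (conjTranspose_eq_transpose_of_trivial _).symm.trans hp.isHermitian
  rw [transition_transpose svd hs, Matrix.mul_assoc, whiten_transpose_mul svd hp, Matrix.mul_assoc,
    mul_nonsing_inv _ hdet, Matrix.mul_one]

/-- The transition matrix is an isometry: it expresses the orthonormal basis of the span of the old
features, given by the whitening matrix, in the one for the new features. -/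
theorem transition_transpose_mul_self {n : ℕ} {p : Fin n → X} {a : X}
    (hp : (gram κ p).PosDef) (hp' : (gram κ (Fin.snoc p a : Fin (n + 1) → X)).PosDef) :
    (transition svd κ (Fin.snoc p a : Fin (n + 1) → X) p)ᵀ
      * transition svd κ (Fin.snoc p a : Fin (n + 1) → X) p = 1 := by
  conv_lhs =>
    arg 2
    rw [transition, crossGram_snoc]
  rw [← Matrix.mul_assoc, ← Matrix.mul_assoc, transition_transpose_mul_whiten svd hp',
    ← whiten_mul_gram_mul svd hp, ← inclusion_gram_inclusion p a]
  simp only [Matrix.mul_assoc]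

end Whitening

/-! ### Coordinates of functions and the projection error -/

section Coordinates

variable (svd : SVDRoutine) {H : Type*} {X : Type*} [NormedAddCommGroup H]
  [InnerProductSpace ℝ H] [CompleteSpace H] [RKHS ℝ H X ℝ]

/-- The coordinates of the orthogonal projection of `f` onto the span of the features of `p`, in
the orthonormal basis given by the whitening matrix. -/
def coords (f : H) {n : ℕ} (p : Fin n → X) : Fin n → ℝ :=
  whiten svd (scalarKernel H) p *ᵥ values f p

theorem coords_featureMap {n : ℕ} (p : Fin n → X) (a : X) :
    coords svd (featureMap H a) p = feature svd (scalarKernel H) p a := by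
  rw [coords, values_featureMap, feature]

theorem coords_dotProduct_self_le {n : ℕ} {p : Fin n → X}
    (hp : (gram (scalarKernel H) p).PosDef) (f : H) :
    coords svd f p ⬝ᵥ coords svd f p ≤ ‖f‖ ^ 2 := by
  rw [coords, whiten_mulVec_dotProduct svd hp]
  exact values_dotProduct_inv_le p hp f

/-- The coordinates of the comparator before a growth step are those after it, restricted by the
isometry. -/
theorem transition_transpose_mulVec_coords {n : ℕ} {p : Fin n → X} {a : X}
    (hp : (gram (scalarKernel H) (Fin.snoc p a : Fin (n + 1) → X)).PosDef) (f : H) :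
    (transition svd (scalarKernel H) (Fin.snoc p a : Fin (n + 1) → X) p)ᵀ
      *ᵥ coords svd f (Fin.snoc p a : Fin (n + 1) → X) = coords svd f p := by
  rw [coords, mulVec_mulVec, transition_transpose_mul_whiten svd hp, ← mulVec_mulVec,
    inclusion_transpose_mulVec, coords]
  congr 1
  ext i
  simp [values]

theorem abs_apply_sub_coords_le {n : ℕ} {p : Fin n → X}
    (hp : (gram (scalarKernel H) p).PosDef) (f : H) (a : X) :
    |f a - coords svd f p ⬝ᵥ feature svd (scalarKernel H) p a|
      ≤ ‖f‖ * √(aldError (scalarKernel H) p a) := by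
  rw [coords, feature, whiten_mulVec_dotProduct svd hp]
  exact abs_apply_sub_le p hp f a

/-- The projection error in terms of the explicit feature vector; the program evaluates it in this
form, without a matrix inverse. -/
theorem aldError_eq {n : ℕ} {p : Fin n → X} (hp : (gram (scalarKernel H) p).PosDef) (a : X) :
    aldError (scalarKernel H) p a = scalarKernel H a a
      - feature svd (scalarKernel H) p a ⬝ᵥ feature svd (scalarKernel H) p a := by
  rw [feature, whiten_mulVec_dotProduct svd hp, aldError]

/-- The projected comparator satisfies the constraint of the projection step, as feature vectors
have norm at most `1`. -/
theorem abs_coords_dotProduct_feature_le {n : ℕ} {p : Fin n → X}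
    (hp : (gram (scalarKernel H) p).PosDef) (f : H) {a : X} (ha : scalarKernel H a a = 1) :
    |coords svd f p ⬝ᵥ feature svd (scalarKernel H) p a| ≤ ‖f‖ := by
  have h1 := coords_dotProduct_self_le svd hp f
  have h2 := coords_dotProduct_self_le svd hp (featureMap H a)
  rw [coords_featureMap, norm_featureMap_sq, ha] at h2
  refine abs_le_of_sq_le_sq ?_ (norm_nonneg f)
  have h3 : (coords svd f p ⬝ᵥ feature svd (scalarKernel H) p a) ^ 2
      ≤ (coords svd f p ⬝ᵥ coords svd f p)
        * (feature svd (scalarKernel H) p a ⬝ᵥ feature svd (scalarKernel H) p a) := by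
    simpa [dotProduct, sq] using Finset.sum_mul_sq_le_sq_mul_sq Finset.univ (coords svd f p)
      (feature svd (scalarKernel H) p a)
  have h4 : 0 ≤ coords svd f p ⬝ᵥ coords svd f p := by
    simpa using dotProduct_star_self_nonneg (coords svd f p)
  nlinarith

/-- A point of the buffer has projection error zero. -/
theorem aldError_snoc_self {n : ℕ} {p : Fin n → X} {a : X}
    (hp : (gram (scalarKernel H) (Fin.snoc p a : Fin (n + 1) → X)).PosDef) :
    aldError (scalarKernel H) (Fin.snoc p a : Fin (n + 1) → X) a = 0 := by
  set q : Fin (n + 1) → X := Fin.snoc p a with hq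
  have hdet : IsUnit (gram (scalarKernel H) q).det := hp.det_pos.ne'.isUnit
  have hlast : q (Fin.last n) = a := by simp [hq]
  have hk : kvec (scalarKernel H) q a
      = gram (scalarKernel H) q *ᵥ Pi.single (Fin.last n) 1 := by
    ext i
    simp [gram, crossGram, kvec, hlast]
  rw [aldError]
  conv_lhs =>
    arg 2
    arg 2
    rw [hk, mulVec_mulVec, nonsing_inv_mul _ hdet, one_mulVec]
  simp [kvec, hlast]

end Coordinates

/-! ### Projection in the norm of a positive definite matrix -/

section QuadraticForm

variable {n : ℕ} {A : Matrix (Fin n) (Fin n) ℝ}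

theorem _root_.Matrix.PosDef.transpose_eq (hA : A.PosDef) : Aᵀ = A :=
  (conjTranspose_eq_transpose_of_trivial _).symm.trans hA.isHermitian

theorem dotProduct_mulVec_comm (hA : Aᵀ = A) (v w : Fin n → ℝ) :
    v ⬝ᵥ (A *ᵥ w) = w ⬝ᵥ (A *ᵥ v) := by
  rw [dotProduct_mulVec, ← mulVec_transpose, hA, dotProduct_comm]

theorem sqNorm_sub (hA : Aᵀ = A) (v w : Fin n → ℝ) :
    sqNorm A (v - w) = sqNorm A v - 2 * (v ⬝ᵥ (A *ᵥ w)) + sqNorm A w := by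
  simp only [sqNorm, mulVec_sub, dotProduct_sub, sub_dotProduct, dotProduct_mulVec_comm hA w v]
  ring

theorem sqNorm_nonneg (hA : A.PosDef) (v : Fin n → ℝ) : 0 ≤ sqNorm A v := by
  simpa [sqNorm] using hA.posSemidef.dotProduct_mulVec_nonneg v

theorem sqNorm_pos (hA : A.PosDef) {v : Fin n → ℝ} (hv : v ≠ 0) : 0 < sqNorm A v := by
  simpa [sqNorm] using hA.dotProduct_mulVec_pos hv

theorem posDef_of_sqNorm_pos (hA : Aᵀ = A) (h : ∀ v : Fin n → ℝ, v ≠ 0 → 0 < sqNorm A v) :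
    A.PosDef := by
  refine PosDef.of_dotProduct_mulVec_pos ?_ fun {v} hv => by simpa [sqNorm] using h v hv
  rw [IsHermitian, conjTranspose_eq_transpose_of_trivial, hA]

/-- The amount by which `p` lies outside of the interval `[-U, U]`, with its sign. -/
def excess (U p : ℝ) : ℝ := p - max (-U) (min U p)

/-- The closed form of the projection of `w₀` onto `{u | |uᵀ φ| ≤ U}` in the norm of `A`: subtract
a multiple of `A⁻¹ φ`. For `φ = 0` the excess is `0`, and the value is `w₀`. -/
def explicitProjection (A : Matrix (Fin n) (Fin n) ℝ) (φ : Fin n → ℝ) (U : ℝ)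
    (w₀ : Fin n → ℝ) : Fin n → ℝ :=
  w₀ - (excess U (φ ⬝ᵥ w₀) * (φ ⬝ᵥ (A⁻¹ *ᵥ φ))⁻¹) • (A⁻¹ *ᵥ φ)

theorem excess_mul_inv_mul (hA : A.PosDef) {U : ℝ} (hU : 0 ≤ U) (φ w₀ : Fin n → ℝ) :
    excess U (φ ⬝ᵥ w₀) * (φ ⬝ᵥ (A⁻¹ *ᵥ φ))⁻¹ * (φ ⬝ᵥ (A⁻¹ *ᵥ φ)) = excess U (φ ⬝ᵥ w₀) := by
  by_cases hφ : φ = 0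
  · -- the inverse is the junk value `0`, but there is no excess either
    subst hφ
    simp [excess, hU]
  · have : 0 < φ ⬝ᵥ (A⁻¹ *ᵥ φ) := sqNorm_pos hA.inv hφ
    rw [mul_assoc, inv_mul_cancel₀ this.ne', mul_one]

theorem dotProduct_explicitProjection (hA : A.PosDef) {U : ℝ} (hU : 0 ≤ U)
    (φ w₀ : Fin n → ℝ) :
    φ ⬝ᵥ explicitProjection A φ U w₀ = max (-U) (min U (φ ⬝ᵥ w₀)) := by
  rw [explicitProjection, dotProduct_sub, dotProduct_smul, smul_eq_mul,
    excess_mul_inv_mul hA hU, excess]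
  ring

/-- The obtuse angle property of the projection. -/
theorem sqNorm_explicitProjection_add_le (hA : A.PosDef) {U : ℝ} (hU : 0 ≤ U)
    (φ w₀ u : Fin n → ℝ) (hu : |u ⬝ᵥ φ| ≤ U) :
    sqNorm A (explicitProjection A φ U w₀ - u) + sqNorm A (explicitProjection A φ U w₀ - w₀)
      ≤ sqNorm A (w₀ - u) := by
  have hdet : IsUnit A.det := hA.det_pos.ne'.isUnit
  set w := explicitProjection A φ U w₀ with hw
  set c := excess U (φ ⬝ᵥ w₀) * (φ ⬝ᵥ (A⁻¹ *ᵥ φ))⁻¹ with hc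
  have h1 : A *ᵥ (w - w₀) = -c • φ := by
    rw [hw, explicitProjection, sub_sub_cancel_left, mulVec_neg, mulVec_smul, mulVec_mulVec,
      mul_nonsing_inv _ hdet, one_mulVec, neg_smul]
  have h2 : sqNorm A (w₀ - u) = sqNorm A (w - u) - 2 * ((w - u) ⬝ᵥ (A *ᵥ (w - w₀)))
      + sqNorm A (w - w₀) := by
    rw [← sqNorm_sub hA.transpose_eq]
    congr 1
    abel
  have h3 : (w - u) ⬝ᵥ (A *ᵥ (w - w₀)) = -c * (max (-U) (min U (φ ⬝ᵥ w₀)) - u ⬝ᵥ φ) := by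
    rw [h1, dotProduct_smul, sub_dotProduct, dotProduct_comm w,
      hw, dotProduct_explicitProjection hA hU, smul_eq_mul]
  have hq : 0 ≤ (φ ⬝ᵥ (A⁻¹ *ᵥ φ))⁻¹ := inv_nonneg.mpr (sqNorm_nonneg hA.inv φ)
  have h4 : 0 ≤ excess U (φ ⬝ᵥ w₀) * (max (-U) (min U (φ ⬝ᵥ w₀)) - u ⬝ᵥ φ) := by
    obtain ⟨hu1, hu2⟩ := abs_le.mp hu
    rw [excess]
    rcases le_total U (φ ⬝ᵥ w₀) with h | h
    · rw [min_eq_left h, max_eq_right (by linarith)]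
      exact mul_nonneg (by linarith) (by linarith)
    · rw [min_eq_right h]
      rcases le_total (-U) (φ ⬝ᵥ w₀) with h' | h'
      · rw [max_eq_right h']
        simp
      · rw [max_eq_left h']
        exact mul_nonneg_of_nonpos_of_nonpos (by linarith) (by linarith)
  have h5 : 0 ≤ c * (max (-U) (min U (φ ⬝ᵥ w₀)) - u ⬝ᵥ φ) := by
    have := mul_nonneg hq h4
    rw [hc]
    linarith
  rw [h2, h3]
  linarith

theorem isProjection_explicitProjection (hA : A.PosDef) {U : ℝ} (hU : 0 ≤ U)
    (φ w₀ : Fin n → ℝ) : IsProjection A φ U w₀ (explicitProjection A φ U w₀) := by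
  constructor
  · rw [dotProduct_comm, dotProduct_explicitProjection hA hU, abs_le]
    exact ⟨le_max_left _ _, max_le (by linarith) (min_le_left _ _)⟩
  · intro u hu
    have h1 := sqNorm_explicitProjection_add_le hA hU φ w₀ u hu
    have h2 := sqNorm_nonneg hA (explicitProjection A φ U w₀ - u)
    have h3 : sqNorm A (u - w₀) = sqNorm A (w₀ - u) := by
      rw [← neg_sub w₀ u, sqNorm, mulVec_neg, neg_dotProduct_neg, sqNorm]
    linarith

theorem project_eq (hA : A.PosDef) {U : ℝ} (hU : 0 ≤ U) (φ w₀ : Fin n → ℝ) :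
    project A φ U w₀ = explicitProjection A φ U w₀ := by
  have hex := isProjection_explicitProjection hA hU φ w₀
  have h : ∃ w, IsProjection A φ U w₀ w := ⟨_, hex⟩
  rw [project, dif_pos h]
  obtain ⟨h1, h2⟩ := h.choose_spec
  set w := h.choose
  have h3 := h2 _ hex.1
  have h4 := sqNorm_explicitProjection_add_le hA hU φ w₀ w h1
  have h5 : sqNorm A (w - w₀) = sqNorm A (w₀ - w) := by
    rw [← neg_sub w₀ w, sqNorm, mulVec_neg, neg_dotProduct_neg, sqNorm]
  by_contra hne
  have h6 := sqNorm_pos hA (sub_ne_zero.mpr (Ne.symm hne))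
  linarith

end QuadraticForm

/-! ### Transport along an isometry -/

section Isometry

variable {m n : ℕ} {Q : Matrix (Fin m) (Fin n) ℝ} {A : Matrix (Fin n) (Fin n) ℝ} {μ : ℝ}

theorem sqNorm_transport (μ : ℝ) (Q : Matrix (Fin m) (Fin n) ℝ) (A : Matrix (Fin n) (Fin n) ℝ)
    (v : Fin m → ℝ) :
    sqNorm (μ • (1 : Matrix (Fin m) (Fin m) ℝ) + Q * (A - μ • (1 : Matrix _ _ ℝ)) * Qᵀ) v
      = μ * (v ⬝ᵥ v - (Qᵀ *ᵥ v) ⬝ᵥ (Qᵀ *ᵥ v)) + sqNorm A (Qᵀ *ᵥ v) := by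
  have h : v ⬝ᵥ ((Q * (A - μ • (1 : Matrix _ _ ℝ)) * Qᵀ) *ᵥ v)
      = (Qᵀ *ᵥ v) ⬝ᵥ ((A - μ • (1 : Matrix _ _ ℝ)) *ᵥ (Qᵀ *ᵥ v)) := by
    rw [Matrix.mul_assoc, ← mulVec_mulVec, ← mulVec_mulVec, dotProduct_mulVec, mulVec_transpose]
  rw [sqNorm, add_mulVec, dotProduct_add, h, sub_mulVec, dotProduct_sub, smul_mulVec, smul_mulVec,
    one_mulVec, one_mulVec, dotProduct_smul, dotProduct_smul, sqNorm, smul_eq_mul, smul_eq_mul]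
  ring

/-- The potential of the analysis does not change when the buffer grows: the loss of
`‖w - u‖²_A` is compensated by the growth of the norm of the projected comparator. -/
theorem sqNorm_transport_sub (hQ : Qᵀ * Q = 1) (w : Fin n → ℝ) (u' : Fin m → ℝ) :
    sqNorm (μ • (1 : Matrix (Fin m) (Fin m) ℝ) + Q * (A - μ • (1 : Matrix _ _ ℝ)) * Qᵀ)
        (Q *ᵥ w - u')
      = sqNorm A (w - Qᵀ *ᵥ u') + μ * (u' ⬝ᵥ u' - (Qᵀ *ᵥ u') ⬝ᵥ (Qᵀ *ᵥ u')) := by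
  have h1 : Qᵀ *ᵥ (Q *ᵥ w - u') = w - Qᵀ *ᵥ u' := by
    rw [mulVec_sub, mulVec_mulVec, hQ, one_mulVec]
  have h2 : (Q *ᵥ w) ⬝ᵥ (Q *ᵥ w) = w ⬝ᵥ w := by
    rw [dotProduct_mulVec, vecMul_mulVec, hQ, vecMul_one]
  have h3 : (Q *ᵥ w) ⬝ᵥ u' = w ⬝ᵥ (Qᵀ *ᵥ u') := by
    rw [dotProduct_comm, dotProduct_mulVec, ← mulVec_transpose, dotProduct_comm]
  rw [sqNorm_transport, h1]
  simp only [sub_dotProduct, dotProduct_sub, h2, h3, dotProduct_comm u' (Q *ᵥ w),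
    dotProduct_comm (Qᵀ *ᵥ u') w]
  ring

theorem posDef_transport (hQ : Qᵀ * Q = 1) (hA : A.PosDef) (hμ : 0 < μ) :
    (μ • (1 : Matrix (Fin m) (Fin m) ℝ) + Q * (A - μ • (1 : Matrix _ _ ℝ)) * Qᵀ).PosDef := by
  refine posDef_of_sqNorm_pos ?_ fun v hv => ?_
  · simp [transpose_mul, hA.transpose_eq, Matrix.mul_assoc]
  · rw [sqNorm_transport]
    have h1 : (v - Q *ᵥ (Qᵀ *ᵥ v)) ⬝ᵥ (v - Q *ᵥ (Qᵀ *ᵥ v))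
        = v ⬝ᵥ v - (Qᵀ *ᵥ v) ⬝ᵥ (Qᵀ *ᵥ v) := by
      have h2 : (Q *ᵥ (Qᵀ *ᵥ v)) ⬝ᵥ (Q *ᵥ (Qᵀ *ᵥ v)) = (Qᵀ *ᵥ v) ⬝ᵥ (Qᵀ *ᵥ v) := by
        rw [dotProduct_mulVec, vecMul_mulVec, hQ, vecMul_one]
      have h3 : v ⬝ᵥ (Q *ᵥ (Qᵀ *ᵥ v)) = (Qᵀ *ᵥ v) ⬝ᵥ (Qᵀ *ᵥ v) := by
        rw [dotProduct_mulVec, ← mulVec_transpose]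
      simp only [sub_dotProduct, dotProduct_sub, h2, h3, dotProduct_comm (Q *ᵥ (Qᵀ *ᵥ v)) v]
      ring
    have h4 : 0 ≤ v ⬝ᵥ v - (Qᵀ *ᵥ v) ⬝ᵥ (Qᵀ *ᵥ v) := by
      rw [← h1]
      simpa using dotProduct_star_self_nonneg (v - Q *ᵥ (Qᵀ *ᵥ v))
    by_cases h : Qᵀ *ᵥ v = 0
    · have hvv : 0 < v ⬝ᵥ v := by simpa using dotProduct_star_self_pos_iff.mpr hv
      rw [h]
      simpa [sqNorm] using mul_pos hμ hvv
    · have := sqNorm_pos hA h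
      have := mul_nonneg hμ.le h4
      linarith

/-- Growth multiplies the determinant by `μ`, so that the determinant relative to that of `μ I` does
not change. -/
theorem det_transport {Q : Matrix (Fin (n + 1)) (Fin n) ℝ} (hQ : Qᵀ * Q = 1) (hμ : 0 < μ) :
    (μ • (1 : Matrix (Fin (n + 1)) (Fin (n + 1)) ℝ)
      + Q * (A - μ • (1 : Matrix _ _ ℝ)) * Qᵀ).det = μ * A.det := by
  have h1 : μ • (1 : Matrix (Fin (n + 1)) (Fin (n + 1)) ℝ) + Q * (A - μ • (1 : Matrix _ _ ℝ)) * Qᵀ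
      = μ • (1 + Q * ((μ⁻¹ • A - 1) * Qᵀ)) := by
    rw [smul_add]
    congr 1
    rw [← Matrix.mul_smul, ← Matrix.smul_mul, smul_sub, smul_smul, mul_inv_cancel₀ hμ.ne', one_smul,
      Matrix.mul_assoc]
  rw [h1, det_smul, det_one_add_mul_comm, Matrix.mul_assoc, hQ, Matrix.mul_one,
    add_sub_cancel, det_smul, Fintype.card_fin, Fintype.card_fin, pow_succ, inv_pow]
  field_simp

theorem trace_transport {Q : Matrix (Fin (n + 1)) (Fin n) ℝ} (hQ : Qᵀ * Q = 1) :
    (μ • (1 : Matrix (Fin (n + 1)) (Fin (n + 1)) ℝ)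
      + Q * (A - μ • (1 : Matrix _ _ ℝ)) * Qᵀ).trace = A.trace + μ := by
  rw [trace_add, trace_mul_cycle, hQ, Matrix.one_mul, trace_sub, trace_smul, trace_smul, trace_one,
    trace_one]
  simp
  ring

end Isometry

/-! ### Rank-one updates -/

section RankOne

variable {n : ℕ} {A : Matrix (Fin n) (Fin n) ℝ} {η : ℝ}

theorem sqNorm_add_vecMulVec (A : Matrix (Fin n) (Fin n) ℝ) (η : ℝ) (g v : Fin n → ℝ) :
    sqNorm (A + η • vecMulVec g g) v = sqNorm A v + η * (g ⬝ᵥ v) ^ 2 := by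
  rw [sqNorm, add_mulVec, dotProduct_add, smul_mulVec, dotProduct_smul, sqNorm, smul_eq_mul,
    vecMulVec_mulVec]
  simp only [op_smul_eq_smul, dotProduct_smul, smul_eq_mul, dotProduct_comm v g]
  ring

theorem posDef_add_vecMulVec (hA : A.PosDef) (hη : 0 ≤ η) (g : Fin n → ℝ) :
    (A + η • vecMulVec g g).PosDef := by
  refine posDef_of_sqNorm_pos ?_ fun v hv => ?_
  · rw [transpose_add, transpose_smul, hA.transpose_eq, transpose_vecMulVec]
  · rw [sqNorm_add_vecMulVec]
    have := sqNorm_pos hA hv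
    positivity

theorem trace_add_vecMulVec (A : Matrix (Fin n) (Fin n) ℝ) (η : ℝ) (g : Fin n → ℝ) :
    (A + η • vecMulVec g g).trace = A.trace + η * (g ⬝ᵥ g) := by
  rw [trace_add, trace_smul, trace_vecMulVec, smul_eq_mul]

theorem det_add_vecMulVec (hA : A.PosDef) (g : Fin n → ℝ) :
    (A + η • vecMulVec g g).det = A.det * (1 + η * (g ⬝ᵥ (A⁻¹ *ᵥ g))) := by
  have h : η • vecMulVec g g = replicateCol Unit g * replicateRow Unit (η • g) := by
    ext i k
    simp [vecMulVec_apply, Matrix.mul_apply]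
    ring
  rw [h, det_add_replicateCol_mul_replicateRow hA.det_pos.ne'.isUnit]
  congr 1
  rw [Matrix.mul_assoc]
  simp [Matrix.mul_apply, dotProduct, mulVec, Finset.mul_sum]

/-- The **Sherman–Morrison formula**. -/
theorem inv_add_vecMulVec (hA : A.PosDef) (hη : 0 ≤ η) (g : Fin n → ℝ) :
    (A + η • vecMulVec g g)⁻¹ = A⁻¹ - (η * (1 + η * (g ⬝ᵥ (A⁻¹ *ᵥ g)))⁻¹)
      • vecMulVec (A⁻¹ *ᵥ g) (A⁻¹ *ᵥ g) := by
  have hdet : IsUnit A.det := hA.det_pos.ne'.isUnit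
  have hq : 0 ≤ g ⬝ᵥ (A⁻¹ *ᵥ g) := sqNorm_nonneg hA.inv g
  have hne : 1 + η * (g ⬝ᵥ (A⁻¹ *ᵥ g)) ≠ 0 := by positivity
  refine inv_eq_right_inv ?_
  have h1 : A * vecMulVec (A⁻¹ *ᵥ g) (A⁻¹ *ᵥ g) = vecMulVec g (A⁻¹ *ᵥ g) := by
    rw [mul_vecMulVec, mulVec_mulVec, mul_nonsing_inv _ hdet, one_mulVec]
  have h2 : vecMulVec g g * A⁻¹ = vecMulVec g (A⁻¹ *ᵥ g) := by
    rw [vecMulVec_mul, ← mulVec_transpose, hA.inv.transpose_eq]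
  have h3 : vecMulVec g g * vecMulVec (A⁻¹ *ᵥ g) (A⁻¹ *ᵥ g)
      = (g ⬝ᵥ (A⁻¹ *ᵥ g)) • vecMulVec g (A⁻¹ *ᵥ g) := by
    rw [vecMulVec_mul_vecMulVec]
    ext i k
    simp [vecMulVec_apply]
    ring
  simp only [Matrix.add_mul, Matrix.mul_sub, Matrix.mul_smul, Matrix.smul_mul, h1, h2, h3,
    mul_nonsing_inv _ hdet]
  ext i k
  simp
  field_simp
  ring

theorem inv_add_vecMulVec_mulVec (hA : A.PosDef) (hη : 0 ≤ η) (g : Fin n → ℝ) :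
    (A + η • vecMulVec g g)⁻¹ *ᵥ g
      = (1 + η * (g ⬝ᵥ (A⁻¹ *ᵥ g)))⁻¹ • (A⁻¹ *ᵥ g) := by
  have hq : 0 ≤ g ⬝ᵥ (A⁻¹ *ᵥ g) := sqNorm_nonneg hA.inv g
  have hne : 1 + η * (g ⬝ᵥ (A⁻¹ *ᵥ g)) ≠ 0 := by positivity
  rw [inv_add_vecMulVec hA hη, sub_mulVec, smul_mulVec, vecMulVec_mulVec]
  ext i
  simp [dotProduct_comm (A⁻¹ *ᵥ g) g]
  field_simp
  ring

/-- The norm of the gradient in the inverse of the updated matrix is bounded by the growth of the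
logarithm of the determinant. -/
theorem mul_sqNorm_inv_le_log (hA : A.PosDef) (hη : 0 ≤ η) (g : Fin n → ℝ) :
    η * sqNorm (A + η • vecMulVec g g)⁻¹ g
      ≤ Real.log (A + η • vecMulVec g g).det - Real.log A.det := by
  have hq : 0 ≤ g ⬝ᵥ (A⁻¹ *ᵥ g) := sqNorm_nonneg hA.inv g
  have hpos : 0 < 1 + η * (g ⬝ᵥ (A⁻¹ *ᵥ g)) := by positivity
  rw [det_add_vecMulVec hA, Real.log_mul hA.det_pos.ne' hpos.ne', add_sub_cancel_left]
  refine le_trans (le_of_eq ?_) (Real.one_sub_inv_le_log_of_pos hpos)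
  rw [sqNorm, inv_add_vecMulVec_mulVec hA hη, dotProduct_smul, smul_eq_mul]
  field_simp
  ring

/-- The effect of a Newton step on the distance to an arbitrary `u`. -/
theorem sqNorm_newton (hA : A.PosDef) (hη : 0 ≤ η) (g w u : Fin n → ℝ) :
    sqNorm (A + η • vecMulVec g g) (w - (A + η • vecMulVec g g)⁻¹ *ᵥ g - u)
      = sqNorm A (w - u) + η * (g ⬝ᵥ (w - u)) ^ 2 - 2 * (g ⬝ᵥ (w - u))
        + sqNorm (A + η • vecMulVec g g)⁻¹ g := by
  have hA' := posDef_add_vecMulVec hA hη g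
  have hdet : IsUnit (A + η • vecMulVec g g).det := hA'.det_pos.ne'.isUnit
  rw [sub_right_comm, sqNorm_sub hA'.transpose_eq, sqNorm_add_vecMulVec, mulVec_mulVec,
    mul_nonsing_inv _ hdet, one_mulVec, dotProduct_comm g (w - u)]
  congr 1
  rw [sqNorm, mulVec_mulVec, mul_nonsing_inv _ hdet, one_mulVec, dotProduct_comm, sqNorm]

theorem det_le_trace_pow (hA : A.PosDef) : A.det ≤ A.trace ^ n := by
  have h1 : A.det = ∏ i, hA.isHermitian.eigenvalues i := by
    simpa using hA.isHermitian.det_eq_prod_eigenvalues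
  have h2 : A.trace = ∑ i, hA.isHermitian.eigenvalues i := by
    simpa using hA.isHermitian.trace_eq_sum_eigenvalues
  have h3 : ∀ i, 0 ≤ hA.isHermitian.eigenvalues i := fun i => (hA.eigenvalues_pos i).le
  calc A.det = ∏ i, hA.isHermitian.eigenvalues i := h1
    _ ≤ ∏ _i : Fin n, A.trace := Finset.prod_le_prod (fun i _ => h3 i) fun i _ => by
        rw [h2]
        exact Finset.single_le_sum (fun k _ => h3 k) (Finset.mem_univ i)
    _ = A.trace ^ n := by simp

end RankOne

/-! ### Invariants of the states of the algorithm -/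

section Invariant

variable (svd : SVDRoutine) {H : Type*} {X : Type*} [NormedAddCommGroup H]
  [InnerProductSpace ℝ H] [CompleteSpace H] [RKHS ℝ H X ℝ] {par : Params}

variable (H) in
/-- What is preserved through the rounds. The buffer consists of `j` different instances among
`x 0, …, x (t - 1)`, its kernel matrix has a determinant of at least `α ^ j`, and `A` is positive
definite. -/
structure Invariant (par : Params) (x : ℕ → X) (t : ℕ) (s : State X) : Prop where
  gram_posDef : (gram (scalarKernel H) s.pts).PosDef
  cov_posDef : s.A.PosDef
  pow_le_det : par.α ^ s.j ≤ (gram (scalarKernel H) s.pts).det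
  exists_index : ∃ idx : Fin s.j → ℕ, Function.Injective idx ∧
    ∀ i, idx i < t ∧ s.pts i = x (idx i)

theorem Invariant.le {x : ℕ → X} {t : ℕ} {s : State X} (h : Invariant H par x t s) :
    s.j ≤ t := by
  obtain ⟨idx, hinj, hidx⟩ := h.exists_index
  have := Finset.card_le_card_of_injOn (s := Finset.univ) (t := Finset.range t) idx
    (fun i _ => by simpa using (hidx i).1) hinj.injOn
  simpa using this

theorem posDef_of_isEmpty (A : Matrix (Fin 0) (Fin 0) ℝ) : A.PosDef :=
  posDef_of_sqNorm_pos (Subsingleton.elim _ _) fun _ hv => absurd (Subsingleton.elim _ _) hv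

theorem invariant_initial (x : ℕ → X) : Invariant H par x 0 (State.initial X) where
  gram_posDef := posDef_of_isEmpty _
  cov_posDef := posDef_of_isEmpty _
  pow_le_det := by
    change par.α ^ 0 ≤ (gram (scalarKernel H) (Fin.elim0 : Fin 0 → X)).det
    simp
  exists_index := ⟨Fin.elim0, fun i => i.elim0, fun i => i.elim0⟩

theorem gram_snoc_posDef {n : ℕ} {p : Fin n → X} (hp : (gram (scalarKernel H) p).PosDef) {a : X}
    (ha : 0 < aldError (scalarKernel H) p a) :
    (gram (scalarKernel H) (Fin.snoc p a : Fin (n + 1) → X)).PosDef := by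
  have hdet : (gram (scalarKernel H) (Fin.snoc p a : Fin (n + 1) → X)).det ≠ 0 := by
    rw [det_gram_snoc p hp]
    exact (mul_pos hp.det_pos ha).ne'
  exact (gram_posSemidef _).posDef_iff_isUnit.mpr ((isUnit_iff_isUnit_det _).mpr hdet.isUnit)

variable {svd}

theorem Invariant.projected {x : ℕ → X} {t : ℕ} {s : State X} (h : Invariant H par x t s)
    (a : X) : Invariant H par x t (s.projected svd (scalarKernel H) par a) :=
  ⟨h.gram_posDef, h.cov_posDef, h.pow_le_det, h.exists_index⟩

theorem Invariant.newton {x : ℕ → X} {t : ℕ} {s : State X} (h : Invariant H par x t s)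
    (hη : 0 ≤ par.η) (a : X) (b : ℝ) :
    Invariant H par x t (s.newton svd (scalarKernel H) par a b) :=
  ⟨h.gram_posDef, posDef_add_vecMulVec h.cov_posDef hη _, h.pow_le_det, h.exists_index⟩

theorem Invariant.mono {x : ℕ → X} {t : ℕ} {s : State X} (h : Invariant H par x t s) :
    Invariant H par x (t + 1) s :=
  ⟨h.gram_posDef, h.cov_posDef, h.pow_le_det, by
    obtain ⟨idx, hinj, hidx⟩ := h.exists_index
    exact ⟨idx, hinj, fun i => ⟨(hidx i).1.trans (Nat.lt_succ_self t), (hidx i).2⟩⟩⟩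

theorem Invariant.grow {x : ℕ → X} {t : ℕ} {s : State X} (h : Invariant H par x t s)
    (hμ : 0 < par.μ) (hα : 0 < par.α) (ha : par.α < aldError (scalarKernel H) s.pts (x t)) :
    Invariant H par x (t + 1) (s.grow svd (scalarKernel H) par (x t)) := by
  have hp := gram_snoc_posDef h.gram_posDef (hα.trans ha)
  refine ⟨hp, posDef_transport (transition_transpose_mul_self svd h.gram_posDef hp)
    h.cov_posDef hμ, ?_, ?_⟩
  · change par.α ^ (s.j + 1) ≤ (gram (scalarKernel H) (Fin.snoc s.pts (x t))).det
    rw [det_gram_snoc _ h.gram_posDef, pow_succ]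
    exact mul_le_mul h.pow_le_det ha.le hα.le h.gram_posDef.det_pos.le
  · obtain ⟨idx, hinj, hidx⟩ := h.exists_index
    change ∃ idx : Fin (s.j + 1) → ℕ, Function.Injective idx ∧
      ∀ i, idx i < t + 1 ∧ (Fin.snoc s.pts (x t) : Fin (s.j + 1) → X) i = x (idx i)
    refine ⟨Fin.snoc idx t, ?_, fun i => ?_⟩
    · rw [Fin.snoc_injective_iff]
      exact ⟨hinj, fun ⟨i, hi⟩ => (hidx i).1.ne hi⟩
    · induction i using Fin.lastCases with
      | last => simp
      | cast i =>
        simp only [Fin.snoc_castSucc]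
        exact ⟨(hidx i).1.trans (Nat.lt_succ_self t), (hidx i).2⟩

theorem ready_of_lt {κ : X → X → ℝ} {s : State X} {a : X} (h : par.α < aldError κ s.pts a) :
    s.ready svd κ par a = (s.projected svd κ par a).grow svd κ par a :=
  if_pos h

theorem ready_of_not_lt {κ : X → X → ℝ} {s : State X} {a : X}
    (h : ¬ par.α < aldError κ s.pts a) : s.ready svd κ par a = s.projected svd κ par a :=
  if_neg h

theorem Invariant.ready {x : ℕ → X} {t : ℕ} {s : State X} (h : Invariant H par x t s)
    (hμ : 0 < par.μ) (hα : 0 < par.α) :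
    Invariant H par x (t + 1) (s.ready svd (scalarKernel H) par (x t)) := by
  by_cases ha : par.α < aldError (scalarKernel H) s.pts (x t)
  · rw [ready_of_lt ha]
    exact (h.projected _).grow hμ hα ha
  · rw [ready_of_not_lt ha]
    exact (h.projected _).mono

theorem invariant_stateAt (svd : SVDRoutine) (hμ : 0 < par.μ) (hα : 0 < par.α) (hη : 0 ≤ par.η)
    (x : ℕ → X) (y : ℕ → ℝ) (t : ℕ) :
    Invariant H par x t (stateAt svd (scalarKernel H) par x y t) := by
  induction t with
  | zero => exact invariant_initial x
  | succ t ih => exact (ih.ready hμ hα).newton hη _ _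

/-! ### The potential -/

variable (svd) in
/-- The potential of the analysis: the squared distance of the weight vector to the comparator
`f`, in the norm of the operator which extends `A` by `μ` on the orthogonal complement of the span
of the buffer. -/
def potential (par : Params) (f : H) (s : State X) : ℝ :=
  sqNorm s.A (s.w - coords svd f s.pts)
    + par.μ * (‖f‖ ^ 2 - coords svd f s.pts ⬝ᵥ coords svd f s.pts)

/-- The logarithm of the determinant of `A`, relative to that of `μ I`. -/
def logDet {X : Type*} (par : Params) (s : State X) : ℝ :=
  Real.log s.A.det - s.j * Real.log par.μ

theorem potential_nonneg {x : ℕ → X} {t : ℕ} {s : State X} (h : Invariant H par x t s)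
    (hμ : 0 < par.μ) (f : H) : 0 ≤ potential svd par f s := by
  have h1 := sqNorm_nonneg h.cov_posDef (s.w - coords svd f s.pts)
  have h2 := mul_nonneg hμ.le (sub_nonneg.mpr (coords_dotProduct_self_le svd h.gram_posDef f))
  rw [potential]
  linarith

theorem potential_initial (f : H) : potential svd par f (State.initial X) = par.μ * ‖f‖ ^ 2 := by
  have h : coords svd f (State.initial X).pts = 0 := Subsingleton.elim (α := Fin 0 → ℝ) _ _
  have h' : (State.initial X).w = 0 := rfl
  rw [potential, h, h']
  simp [sqNorm]

theorem logDet_initial : logDet par (State.initial X) = 0 := by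
  have h : (State.initial X).A.det = 1 := det_fin_zero
  have h' : (State.initial X).j = 0 := rfl
  simp [logDet, h, h']

theorem potential_projected_le {x : ℕ → X} {t : ℕ} {s : State X} (h : Invariant H par x t s)
    (hU : 0 ≤ par.U) {f : H} (hf : ‖f‖ ≤ par.U) {a : X} (ha : scalarKernel H a a = 1) :
    potential svd par f (s.projected svd (scalarKernel H) par a) ≤ potential svd par f s := by
  have h1 := abs_coords_dotProduct_feature_le svd h.gram_posDef f ha
  have h2 := sqNorm_explicitProjection_add_le h.cov_posDef hU
    (feature svd (scalarKernel H) s.pts a) s.w _ (h1.trans hf)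
  rw [← project_eq h.cov_posDef hU] at h2
  have h3 := sqNorm_nonneg h.cov_posDef
    (project s.A (feature svd (scalarKernel H) s.pts a) par.U s.w - s.w)
  exact add_le_add_left (by linarith : sqNorm s.A (project s.A
    (feature svd (scalarKernel H) s.pts a) par.U s.w - coords svd f s.pts)
      ≤ sqNorm s.A (s.w - coords svd f s.pts)) _

theorem potential_grow {x : ℕ → X} {t : ℕ} {s : State X} (h : Invariant H par x t s)
    (f : H) {a : X} (ha : 0 < aldError (scalarKernel H) s.pts a) :
    potential svd par f (s.grow svd (scalarKernel H) par a) = potential svd par f s := by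
  have hp := gram_snoc_posDef h.gram_posDef ha
  have h1 := sqNorm_transport_sub (A := s.A) (μ := par.μ)
    (transition_transpose_mul_self svd h.gram_posDef hp) s.w (coords svd f (Fin.snoc s.pts a))
  rw [transition_transpose_mulVec_coords svd hp] at h1
  refine (congrArg (· + par.μ * (‖f‖ ^ 2 - coords svd f (Fin.snoc s.pts a : Fin (s.j + 1) → X)
    ⬝ᵥ coords svd f (Fin.snoc s.pts a : Fin (s.j + 1) → X))) h1).trans ?_
  rw [potential]
  ring

theorem logDet_grow {x : ℕ → X} {t : ℕ} {s : State X} (h : Invariant H par x t s)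
    (hμ : 0 < par.μ) {a : X} (ha : 0 < aldError (scalarKernel H) s.pts a) :
    logDet par (s.grow svd (scalarKernel H) par a) = logDet par s := by
  have hp := gram_snoc_posDef h.gram_posDef ha
  have h1 := det_transport (A := s.A) (transition_transpose_mul_self svd h.gram_posDef hp) hμ
  refine (congrArg (fun D => Real.log D - ((s.j + 1 : ℕ) : ℝ) * Real.log par.μ) h1).trans ?_
  rw [Real.log_mul hμ.ne' h.cov_posDef.det_pos.ne', logDet]
  push_cast
  ring

theorem potential_ready_le {x : ℕ → X} {t : ℕ} {s : State X} (h : Invariant H par x t s)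
    (hU : 0 ≤ par.U) (hα : 0 < par.α) {f : H} (hf : ‖f‖ ≤ par.U) {a : X}
    (ha : scalarKernel H a a = 1) :
    potential svd par f (s.ready svd (scalarKernel H) par a) ≤ potential svd par f s := by
  by_cases hald : par.α < aldError (scalarKernel H) s.pts a
  · rw [ready_of_lt hald]
    exact (potential_grow (h.projected a) f (hα.trans hald)).le.trans
      (potential_projected_le h hU hf ha)
  · rw [ready_of_not_lt hald]
    exact potential_projected_le h hU hf ha

theorem logDet_ready {x : ℕ → X} {t : ℕ} {s : State X} (h : Invariant H par x t s)
    (hμ : 0 < par.μ) (hα : 0 < par.α) (a : X) :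
    logDet par (s.ready svd (scalarKernel H) par a) = logDet par s := by
  by_cases hald : par.α < aldError (scalarKernel H) s.pts a
  · rw [ready_of_lt hald]
    exact logDet_grow (h.projected a) hμ (hα.trans hald)
  · rw [ready_of_not_lt hald]
    rfl

/-- The instance is always well approximated by the buffer with which the prediction is made: it
has either passed the test or been added. -/
theorem aldError_ready_le {x : ℕ → X} {t : ℕ} {s : State X} (h : Invariant H par x t s)
    (hα : 0 < par.α) (a : X) :
    aldError (scalarKernel H) (s.ready svd (scalarKernel H) par a).pts a ≤ par.α := by
  by_cases hald : par.α < aldError (scalarKernel H) s.pts a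
  · rw [ready_of_lt hald]
    exact (aldError_snoc_self (gram_snoc_posDef h.gram_posDef (hα.trans hald))).le.trans hα.le
  · rw [ready_of_not_lt hald]
    exact not_lt.mp hald

/-- Growth does not change the predictions, so that the constraint of the projection step, which
was imposed in the old feature space, also bounds the prediction made in the new one. -/
theorem predict_grow {x : ℕ → X} {t : ℕ} {s : State X} (h : Invariant H par x t s)
    {a : X} (ha : 0 < aldError (scalarKernel H) s.pts a) (b : X) :
    (s.grow svd (scalarKernel H) par a).predict svd (scalarKernel H) b
      = s.predict svd (scalarKernel H) b := by
  have hp := gram_snoc_posDef h.gram_posDef ha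
  change (transition svd (scalarKernel H) (Fin.snoc s.pts a : Fin (s.j + 1) → X) s.pts *ᵥ s.w)
    ⬝ᵥ feature svd (scalarKernel H) (Fin.snoc s.pts a : Fin (s.j + 1) → X) b
    = s.w ⬝ᵥ feature svd (scalarKernel H) s.pts b
  rw [← coords_featureMap, ← coords_featureMap, ← transition_transpose_mulVec_coords svd hp,
    dotProduct_mulVec s.w, vecMul_transpose]

theorem abs_predict_ready_le {x : ℕ → X} {t : ℕ} {s : State X} (h : Invariant H par x t s)
    (hU : 0 ≤ par.U) (hα : 0 < par.α) (a : X) :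
    |(s.ready svd (scalarKernel H) par a).predict svd (scalarKernel H) a| ≤ par.U := by
  have h1 : |(s.projected svd (scalarKernel H) par a).predict svd (scalarKernel H) a| ≤ par.U := by
    have := (isProjection_explicitProjection h.cov_posDef hU
      (feature svd (scalarKernel H) s.pts a) s.w).1
    rwa [← project_eq h.cov_posDef hU] at this
  by_cases hald : par.α < aldError (scalarKernel H) s.pts a
  · rwa [ready_of_lt hald, predict_grow (h.projected a) (hα.trans hald)]
  · rwa [ready_of_not_lt hald]

theorem sq_sub_le_of_abs_le {p b U Y : ℝ} (hp : |p| ≤ U) (hb : |b| ≤ Y) :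
    (p - b) ^ 2 ≤ 2 * (U ^ 2 + Y ^ 2) := by
  have h1 : p ^ 2 ≤ U ^ 2 := sq_le_sq' (neg_le_of_abs_le hp) (le_of_abs_le hp)
  have h2 : b ^ 2 ≤ Y ^ 2 := sq_le_sq' (neg_le_of_abs_le hb) (le_of_abs_le hb)
  nlinarith [sq_nonneg (p + b)]

theorem Params.eta_mul_le (hU : 0 < par.U) {p b : ℝ} (hp : |p| ≤ par.U) (hb : |b| ≤ par.Y) :
    par.η * (2 * (p - b)) ^ 2 ≤ 2 := by
  have h1 := sq_sub_le_of_abs_le hp hb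
  have h2 : 0 < par.U ^ 2 + par.Y ^ 2 := by positivity
  rw [Params.η, div_mul_eq_mul_div, div_le_iff₀ (by positivity)]
  nlinarith

/-- The Newton step pays for the excess loss at one example: the square loss satisfies
`ℓ(p) - ℓ(z) ≤ D - (η / 2) D²` with `D = ℓ'(p) (p - z)`. -/
theorem potential_newton_le {x : ℕ → X} {t : ℕ} {s : State X} (h : Invariant H par x t s)
    (hU : 0 < par.U) (f : H) {a : X} {b : ℝ}
    (hp : |s.predict svd (scalarKernel H) a| ≤ par.U) (hb : |b| ≤ par.Y) :
    2 * ((s.predict svd (scalarKernel H) a - b) ^ 2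
        - (coords svd f s.pts ⬝ᵥ feature svd (scalarKernel H) s.pts a - b) ^ 2)
      + potential svd par f (s.newton svd (scalarKernel H) par a b)
      ≤ potential svd par f s
        + (logDet par (s.newton svd (scalarKernel H) par a b) - logDet par s) / par.η := by
  have hη : 0 < par.η := by
    rw [Params.η]
    positivity
  set P := s.predict svd (scalarKernel H) a with hP
  set φ := feature svd (scalarKernel H) s.pts a with hφ
  set u := coords svd f s.pts with hu
  set z := u ⬝ᵥ φ with hz
  set g : Fin s.j → ℝ := (2 * (P - b)) • φ with hg
  have h1 := sqNorm_newton h.cov_posDef hη.le g s.w u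
  have h2 := mul_sqNorm_inv_le_log h.cov_posDef hη.le g
  have h3 : g ⬝ᵥ (s.w - u) = 2 * (P - b) * (P - z) := by
    rw [hg, smul_dotProduct, dotProduct_sub, dotProduct_comm φ, dotProduct_comm φ, smul_eq_mul, hz,
      hP, State.predict]
  -- the quadratic term of the Newton step is at most twice the curvature of the square loss
  have h4 : par.η * (2 * (P - b)) ^ 2 * (P - z) ^ 2 ≤ 2 * (P - z) ^ 2 :=
    mul_le_mul_of_nonneg_right (Params.eta_mul_le hU hp hb) (sq_nonneg _)
  have h5 : sqNorm (s.A + par.η • vecMulVec g g)⁻¹ g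
      ≤ (logDet par (s.newton svd (scalarKernel H) par a b) - logDet par s) / par.η := by
    rw [le_div_iff₀ hη, mul_comm]
    refine h2.trans (le_of_eq ?_)
    exact (sub_sub_sub_cancel_right _ _ _).symm
  have h6 : potential svd par f (s.newton svd (scalarKernel H) par a b)
      = sqNorm (s.A + par.η • vecMulVec g g) (s.w - (s.A + par.η • vecMulVec g g)⁻¹ *ᵥ g - u)
        + par.μ * (‖f‖ ^ 2 - u ⬝ᵥ u) := rfl
  have h7 : potential svd par f s = sqNorm s.A (s.w - u) + par.μ * (‖f‖ ^ 2 - u ⬝ᵥ u) := rfl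
  rw [h6, h7, h1, h3]
  nlinarith

/-- Replacing the comparator by its projection costs little when the projection error is small. -/
theorem sq_coords_sub_le {n : ℕ} {p : Fin n → X} (hp : (gram (scalarKernel H) p).PosDef)
    {f : H} (hf : ‖f‖ ≤ par.U) {a : X} (ha : scalarKernel H a a = 1) {b : ℝ} (hb : |b| ≤ par.Y)
    (hYU : par.Y ≤ par.U) (hald : aldError (scalarKernel H) p a ≤ par.α) :
    (coords svd f p ⬝ᵥ feature svd (scalarKernel H) p a - b) ^ 2 - (f a - b) ^ 2
      ≤ 4 * par.U ^ 2 * √par.α := by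
  set z := coords svd f p ⬝ᵥ feature svd (scalarKernel H) p a with hz
  have hU : 0 ≤ par.U := (norm_nonneg f).trans hf
  have h1 : |f a - z| ≤ par.U * √par.α :=
    (abs_apply_sub_coords_le svd hp f a).trans
      (mul_le_mul hf (Real.sqrt_le_sqrt hald) (Real.sqrt_nonneg _) hU)
  have h2 : |z| ≤ par.U := (abs_coords_dotProduct_feature_le svd hp f ha).trans hf
  have h3 : |f a| ≤ par.U := by
    rw [← inner_featureMap]
    refine (abs_real_inner_le_norm _ _).trans ?_
    have h4 : ‖featureMap H a‖ = 1 := by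
      have := norm_featureMap_sq (H := H) a
      rw [ha] at this
      exact (pow_eq_one_iff_of_nonneg (norm_nonneg _) two_ne_zero).mp this
    rwa [h4, mul_one]
  have h5 : |z + f a - 2 * b| ≤ 4 * par.U := by
    rw [abs_le] at h2 h3 hb ⊢
    constructor <;> linarith
  calc (z - b) ^ 2 - (f a - b) ^ 2 = -(f a - z) * (z + f a - 2 * b) := by ring
    _ ≤ |-(f a - z) * (z + f a - 2 * b)| := le_abs_self _
    _ = |f a - z| * |z + f a - 2 * b| := by rw [abs_mul, abs_neg]
    _ ≤ par.U * √par.α * (4 * par.U) := mul_le_mul h1 h5 (abs_nonneg _) (by positivity)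
    _ = _ := by ring

/-- The sum of the inequalities for the single rounds. Projection decreases the potential, growth
preserves the potential and the relative log-determinant, and the Newton step and the replacement of
the comparator by its projection are accounted for by `potential_newton_le` and
`sq_coords_sub_le`. -/
theorem regret_add_potential_le (svd : SVDRoutine) (hker : ∀ a : X, scalarKernel H a a = 1)
    (hμ : 0 < par.μ) (hα : 0 < par.α) (hU : 0 < par.U) (hYU : par.Y ≤ par.U) {x : ℕ → X}
    {y : ℕ → ℝ} {T : ℕ} (hy : ∀ t < T, |y t| ≤ par.Y) {f : H} (hf : ‖f‖ ≤ par.U) :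
    2 * regret x y T (prediction svd (scalarKernel H) par x y) f
        + potential svd par f (stateAt svd (scalarKernel H) par x y T)
      ≤ par.μ * ‖f‖ ^ 2 + logDet par (stateAt svd (scalarKernel H) par x y T) / par.η
        + T * (8 * par.U ^ 2 * √par.α) := by
  have hη : 0 < par.η := by
    rw [Params.η]
    positivity
  induction T with
  | zero => simp [regret, stateAt, potential_initial, logDet_initial]
  | succ T ih =>
    have ih := ih fun t ht => hy t (ht.trans (Nat.lt_succ_self T))
    have hb := hy T (Nat.lt_succ_self T)
    have hs := invariant_stateAt (H := H) svd hμ hα hη.le x y T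
    have hr := hs.ready (svd := svd) hμ hα
    have h1 := potential_ready_le (svd := svd) hs hU.le hα hf (hker (x T))
    have h2 := logDet_ready (svd := svd) hs hμ hα (x T)
    have h3 := potential_newton_le (svd := svd) hr hU f
      (abs_predict_ready_le hs hU.le hα (x T)) hb
    have h4 := sq_coords_sub_le (svd := svd) hr.gram_posDef hf (hker (x T)) hb hYU
      (aldError_ready_le hs hα (x T))
    rw [regret, Finset.sum_range_succ, ← regret, stateAt]
    rw [h2, sub_div] at h3
    push_cast
    rw [prediction]
    linarith

/-- Growth adds `μ` to the trace, and a Newton step at most `2`, as feature vectors have norm at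
most `1`. -/
theorem trace_stateAt_le (svd : SVDRoutine) (hker : ∀ a : X, scalarKernel H a a = 1)
    (hμ : 0 < par.μ) (hα : 0 < par.α) (hU : 0 < par.U) {x : ℕ → X}
    {y : ℕ → ℝ} {T : ℕ} (hy : ∀ t < T, |y t| ≤ par.Y) :
    (stateAt svd (scalarKernel H) par x y T).A.trace
      ≤ par.μ * (stateAt svd (scalarKernel H) par x y T).j + 2 * T := by
  have hη : 0 < par.η := by
    rw [Params.η]
    positivity
  induction T with
  | zero =>
    change (0 : Matrix (Fin 0) (Fin 0) ℝ).trace ≤ par.μ * ((0 : ℕ) : ℝ) + 2 * ((0 : ℕ) : ℝ)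
    simp
  | succ T ih =>
    have ih := ih fun t ht => hy t (ht.trans (Nat.lt_succ_self T))
    have hb := hy T (Nat.lt_succ_self T)
    have hs := invariant_stateAt (H := H) svd hμ hα hη.le x y T
    have hr := hs.ready (svd := svd) hμ hα
    have hpred := abs_predict_ready_le (svd := svd) hs hU.le hα (x T)
    set s := stateAt svd (scalarKernel H) par x y T with hsdef
    have h1 : (s.ready svd (scalarKernel H) par (x T)).A.trace
        ≤ par.μ * (s.ready svd (scalarKernel H) par (x T)).j + 2 * T := by
      by_cases hald : par.α < aldError (scalarKernel H) s.pts (x T)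
      · have h2 := trace_transport (A := s.A) (μ := par.μ)
          (transition_transpose_mul_self svd hs.gram_posDef
            (gram_snoc_posDef hs.gram_posDef (hα.trans hald)))
        rw [ready_of_lt hald]
        refine h2.trans_le ?_
        change s.A.trace + par.μ ≤ par.μ * ((s.j + 1 : ℕ) : ℝ) + 2 * T
        push_cast
        linarith
      · rw [ready_of_not_lt hald]
        exact ih
    rw [stateAt, ← hsdef]
    set r := s.ready svd (scalarKernel H) par (x T) with hrdef
    have h3 := coords_dotProduct_self_le svd hr.gram_posDef (featureMap H (x T))
    rw [coords_featureMap, norm_featureMap_sq, hker] at h3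
    have h4 := Params.eta_mul_le hU hpred hb
    have h5 : 0 ≤ feature svd (scalarKernel H) r.pts (x T)
        ⬝ᵥ feature svd (scalarKernel H) r.pts (x T) := by
      simpa using dotProduct_star_self_nonneg (feature svd (scalarKernel H) r.pts (x T))
    refine (trace_add_vecMulVec _ _ _).trans_le ?_
    change _ ≤ par.μ * r.j + 2 * ((T + 1 : ℕ) : ℝ)
    rw [smul_dotProduct, dotProduct_smul, smul_eq_mul, smul_eq_mul]
    push_cast
    nlinarith

/-- The determinant is at most `(tr A) ^ j`, and `j ≤ t`. -/
theorem logDet_le {x : ℕ → X} {t : ℕ} {s : State X} (h : Invariant H par x t s) (hμ : 0 < par.μ)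
    (htr : s.A.trace ≤ par.μ * s.j + 2 * t) :
    logDet par s ≤ s.j * Real.log (t * (1 + 2 / par.μ)) := by
  rcases Nat.eq_zero_or_pos s.j with hj | hj
  · have hA : s.A.det ≤ 1 := by
      simpa [hj] using det_le_trace_pow h.cov_posDef
    have := Real.log_nonpos h.cov_posDef.det_pos.le hA
    simpa [logDet, hj] using this
  · have hjt : (s.j : ℝ) ≤ t := by exact_mod_cast h.le
    have ht : (0 : ℝ) < t := lt_of_lt_of_le (by exact_mod_cast hj) hjt
    have h1 : s.A.trace ≤ par.μ * (t * (1 + 2 / par.μ)) := by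
      have : par.μ * (t * (1 + 2 / par.μ)) = par.μ * t + 2 * t := by field_simp
      nlinarith
    have h2 : s.A.det ≤ (par.μ * (t * (1 + 2 / par.μ))) ^ s.j :=
      (det_le_trace_pow h.cov_posDef).trans
        (pow_le_pow_left₀ h.cov_posDef.posSemidef.trace_nonneg h1 _)
    have h3 := Real.log_le_log h.cov_posDef.det_pos h2
    rw [Real.log_pow, Real.log_mul hμ.ne' (by positivity)] at h3
    rw [logDet]
    linarith

end Invariant

/-! ### Interlacing of eigenvalues -/

section Interlacing

variable {m n : Type*} [Fintype m] [Fintype n] [DecidableEq m] [DecidableEq n]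

theorem dotProduct_self_eq_sum {A : Matrix n n ℝ} (hA : A.IsHermitian) (v : n → ℝ) :
    v ⬝ᵥ v = ∑ i, ((hA.eigenvectorBasis i).ofLp ⬝ᵥ v) ^ 2 := by
  have h := hA.eigenvectorBasis.sum_inner_mul_inner (WithLp.toLp 2 v) (WithLp.toLp 2 v)
  simp only [EuclideanSpace.inner_eq_star_dotProduct, star_trivial] at h
  rw [← h]
  refine Finset.sum_congr rfl fun i _ => ?_
  rw [dotProduct_comm v, sq]

theorem dotProduct_mulVec_eq_sum {A : Matrix n n ℝ} (hA : A.IsHermitian) (v : n → ℝ) :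
    v ⬝ᵥ (A *ᵥ v) = ∑ i, hA.eigenvalues i * ((hA.eigenvectorBasis i).ofLp ⬝ᵥ v) ^ 2 := by
  have h := hA.eigenvectorBasis.sum_inner_mul_inner (WithLp.toLp 2 v) (WithLp.toLp 2 (A *ᵥ v))
  simp only [EuclideanSpace.inner_eq_star_dotProduct, star_trivial] at h
  have hs : Aᵀ = A := (conjTranspose_eq_transpose_of_trivial _).symm.trans hA
  rw [dotProduct_comm, ← h]
  refine Finset.sum_congr rfl fun i _ => ?_
  have h1 : (A *ᵥ v) ⬝ᵥ (hA.eigenvectorBasis i).ofLp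
      = hA.eigenvalues i * ((hA.eigenvectorBasis i).ofLp ⬝ᵥ v) := by
    rw [dotProduct_comm, dotProduct_mulVec, ← mulVec_transpose, hs, hA.mulVec_eigenvectorBasis,
      smul_dotProduct, smul_eq_mul]
  rw [h1]
  ring

/-- One half of **Cauchy interlacing**: the `i`-th largest eigenvalue of a principal submatrix is
at most that of the matrix. There is a nonzero vector supported on the submatrix which is
orthogonal to the first `i` eigenvectors of the matrix and to the eigenvectors of the submatrix
after the `i`-th one; compare the two quadratic forms on it. -/
theorem eigenvalues₀_submatrix_le {A : Matrix n n ℝ} (hA : A.IsHermitian) {e : m → n}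
    (he : Function.Injective e) (hB : (A.submatrix e e).IsHermitian) (i : ℕ)
    (hi : i < Fintype.card m) (hi' : i < Fintype.card n) :
    hB.eigenvalues₀ ⟨i, hi⟩ ≤ hA.eigenvalues₀ ⟨i, hi'⟩ := by
  let em : Fin (Fintype.card m) ≃ m := Fintype.equivOfCardEq (Fintype.card_fin _)
  let en : Fin (Fintype.card n) ≃ n := Fintype.equivOfCardEq (Fintype.card_fin _)
  let M₁ : Matrix (Fin (Fintype.card m - (i + 1))) m ℝ := Matrix.of fun q l =>
    (hB.eigenvectorBasis (em ⟨i + 1 + q, by omega⟩)).ofLp l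
  let M₂ : Matrix (Fin i) m ℝ := Matrix.of fun q l =>
    (hA.eigenvectorBasis (en ⟨q, by omega⟩)).ofLp (e l)
  obtain ⟨y, hy, hy0⟩ : ∃ y ∈ LinearMap.ker (M₁.mulVecLin.prod M₂.mulVecLin), y ≠ 0 := by
    refine (Submodule.ne_bot_iff _).mp (LinearMap.ker_ne_bot_of_finrank_lt ?_)
    simp
    omega
  rw [LinearMap.ker_prod, Submodule.mem_inf, LinearMap.mem_ker, LinearMap.mem_ker] at hy
  obtain ⟨hy1, hy2⟩ := hy
  let E : Matrix n m ℝ := Matrix.of fun k l => if k = e l then 1 else 0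
  have hE : ∀ v : n → ℝ, v ᵥ* E = fun l => v (e l) := by
    intro v
    ext l
    simp [E, vecMul, dotProduct]
  have hEE : ∀ v : n → ℝ, v ⬝ᵥ (E *ᵥ y) = (fun l => v (e l)) ⬝ᵥ y := fun v => by
    rw [dotProduct_mulVec, hE]
  have hEy : ∀ l, (E *ᵥ y) (e l) = y l := fun l => by
    simp [E, mulVec, dotProduct, he.eq_iff]
  have hAE : ∀ l, (A *ᵥ (E *ᵥ y)) (e l) = (A.submatrix e e *ᵥ y) l := fun l => by
    rw [mulVec, hEE]
    rfl
  have hnorm : (E *ᵥ y) ⬝ᵥ (E *ᵥ y) = y ⬝ᵥ y := by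
    rw [hEE]
    simp only [hEy]
  have hquad : (E *ᵥ y) ⬝ᵥ (A *ᵥ (E *ᵥ y)) = y ⬝ᵥ (A.submatrix e e *ᵥ y) := by
    rw [dotProduct_comm, hEE, dotProduct_comm]
    simp only [hAE]
  have hpos : 0 < y ⬝ᵥ y := by simpa using dotProduct_star_self_pos_iff.mpr hy0
  have hlow : hB.eigenvalues₀ ⟨i, hi⟩ * (y ⬝ᵥ y) ≤ y ⬝ᵥ (A.submatrix e e *ᵥ y) := by
    rw [dotProduct_self_eq_sum hB, dotProduct_mulVec_eq_sum hB, Finset.mul_sum]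
    refine Finset.sum_le_sum fun k _ => ?_
    by_cases hk : (em.symm k : ℕ) ≤ i
    · exact mul_le_mul_of_nonneg_right
        (hB.eigenvalues₀_antitone (show em.symm k ≤ ⟨i, hi⟩ from hk)) (sq_nonneg _)
    · have hlt := (em.symm k).isLt
      have h := congrFun hy1 ⟨(em.symm k : ℕ) - (i + 1), by omega⟩
      have h' : (⟨i + 1 + ((em.symm k : ℕ) - (i + 1)), by omega⟩ : Fin (Fintype.card m))
          = em.symm k := Fin.ext (by simp; omega)
      have h0 : (hB.eigenvectorBasis k).ofLp ⬝ᵥ y = 0 := by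
        simpa [M₁, mulVec, h'] using h
      simp [h0]
  have hup : (E *ᵥ y) ⬝ᵥ (A *ᵥ (E *ᵥ y))
      ≤ hA.eigenvalues₀ ⟨i, hi'⟩ * ((E *ᵥ y) ⬝ᵥ (E *ᵥ y)) := by
    rw [dotProduct_self_eq_sum hA, dotProduct_mulVec_eq_sum hA, Finset.mul_sum]
    refine Finset.sum_le_sum fun k _ => ?_
    by_cases hk : i ≤ (en.symm k : ℕ)
    · exact mul_le_mul_of_nonneg_right
        (hA.eigenvalues₀_antitone (show ⟨i, hi'⟩ ≤ en.symm k from hk)) (sq_nonneg _)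
    · have h := congrFun hy2 ⟨(en.symm k : ℕ), by omega⟩
      have h0 : (hA.eigenvectorBasis k).ofLp ⬝ᵥ (E *ᵥ y) = 0 := by
        rw [hEE]
        simpa [M₂, mulVec] using h
      simp [h0]
  rw [hquad, hnorm] at hup
  exact le_of_mul_le_mul_right (hlow.trans hup) hpos

theorem det_eq_prod_eigenvalues₀ {A : Matrix n n ℝ} (hA : A.IsHermitian) :
    A.det = ∏ i, hA.eigenvalues₀ i := by
  rw [hA.det_eq_prod_eigenvalues]
  exact Equiv.prod_comp (Fintype.equivOfCardEq (Fintype.card_fin _)).symm hA.eigenvalues₀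

end Interlacing

/-! ### The size of the buffer -/

section BufferSize

variable {H : Type*} {X : Type*} [NormedAddCommGroup H]
  [InnerProductSpace ℝ H] [CompleteSpace H] [RKHS ℝ H X ℝ] {par : Params}

/-- The kernel matrix of the buffer is a principal submatrix of the kernel matrix of all instances,
so that its eigenvalues decay as well. -/
theorem sq_det_gram_le {x : ℕ → X} {T j : ℕ} {idx : Fin j → ℕ} (hinj : Function.Injective idx)
    (hidx : ∀ i, idx i < T) {R₀ r : ℝ}
    (heig : ∀ i : Fin (Fintype.card (Fin T)),
      (gram_isHermitian H (fun t : Fin T => x t)).eigenvalues₀ i ≤ R₀ * r ^ ((i : ℕ) + 1)) :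
    (gram (scalarKernel H) fun i => x (idx i)).det ^ 2 ≤ (R₀ ^ 2 * r ^ (j + 1)) ^ j := by
  let e : Fin j → Fin T := fun i => ⟨idx i, hidx i⟩
  have he : Function.Injective e := fun a b hab => hinj (Fin.mk.inj hab)
  have hps : (gram (scalarKernel H) fun i => x (idx i)).PosSemidef := gram_posSemidef _
  have hjT : j ≤ T := by simpa using Fintype.card_le_of_injective e he
  have hnonneg : ∀ i, 0 ≤ hps.isHermitian.eigenvalues₀ i := fun i => by
    have := hps.eigenvalues_nonneg (Fintype.equivOfCardEq (Fintype.card_fin _) i)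
    simpa [IsHermitian.eigenvalues] using this
  have hle : ∀ i : Fin (Fintype.card (Fin j)),
      hps.isHermitian.eigenvalues₀ i ≤ R₀ * r ^ ((i : ℕ) + 1) := fun i => by
    have hi : (i : ℕ) < Fintype.card (Fin T) := by
      have := i.isLt
      simp only [Fintype.card_fin] at this ⊢
      omega
    exact (eigenvalues₀_submatrix_le (gram_isHermitian H fun t : Fin T => x t) he
      hps.isHermitian i i.isLt hi).trans (heig ⟨i, hi⟩)
  have hdet : (gram (scalarKernel H) fun i => x (idx i)).det
      ≤ ∏ i ∈ Finset.range j, (R₀ * r ^ (i + 1)) := by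
    rw [det_eq_prod_eigenvalues₀ hps.isHermitian]
    refine (Finset.prod_le_prod (fun i _ => hnonneg i) fun i _ => hle i).trans (le_of_eq ?_)
    rw [Fin.prod_univ_eq_prod_range (fun i => R₀ * r ^ (i + 1)), Fintype.card_fin]
  have hprod : (∏ i ∈ Finset.range j, (R₀ * r ^ (i + 1))) ^ 2 = (R₀ ^ 2 * r ^ (j + 1)) ^ j := by
    have hsum : ∀ k : ℕ, (∑ i ∈ Finset.range k, (i + 1)) * 2 = (k + 1) * k := fun k => by
      induction k with
      | zero => simp
      | succ k ih =>
        rw [Finset.sum_range_succ, add_mul, ih]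
        ring
    rw [Finset.prod_mul_distrib, Finset.prod_pow_eq_pow_sum, Finset.prod_const, Finset.card_range,
      mul_pow, ← pow_mul r, hsum, mul_pow, pow_mul r (j + 1), ← pow_mul, ← pow_mul, mul_comm j 2,
      pow_mul]
  rw [← hprod]
  exact pow_le_pow_left₀ hps.det_nonneg hdet 2

/-- The constant in front of `ln T` in the bound for the size of the buffer. The terms with `c₂` and
`ln 2` come from `ln R₀ ≤ ln c₂ + ln T` and `ln α = 4 ln (ln T) - 4 ln T`, where constants are
absorbed into `ln T > 1 / 2`. -/
def bufferConst (r c₂ : ℝ) : ℝ :=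
  2 * (5 + 2 * |Real.log c₂| + 8 * |Real.log (Real.log 2)|) / Real.log (1 / r)

theorem half_lt_log {T : ℕ} (hT : 2 ≤ T) : 1 / 2 < Real.log T := by
  have h1 : (2 : ℝ) ≤ T := by exact_mod_cast hT
  have h2 := Real.log_le_log two_pos h1
  linarith [Real.log_two_gt_d9]

theorem bufferConst_nonneg {r : ℝ} (hr : 0 < r) (hr1 : r < 1) (c₂ : ℝ) : 0 ≤ bufferConst r c₂ := by
  have h : 0 < Real.log (1 / r) := Real.log_pos (by rw [lt_div_iff₀ hr]; linarith)
  rw [bufferConst]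
  positivity

/-- The buffer has logarithmic size: its kernel matrix has a determinant of at least `α ^ j`,
while the decay of the eigenvalues forces a determinant of at most `R₀ ^ j * r ^ (j (j + 1) / 2)`.
-/
theorem Invariant.card_le {x : ℕ → X} {t T : ℕ} {s : State X} (h : Invariant H par x t s)
    (htT : t ≤ T) (hT : 2 ≤ T) (hα : par.α = Real.log T ^ 4 / (T : ℝ) ^ 4)
    {r c₁ c₂ R₀ : ℝ} (hr : 0 < r) (hr1 : r < 1) (hc₁ : 0 < c₁)
    (hR₁ : c₁ * T ≤ R₀) (hR₂ : R₀ ≤ c₂ * T)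
    (heig : ∀ i : Fin (Fintype.card (Fin T)),
      (gram_isHermitian H (fun t : Fin T => x t)).eigenvalues₀ i ≤ R₀ * r ^ ((i : ℕ) + 1)) :
    (s.j : ℝ) ≤ bufferConst r c₂ * Real.log T := by
  have hL := half_lt_log hT
  have hT0 : (0 : ℝ) < T := by positivity
  have hlogr : 0 < Real.log (1 / r) := Real.log_pos (by rw [lt_div_iff₀ hr]; linarith)
  rcases Nat.eq_zero_or_pos s.j with hj | hj
  · rw [hj, Nat.cast_zero]
    exact mul_nonneg (bufferConst_nonneg hr hr1 c₂) (by linarith)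
  obtain ⟨idx, hinj, hidx⟩ := h.exists_index
  have hR0 : 0 < R₀ := lt_of_lt_of_le (by positivity) hR₁
  have hc₂ : 0 < c₂ := pos_of_mul_pos_left (hR0.trans_le hR₂) hT0.le
  have hα0 : 0 < par.α := by
    rw [hα]
    have : 0 < Real.log T := by linarith
    positivity
  have hpts : s.pts = fun i => x (idx i) := funext fun i => (hidx i).2
  -- compare the two bounds for the squared determinant and take the `j`-th root
  have h1 : par.α ^ 2 ≤ R₀ ^ 2 * r ^ (s.j + 1) := by
    have h2 := sq_det_gram_le (H := H) (x := x) hinj (fun i => (hidx i).1.trans_le htT) heig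
    have h3 := h.pow_le_det
    rw [hpts] at h3
    have h4 : (par.α ^ 2) ^ s.j ≤ (R₀ ^ 2 * r ^ (s.j + 1)) ^ s.j := by
      rw [← pow_mul, mul_comm 2, pow_mul]
      exact (pow_le_pow_left₀ (by positivity) h3 2).trans h2
    exact (pow_le_pow_iff_left₀ (by positivity) (by positivity) hj.ne').mp h4
  have h5 := Real.log_le_log (by positivity) h1
  rw [Real.log_mul (by positivity) (by positivity), Real.log_pow, Real.log_pow, Real.log_pow] at h5
  have h6 : Real.log R₀ ≤ |Real.log c₂| + Real.log T := by
    have := Real.log_le_log hR0 hR₂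
    rw [Real.log_mul hc₂.ne' hT0.ne'] at this
    linarith [le_abs_self (Real.log c₂)]
  have h7 : -|Real.log (Real.log 2)| ≤ Real.log (Real.log T) := by
    have h8 : Real.log 2 ≤ Real.log T :=
      Real.log_le_log two_pos (by exact_mod_cast hT)
    have := Real.log_le_log (Real.log_pos one_lt_two) h8
    linarith [neg_abs_le (Real.log (Real.log 2))]
  have h8 : Real.log par.α = 4 * Real.log (Real.log T) - 4 * Real.log T := by
    rw [hα, Real.log_div (by positivity) (by positivity), Real.log_pow, Real.log_pow]
    norm_num
  have h9 : Real.log (1 / r) = -Real.log r := by rw [one_div, Real.log_inv]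
  rw [bufferConst, div_mul_eq_mul_div, le_div_iff₀ hlogr, h9]
  rw [h9] at hlogr
  push_cast at h5
  have ha := abs_nonneg (Real.log c₂)
  have hb := abs_nonneg (Real.log (Real.log 2))
  have h10 : |Real.log c₂| ≤ 2 * |Real.log c₂| * Real.log T := by nlinarith
  have h11 : |Real.log (Real.log 2)| ≤ 2 * |Real.log (Real.log 2)| * Real.log T := by nlinarith
  nlinarith

end BufferSize

/-! ### The operations of the machine on matrices of known size -/

section Operations

variable {m n k : ℕ}

/-- A matrix as the content of a register. -/
abbrev Mat.of (A : Matrix (Fin m) (Fin n) ℝ) : Mat := ⟨m, n, A⟩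

/-- A vector as a row. -/
def Mat.ofRow (v : Fin n → ℝ) : Mat := ⟨1, n, Matrix.of fun _ i => v i⟩

theorem Mat.ofFn_eq {f : ℕ → ℕ → ℝ} {A : Matrix (Fin m) (Fin n) ℝ}
    (h : ∀ (i : Fin m) (k : Fin n), f i k = A i k) : Mat.ofFn m n f = Mat.of A := by
  rw [Mat.ofFn, Mat.of]
  congr 1
  ext i k
  exact h i k

@[simp]
theorem Mat.entry_of (A : Matrix (Fin m) (Fin n) ℝ) (i : Fin m) (k : Fin n) :
    (Mat.of A).entry i k = A i k := by
  simp [Mat.entry]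

@[simp]
theorem Mat.entry_of_zero_right (A : Matrix (Fin m) (Fin 1) ℝ) (i : Fin m) :
    (Mat.of A).entry i 0 = A i 0 :=
  Mat.entry_of A i 0

theorem Mat.entry_scalar (a : ℝ) : (Mat.scalar a).entry 0 0 = a := by
  simp [Mat.entry, Mat.scalar]

theorem Mat.square_of (K : Matrix (Fin n) (Fin n) ℝ) : (Mat.of K).square = K := by
  ext i k
  simp [Mat.square]

/-- The operation behind `Op.add`. -/
def Mat.add (M N : Mat) : Mat := Mat.ofFn M.r M.c fun i k => M.entry i k + N.entry i k

/-- The operation behind `Op.sub`. -/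
def Mat.sub (M N : Mat) : Mat := Mat.ofFn M.r M.c fun i k => M.entry i k - N.entry i k

/-- The operation behind `Op.mul`. -/
def Mat.mul (M N : Mat) : Mat :=
  Mat.ofFn M.r N.c fun i k => ∑ l ∈ Finset.range M.c, M.entry i l * N.entry l k

/-- The operation behind `Op.smul`. -/
def Mat.smul (M N : Mat) : Mat := Mat.ofFn N.r N.c fun i k => M.entry 0 0 * N.entry i k

/-- The operation behind `Op.transpose`. -/
def Mat.transpose (M : Mat) : Mat := Mat.ofFn M.c M.r fun i k => M.entry k i

/-- The operation behind `Op.one`. -/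
def Mat.one (M : Mat) : Mat := Mat.ofFn M.r M.r fun i k => if i = k then 1 else 0

/-- The operation behind `Op.empty`. -/
def Mat.empty (M : Mat) : Mat := Mat.ofFn M.r 0 fun _ _ => 0

/-- The operation behind `Op.inv`. -/
def Mat.inv (M : Mat) : Mat := Mat.ofFn M.r M.c fun i k => (M.entry i k)⁻¹

/-- The operation behind `Op.sqrt`. -/
def Mat.sqrt (M : Mat) : Mat := Mat.ofFn M.r M.c fun i k => √(M.entry i k)

/-- The operation behind `Op.diag`. -/
def Mat.diag (M : Mat) : Mat := Mat.ofFn M.r M.r fun i k => if i = k then M.entry i 0 else 0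

/-- The operation behind `Op.hcat`. -/
def Mat.hcat (M N : Mat) : Mat :=
  Mat.ofFn M.r (M.c + N.c) fun i k => if k < M.c then M.entry i k else N.entry i (k - M.c)

/-- The operation behind `Op.kernel`. -/
def Mat.kernel {d : ℕ} (κ : EuclideanSpace ℝ (Fin d) → EuclideanSpace ℝ (Fin d) → ℝ)
    (M N : Mat) : Mat :=
  Mat.ofFn M.c N.c fun i k => κ (M.point d i) (N.point d k)

/-- The operation behind `Op.svdU`. -/
def Mat.svdU (svd : SVDRoutine) (M : Mat) : Mat := ⟨M.r, M.r, svd.U M.r M.square⟩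

/-- The operation behind `Op.svdSigma`. -/
def Mat.svdSigma (svd : SVDRoutine) (M : Mat) : Mat := Mat.ofVec (svd.sigma M.r M.square)

@[simp]
theorem Mat.add_of (A B : Matrix (Fin m) (Fin n) ℝ) :
    (Mat.of A).add (Mat.of B) = Mat.of (A + B) :=
  Mat.ofFn_eq fun i k => by simp

@[simp]
theorem Mat.sub_of (A B : Matrix (Fin m) (Fin n) ℝ) :
    (Mat.of A).sub (Mat.of B) = Mat.of (A - B) :=
  Mat.ofFn_eq fun i k => by simp

@[simp]
theorem Mat.mul_of (A : Matrix (Fin m) (Fin n) ℝ) (B : Matrix (Fin n) (Fin k) ℝ) :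
    (Mat.of A).mul (Mat.of B) = Mat.of (A * B) := by
  refine Mat.ofFn_eq fun i k => ?_
  rw [Matrix.mul_apply, ← Fin.sum_univ_eq_sum_range
    (fun l => (Mat.of A).entry i l * (Mat.of B).entry l k)]
  simp

@[simp]
theorem Mat.smul_of (x : ℝ) (A : Matrix (Fin m) (Fin n) ℝ) :
    (Mat.scalar x).smul (Mat.of A) = Mat.of (x • A) :=
  Mat.ofFn_eq fun i k => by simp [Mat.entry_scalar]

@[simp]
theorem Mat.transpose_of (A : Matrix (Fin m) (Fin n) ℝ) : (Mat.of A).transpose = Mat.of Aᵀ :=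
  Mat.ofFn_eq fun i k => by simp

@[simp]
theorem Mat.one_of (A : Matrix (Fin m) (Fin n) ℝ) :
    (Mat.of A).one = Mat.of (1 : Matrix (Fin m) (Fin m) ℝ) :=
  Mat.ofFn_eq fun i k => by simp [Matrix.one_apply, Fin.ext_iff]

@[simp]
theorem Mat.inv_ofVec (v : Fin n → ℝ) : (Mat.ofVec v).inv = Mat.ofVec fun i => (v i)⁻¹ :=
  Mat.ofFn_eq fun i k => congrArg (·⁻¹) (Mat.entry_of (Matrix.of fun i (_ : Fin 1) => v i) i k)

@[simp]
theorem Mat.sqrt_ofVec (v : Fin n → ℝ) : (Mat.ofVec v).sqrt = Mat.ofVec fun i => √(v i) :=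
  Mat.ofFn_eq fun i k => congrArg (√·) (Mat.entry_of (Matrix.of fun i (_ : Fin 1) => v i) i k)

@[simp]
theorem Mat.diag_ofVec (v : Fin n → ℝ) : (Mat.ofVec v).diag = Mat.of (diagonal v) := by
  refine Mat.ofFn_eq (m := n) (n := n) fun i k => ?_
  have h := Mat.entry_of_zero_right (Matrix.of fun i (_ : Fin 1) => v i) i
  simp only [diagonal_apply, Fin.ext_iff]
  exact if_congr Iff.rfl h rfl

@[simp]
theorem Mat.svdU_of (svd : SVDRoutine) (K : Matrix (Fin n) (Fin n) ℝ) :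
    (Mat.of K).svdU svd = Mat.of (svd.U n K) := by
  rw [Mat.svdU, Mat.square_of]

@[simp]
theorem Mat.svdSigma_of (svd : SVDRoutine) (K : Matrix (Fin n) (Fin n) ℝ) :
    (Mat.of K).svdSigma svd = Mat.ofVec (svd.sigma n K) := by
  rw [Mat.svdSigma, Mat.square_of]

@[simp]
theorem Mat.mul_ofVec (A : Matrix (Fin m) (Fin n) ℝ) (v : Fin n → ℝ) :
    (Mat.of A).mul (Mat.ofVec v) = Mat.ofVec (A *ᵥ v) :=
  (Mat.mul_of A _).trans rfl

@[simp]
theorem Mat.ofRow_mul_ofVec (v w : Fin n → ℝ) :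
    (Mat.ofRow v).mul (Mat.ofVec w) = Mat.scalar (v ⬝ᵥ w) :=
  (Mat.mul_of _ _).trans rfl

@[simp]
theorem Mat.ofVec_mul_ofRow (v : Fin m → ℝ) (w : Fin n → ℝ) :
    (Mat.ofVec v).mul (Mat.ofRow w) = Mat.of (vecMulVec v w) := by
  refine (Mat.mul_of _ _).trans (congrArg Mat.of ?_)
  ext i k
  simp [Matrix.mul_apply, vecMulVec_apply]

@[simp]
theorem Mat.scalar_mul_scalar (x y : ℝ) :
    (Mat.scalar x).mul (Mat.scalar y) = Mat.scalar (x * y) := by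
  refine (Mat.mul_of _ _).trans (congrArg Mat.of ?_)
  ext i k
  simp [Matrix.mul_apply]

@[simp]
theorem Mat.scalar_add_scalar (x y : ℝ) :
    (Mat.scalar x).add (Mat.scalar y) = Mat.scalar (x + y) :=
  (Mat.add_of _ _).trans rfl

@[simp]
theorem Mat.scalar_sub_scalar (x y : ℝ) :
    (Mat.scalar x).sub (Mat.scalar y) = Mat.scalar (x - y) :=
  (Mat.sub_of _ _).trans rfl

@[simp]
theorem Mat.ofVec_sub_ofVec (v w : Fin n → ℝ) :
    (Mat.ofVec v).sub (Mat.ofVec w) = Mat.ofVec (v - w) :=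
  (Mat.sub_of _ _).trans rfl

@[simp]
theorem Mat.smul_ofVec (x : ℝ) (v : Fin n → ℝ) :
    (Mat.scalar x).smul (Mat.ofVec v) = Mat.ofVec (x • v) :=
  (Mat.smul_of _ _).trans rfl

@[simp]
theorem Mat.transpose_ofVec (v : Fin n → ℝ) : (Mat.ofVec v).transpose = Mat.ofRow v :=
  (Mat.transpose_of _).trans rfl

@[simp]
theorem Mat.inv_scalar (x : ℝ) : (Mat.scalar x).inv = Mat.scalar x⁻¹ :=
  (Mat.inv_ofVec fun _ : Fin 1 => x).trans rfl

variable {d : ℕ}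

@[simp]
theorem Mat.point_ofPoints (p : Fin n → EuclideanSpace ℝ (Fin d)) (i : Fin n) :
    (Mat.ofPoints p).point d i = p i := by
  ext k
  simp [Mat.point, Mat.ofPoints, Mat.entry]

/-- A single point of `ℝ^d` as a column. -/
def Mat.ofPoint (x : EuclideanSpace ℝ (Fin d)) : Mat := Mat.ofPoints fun _ : Fin 1 => x

@[simp]
theorem Mat.kernel_ofPoints (κ : EuclideanSpace ℝ (Fin d) → EuclideanSpace ℝ (Fin d) → ℝ)
    (p : Fin m → EuclideanSpace ℝ (Fin d)) (q : Fin n → EuclideanSpace ℝ (Fin d)) :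
    Mat.kernel κ (Mat.ofPoints p) (Mat.ofPoints q) = Mat.of (crossGram κ p q) := by
  refine Mat.ofFn_eq (m := m) (n := n) fun i k => ?_
  rw [Mat.point_ofPoints, Mat.point_ofPoints]
  rfl

@[simp]
theorem Mat.kernel_ofPoint (κ : EuclideanSpace ℝ (Fin d) → EuclideanSpace ℝ (Fin d) → ℝ)
    (p : Fin m → EuclideanSpace ℝ (Fin d)) (x : EuclideanSpace ℝ (Fin d)) :
    Mat.kernel κ (Mat.ofPoints p) (Mat.ofPoint x) = Mat.ofVec (kvec κ p x) :=
  (Mat.kernel_ofPoints κ p _).trans rfl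

@[simp]
theorem Mat.kernel_point_point (κ : EuclideanSpace ℝ (Fin d) → EuclideanSpace ℝ (Fin d) → ℝ)
    (x : EuclideanSpace ℝ (Fin d)) :
    Mat.kernel κ (Mat.ofPoint x) (Mat.ofPoint x) = Mat.scalar (κ x x) :=
  (Mat.kernel_ofPoints κ _ _).trans rfl

@[simp]
theorem Mat.hcat_ofPoints (p : Fin n → EuclideanSpace ℝ (Fin d)) (x : EuclideanSpace ℝ (Fin d)) :
    (Mat.ofPoints p).hcat (Mat.ofPoint x)
      = Mat.ofPoints (Fin.snoc p x : Fin (n + 1) → EuclideanSpace ℝ (Fin d)) := by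
  refine Mat.ofFn_eq (m := d) (n := n + 1) fun i k => ?_
  induction k using Fin.lastCases with
  | last => simp [Mat.ofPoints, Mat.ofPoint, Mat.entry]
  | cast k => simp [Mat.ofPoints, Mat.entry]

@[simp]
theorem Mat.empty_ofPoint (x : EuclideanSpace ℝ (Fin d)) :
    (Mat.ofPoint x).empty = Mat.ofPoints (Fin.elim0 : Fin 0 → EuclideanSpace ℝ (Fin d)) :=
  Mat.ofFn_eq (m := d) (n := 0) fun _ k => k.elim0

end Operations

/-! ### The values computed by a program -/

section Values

variable (svd : SVDRoutine) {d : ℕ}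
  (κ : EuclideanSpace ℝ (Fin d) → EuclideanSpace ℝ (Fin d) → ℝ) {n : ℕ}

open Classical in
/-- The registers after a block of code, without the accounting of time and space. -/
def Code.regs : Code n → (Fin n → Mat) → Fin n → Mat
  | .skip, R => R
  | .set dst op, R => Function.update R dst (op.eval svd κ R)
  | .seq p q, R => q.regs (p.regs R)
  | .ifPos a p q, R => if 0 < (R a).entry 0 0 then p.regs R else q.regs R

theorem Code.exec_reg (p : Code n) (cfg : Config n) :
    (p.exec svd κ cfg).reg = p.regs svd κ cfg.reg := by
  induction p generalizing cfg with
  | skip => rfl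
  | set dst op => rfl
  | seq p q ihp ihq => rw [Code.exec, ihq, ihp, Code.regs]
  | ifPos a p q ihp ihq =>
    rw [Code.exec, Code.regs]
    split_ifs
    · exact ihp _
    · exact ihq _

/-- The registers to which a block of code assigns. -/
def Code.writes : Code n → List (Fin n)
  | .skip => []
  | .set dst _ => [dst]
  | .seq p q => p.writes ++ q.writes
  | .ifPos _ p q => p.writes ++ q.writes

theorem Code.regs_of_notMem_writes {p : Code n} {a : Fin n} (h : a ∉ p.writes)
    (R : Fin n → Mat) : p.regs svd κ R a = R a := by
  induction p generalizing R with
  | skip => rfl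
  | set dst op =>
    simp only [Code.writes, List.mem_singleton] at h
    rw [Code.regs, Function.update_of_ne h]
  | seq p q ihp ihq =>
    simp only [Code.writes, List.mem_append, not_or] at h
    rw [Code.regs, ihq h.2, ihp h.1]
  | ifPos b p q ihp ihq =>
    simp only [Code.writes, List.mem_append, not_or] at h
    rw [Code.regs]
    split_ifs
    · exact ihp h.1 R
    · exact ihq h.2 R

/-- Straight-line code. -/
def Code.block : List (Fin n × Op n) → Code n
  | [] => .skip
  | i :: l => .seq (.set i.1 i.2) (Code.block l)

end Values

/-! ### Time and space of a program -/

section Resources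

/-- An upper bound for a number of rows or columns: `1`, the dimension of the instances, or the
size of the buffer. -/
inductive Dim where
  | one
  | pt
  | buf
  deriving DecidableEq

/-- The number which a `Dim` stands for. -/
def Dim.val (d N : ℕ) : Dim → ℕ
  | .one => 1
  | .pt => d
  | .buf => N

variable {n : ℕ}

/-- The shape of the result of an operation, for given shapes of the registers. -/
def Op.shape (Γ : Fin n → Dim × Dim) : Op n → Dim × Dim
  | .num _ => (.one, .one)
  | .copy a => Γ a
  | .empty a => ((Γ a).1, .one)
  | .one a => ((Γ a).1, (Γ a).1)
  | .add a _ => Γ a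
  | .sub a _ => Γ a
  | .mul a b => ((Γ a).1, (Γ b).2)
  | .smul _ a => Γ a
  | .transpose a => ((Γ a).2, (Γ a).1)
  | .inv a => Γ a
  | .sqrt a => Γ a
  | .diag a => ((Γ a).1, (Γ a).1)
  | .hcat a _ => Γ a
  | .kernel a b => ((Γ a).2, (Γ b).2)
  | .svdU a => ((Γ a).1, (Γ a).1)
  | .svdSigma a => ((Γ a).1, .one)

/-- Whether an operation on registers of given shapes is admitted. The `cheap` operations are those
with quadratic cost in the size of the buffer. Concatenation is not admitted, since the shape of its
result depends on the actual sizes of its arguments. -/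
def Op.admitted (cheap : Bool) (Γ : Fin n → Dim × Dim) : Op n → Bool
  | .mul a b => (Γ a).1 ≠ .pt ∧ (Γ a).2 ≠ .pt ∧ (Γ b).2 ≠ .pt ∧
      (cheap → (Γ a).1 = .one ∨ (Γ a).2 = .one ∨ (Γ b).2 = .one)
  | .kernel a b => (Γ a).2 ≠ .pt ∧ (Γ b).2 ≠ .pt ∧ (cheap → (Γ a).2 = .one ∨ (Γ b).2 = .one)
  | .one a => (Γ a).1 ≠ .pt
  | .diag a => (Γ a).1 ≠ .pt
  | .svdU a => (Γ a).1 ≠ .pt ∧ cheap = false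
  | .svdSigma a => (Γ a).1 ≠ .pt ∧ cheap = false
  | .hcat _ _ => false
  | _ => true

/-- Whether a result of the first shape may be stored in a register of the second shape. -/
def Dim.fits (a b : Dim) : Bool := a = b ∨ (a = .one ∧ b = .buf)

/-- Whether a block of code respects the shapes of the registers and uses admitted operations
only. -/
def Code.wellTyped (cheap : Bool) (Γ : Fin n → Dim × Dim) : Code n → Bool
  | .skip => true
  | .set dst op => op.admitted cheap Γ ∧ (op.shape Γ).1.fits (Γ dst).1 ∧
      (op.shape Γ).2.fits (Γ dst).2
  | .seq p q => p.wellTyped cheap Γ ∧ q.wellTyped cheap Γ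
  | .ifPos _ p q => p.wellTyped cheap Γ ∧ q.wellTyped cheap Γ

/-- The number of instructions and tests in a block of code. -/
def Code.length : Code n → ℕ
  | .skip => 0
  | .set _ _ => 1
  | .seq p q => p.length + q.length
  | .ifPos _ p q => 1 + p.length + q.length

/-- An upper bound for the cost of a cheap operation, or of any admitted operation. -/
def stepCost (cheap : Bool) (d N : ℕ) : ℕ :=
  if cheap then 3 * N ^ 2 + N * (d + 1) + 1 else 3 * N ^ 3 + N ^ 2 * (d + 1) + 1

/-- The registers hold matrices of at most the given shapes. -/
def Within (Γ : Fin n → Dim × Dim) (d N : ℕ) (R : Fin n → Mat) : Prop :=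
  ∀ a, (R a).r ≤ (Γ a).1.val d N ∧ (R a).c ≤ (Γ a).2.val d N

/-- An upper bound for the number of memory cells used by `n` registers and one intermediate
result. -/
def spaceBound (n d N : ℕ) : ℕ := (n + 1) * (N ^ 2 + d * N + 1)

variable {Γ : Fin n → Dim × Dim} {d N : ℕ} {R : Fin n → Mat}

theorem Dim.val_le_of_fits (hN : 1 ≤ N) {a b : Dim} (h : a.fits b) : a.val d N ≤ b.val d N := by
  cases a <;> cases b <;> simp_all [Dim.fits, Dim.val]

theorem Dim.val_mul_val_le (hN : 1 ≤ N) {a b : Dim} (h : (a, b) ≠ (.pt, .pt)) :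
    a.val d N * b.val d N ≤ N ^ 2 + d * N := by
  cases a <;> cases b <;> simp_all [Dim.val] <;> nlinarith

theorem Within.size_le (hR : Within Γ d N R) (hN : 1 ≤ N) (hΓ : ∀ a, Γ a ≠ (.pt, .pt))
    (a : Fin n) : (R a).size ≤ N ^ 2 + d * N :=
  (Nat.mul_le_mul (hR a).1 (hR a).2).trans (Dim.val_mul_val_le hN (hΓ a))

theorem Within.cells_add_le (hR : Within Γ d N R) (hN : 1 ≤ N) (hΓ : ∀ a, Γ a ≠ (.pt, .pt))
    {s : ℕ} (hs : s ≤ N ^ 2 + d * N) : cells R + s ≤ spaceBound n d N := by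
  have h : cells R ≤ ∑ _a : Fin n, (N ^ 2 + d * N + 1) :=
    Finset.sum_le_sum fun a _ => Nat.succ_le_succ (hR.size_le hN hΓ a)
  rw [Finset.sum_const, Finset.card_univ, Fintype.card_fin, smul_eq_mul] at h
  rw [spaceBound, add_mul]
  omega

theorem Within.update (hR : Within Γ d N R) {dst : Fin n} {M : Mat}
    (hr : M.r ≤ (Γ dst).1.val d N) (hc : M.c ≤ (Γ dst).2.val d N) :
    Within Γ d N (Function.update R dst M) := by
  intro a
  by_cases h : a = dst
  · subst h
    simpa using ⟨hr, hc⟩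
  · simpa [Function.update_of_ne h] using hR a

theorem Op.eval_shape (svd : SVDRoutine)
    (κ : EuclideanSpace ℝ (Fin d) → EuclideanSpace ℝ (Fin d) → ℝ) (hR : Within Γ d N R)
    {cheap : Bool} {op : Op n} (h : op.admitted cheap Γ) :
    (op.eval svd κ R).r ≤ (op.shape Γ).1.val d N ∧
      (op.eval svd κ R).c ≤ (op.shape Γ).2.val d N := by
  have h0 : Dim.one.val d N = 1 := rfl
  have h1 := fun a => (hR a).1
  have h2 := fun a => (hR a).2
  cases op with
  | hcat a b => exact absurd h Bool.false_ne_true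
  | _ => simp [Op.eval, Op.shape, Mat.ofFn, Mat.scalar, Mat.ofVec, h0, h1, h2]

theorem le_stepCost (hN : 1 ≤ N) {cheap : Bool} {s : ℕ} (hs : s ≤ N ^ 2 + d * N) :
    s + 1 ≤ stepCost cheap d N := by
  rw [stepCost]
  split_ifs
  · nlinarith
  · have h1 : N ≤ N ^ 2 := Nat.le_self_pow two_ne_zero N
    have h2 : N ^ 2 ≤ N ^ 3 := Nat.pow_le_pow_right hN (by norm_num)
    nlinarith [Nat.mul_le_mul_left d h1]

theorem mul_cost_le (hN : 1 ≤ N) {cheap : Bool} {p q s : ℕ} (hp : p ≤ N) (hq : q ≤ N) (hs : s ≤ N)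
    (h : cheap → p ≤ 1 ∨ q ≤ 1 ∨ s ≤ 1) : p * s * (2 * q + 1) + 1 ≤ stepCost cheap d N := by
  rw [stepCost]
  have hNN : N ≤ N ^ 2 := Nat.le_self_pow two_ne_zero N
  split_ifs with hc
  · rcases h hc with h | h | h
    · have h1 : p * s * (2 * q + 1) ≤ 1 * N * (2 * N + 1) := by gcongr
      nlinarith
    · have h1 : p * s * (2 * q + 1) ≤ N * N * (2 * 1 + 1) := by gcongr
      nlinarith
    · have h1 : p * s * (2 * q + 1) ≤ N * 1 * (2 * N + 1) := by gcongr
      nlinarith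
  · have h1 : p * s * (2 * q + 1) ≤ N * N * (2 * N + 1) := by gcongr
    have h2 : N ^ 2 ≤ N ^ 3 := Nat.pow_le_pow_right hN (by norm_num)
    nlinarith

theorem kernel_cost_le {cheap : Bool} {p q : ℕ} (hp : p ≤ N) (hq : q ≤ N)
    (h : cheap → p ≤ 1 ∨ q ≤ 1) : p * q * (d + 1) + 1 ≤ stepCost cheap d N := by
  rw [stepCost]
  split_ifs with hc
  · have h1 : p * q ≤ N := by
      rcases h hc with h | h <;> nlinarith
    have h2 : p * q * (d + 1) ≤ N * (d + 1) := Nat.mul_le_mul_right _ h1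
    nlinarith
  · have h1 : p * q * (d + 1) ≤ N * N * (d + 1) := by gcongr
    nlinarith [Nat.zero_le (N ^ 3)]

theorem Dim.val_le (hN : 1 ≤ N) {a : Dim} (h : a ≠ .pt) : a.val d N ≤ N := by
  cases a <;> simp_all [Dim.val]

theorem Op.cost_le (hN : 1 ≤ N) (hR : Within Γ d N R) (hΓ : ∀ a, Γ a ≠ (.pt, .pt))
    {cheap : Bool} {op : Op n} (h : op.admitted cheap Γ) :
    op.cost d R ≤ stepCost cheap d N := by
  have hr : ∀ a, (Γ a).1 ≠ .pt → (R a).r ≤ N := fun a ha => (hR a).1.trans (Dim.val_le hN ha)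
  have hc : ∀ a, (Γ a).2 ≠ .pt → (R a).c ≤ N := fun a ha => (hR a).2.trans (Dim.val_le hN ha)
  have hr1 : ∀ a, (Γ a).1 = .one → (R a).r ≤ 1 := fun a ha => by simpa [ha, Dim.val] using (hR a).1
  have hc1 : ∀ a, (Γ a).2 = .one → (R a).c ≤ 1 := fun a ha => by simpa [ha, Dim.val] using (hR a).2
  cases op with
  | hcat a b => exact absurd h Bool.false_ne_true
  | num k => exact le_stepCost hN (Nat.zero_le _)
  | empty a => exact le_stepCost hN (Nat.zero_le _)
  | mul a b =>
    simp only [Op.admitted, decide_eq_true_eq] at h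
    refine mul_cost_le hN (hr a h.1) (hc a h.2.1) (hc b h.2.2.1) fun hch => ?_
    rcases h.2.2.2 hch with h | h | h
    · exact .inl (hr1 a h)
    · exact .inr (.inl (hc1 a h))
    · exact .inr (.inr (hc1 b h))
  | kernel a b =>
    simp only [Op.admitted, decide_eq_true_eq] at h
    exact kernel_cost_le (hc a h.1) (hc b h.2.1) fun hch =>
      (h.2.2 hch).imp (hc1 a) (hc1 b)
  | one a =>
    simp only [Op.admitted, decide_eq_true_eq] at h
    have := Nat.mul_le_mul (hr a h) (hr a h)
    exact le_stepCost hN (by nlinarith [Nat.zero_le (d * N)])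
  | diag a =>
    simp only [Op.admitted, decide_eq_true_eq] at h
    have := Nat.mul_le_mul (hr a h) (hr a h)
    exact le_stepCost hN (by nlinarith [Nat.zero_le (d * N)])
  | svdU a =>
    simp only [Op.admitted, decide_eq_true_eq] at h
    have := Nat.pow_le_pow_left (hr a h.1) 3
    simp only [Op.cost, stepCost, h.2, Bool.false_eq_true, if_false]
    nlinarith [Nat.zero_le (N ^ 2 * (d + 1))]
  | svdSigma a =>
    simp only [Op.admitted, decide_eq_true_eq] at h
    have := Nat.pow_le_pow_left (hr a h.1) 3
    simp only [Op.cost, stepCost, h.2, Bool.false_eq_true, if_false]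
    nlinarith [Nat.zero_le (N ^ 2 * (d + 1))]
  | copy a => exact le_stepCost hN (hR.size_le hN hΓ a)
  | add a b => exact le_stepCost hN (hR.size_le hN hΓ a)
  | sub a b => exact le_stepCost hN (hR.size_le hN hΓ a)
  | smul s a => exact le_stepCost hN (hR.size_le hN hΓ a)
  | transpose a => exact le_stepCost hN (hR.size_le hN hΓ a)
  | inv a => exact le_stepCost hN (hR.size_le hN hΓ a)
  | sqrt a => exact le_stepCost hN (hR.size_le hN hΓ a)

theorem one_le_stepCost (cheap : Bool) (d N : ℕ) : 1 ≤ stepCost cheap d N := by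
  rw [stepCost]
  split_ifs <;> omega

/-- The resources used by a configuration: the registers respect the given shapes, the time is
at most `t`, and the space is at most the bound given by the shapes. -/
structure Config.Bounded (Γ : Fin n → Dim × Dim) (d N t : ℕ) (cfg : Config n) : Prop where
  within : Within Γ d N cfg.reg
  time_le : cfg.time ≤ t
  space_le : cfg.space ≤ spaceBound n d N

theorem Config.Bounded.set {t : ℕ} {cfg : Config n} (h : cfg.Bounded Γ d N t) (hN : 1 ≤ N)
    (hΓ : ∀ a, Γ a ≠ (.pt, .pt)) (svd : SVDRoutine)
    (κ : EuclideanSpace ℝ (Fin d) → EuclideanSpace ℝ (Fin d) → ℝ) {dst : Fin n} {op : Op n} {c : ℕ}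
    (hr : (op.eval svd κ cfg.reg).r ≤ (Γ dst).1.val d N)
    (hc : (op.eval svd κ cfg.reg).c ≤ (Γ dst).2.val d N) (hcost : op.cost d cfg.reg ≤ c) :
    ((Code.set dst op).exec svd κ cfg).Bounded Γ d N (t + c) where
  within := h.within.update hr hc
  time_le := Nat.add_le_add h.time_le hcost
  space_le := max_le h.space_le (h.within.cells_add_le hN hΓ
    ((Nat.mul_le_mul hr hc).trans (Dim.val_mul_val_le hN (hΓ dst))))

theorem Config.Bounded.load {t : ℕ} {cfg : Config n} (h : cfg.Bounded Γ d N t) (hN : 1 ≤ N)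
    (hΓ : ∀ a, Γ a ≠ (.pt, .pt)) {dst : Fin n} {M : Mat}
    (hr : M.r ≤ (Γ dst).1.val d N) (hc : M.c ≤ (Γ dst).2.val d N) :
    (cfg.load dst M).Bounded Γ d N (t + stepCost true d N) where
  within := h.within.update hr hc
  time_le := Nat.add_le_add h.time_le (le_stepCost hN
    ((Nat.mul_le_mul hr hc).trans (Dim.val_mul_val_le hN (hΓ dst))))
  space_le := max_le h.space_le (h.within.cells_add_le hN hΓ
    ((Nat.mul_le_mul hr hc).trans (Dim.val_mul_val_le hN (hΓ dst))))

theorem Config.Bounded.mono {t t' : ℕ} {cfg : Config n} (h : cfg.Bounded Γ d N t) (ht : t ≤ t') :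
    cfg.Bounded Γ d N t' :=
  ⟨h.within, h.time_le.trans ht, h.space_le⟩

/-- The resources used by a well typed block of code. -/
theorem Config.Bounded.exec (hN : 1 ≤ N) (hΓ : ∀ a, Γ a ≠ (.pt, .pt)) (svd : SVDRoutine)
    (κ : EuclideanSpace ℝ (Fin d) → EuclideanSpace ℝ (Fin d) → ℝ) {cheap : Bool} {p : Code n}
    (hp : p.wellTyped cheap Γ) {t : ℕ} {cfg : Config n} (h : cfg.Bounded Γ d N t) :
    (p.exec svd κ cfg).Bounded Γ d N (t + p.length * stepCost cheap d N) := by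
  induction p generalizing t cfg with
  | skip => simpa [Code.exec, Code.length] using h
  | set dst op =>
    simp only [Code.wellTyped, decide_eq_true_eq] at hp
    have hs := Op.eval_shape svd κ h.within hp.1
    simpa [Code.length] using h.set hN hΓ svd κ (hs.1.trans (Dim.val_le_of_fits hN hp.2.1))
      (hs.2.trans (Dim.val_le_of_fits hN hp.2.2)) (Op.cost_le hN h.within hΓ hp.1)
  | seq p q ihp ihq =>
    simp only [Code.wellTyped, decide_eq_true_eq] at hp
    rw [Code.exec, Code.length, add_mul, ← add_assoc]
    exact ihq hp.2 (ihp hp.1 h)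
  | ifPos a p q ihp ihq =>
    simp only [Code.wellTyped, decide_eq_true_eq] at hp
    have h1 : Config.Bounded Γ d N (t + 1) ⟨cfg.reg, cfg.time + 1, cfg.space⟩ :=
      ⟨h.within, Nat.succ_le_succ h.time_le, h.space_le⟩
    have h2 := one_le_stepCost cheap d N
    rw [Code.exec, Code.length]
    split_ifs
    · refine (ihp hp.1 h1).mono ?_
      nlinarith [Nat.zero_le (q.length * stepCost cheap d N)]
    · refine (ihq hp.2 h1).mono ?_
      nlinarith [Nat.zero_le (p.length * stepCost cheap d N)]

end Resources

/-! ### Operations as functions of the registers -/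

section EvalLemmas

variable (svd : SVDRoutine) {d : ℕ}
  (κ : EuclideanSpace ℝ (Fin d) → EuclideanSpace ℝ (Fin d) → ℝ) {n : ℕ} (R : Fin n → Mat)
  (a b : Fin n)

@[simp]
theorem Op.eval_num (k : ℕ) : (Op.num k : Op n).eval svd κ R = Mat.scalar k :=
  rfl

@[simp]
theorem Op.eval_copy : (Op.copy a).eval svd κ R = R a :=
  rfl

@[simp]
theorem Op.eval_empty : (Op.empty a).eval svd κ R = (R a).empty :=
  rfl

@[simp]
theorem Op.eval_one : (Op.one a).eval svd κ R = (R a).one :=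
  rfl

@[simp]
theorem Op.eval_add : (Op.add a b).eval svd κ R = (R a).add (R b) :=
  rfl

@[simp]
theorem Op.eval_sub : (Op.sub a b).eval svd κ R = (R a).sub (R b) :=
  rfl

@[simp]
theorem Op.eval_mul : (Op.mul a b).eval svd κ R = (R a).mul (R b) :=
  rfl

@[simp]
theorem Op.eval_smul : (Op.smul a b).eval svd κ R = (R a).smul (R b) :=
  rfl

@[simp]
theorem Op.eval_transpose : (Op.transpose a).eval svd κ R = (R a).transpose :=
  rfl

@[simp]
theorem Op.eval_inv : (Op.inv a).eval svd κ R = (R a).inv :=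
  rfl

@[simp]
theorem Op.eval_sqrt : (Op.sqrt a).eval svd κ R = (R a).sqrt :=
  rfl

@[simp]
theorem Op.eval_diag : (Op.diag a).eval svd κ R = (R a).diag :=
  rfl

@[simp]
theorem Op.eval_kernel : (Op.kernel a b).eval svd κ R = Mat.kernel κ (R a) (R b) :=
  rfl

@[simp]
theorem Op.eval_svdU : (Op.svdU a).eval svd κ R = (R a).svdU svd :=
  rfl

@[simp]
theorem Op.eval_svdSigma : (Op.svdSigma a).eval svd κ R = (R a).svdSigma svd :=
  rfl

end EvalLemmas

/-! ### Registers -/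

namespace Reg

/-- The parameter `μ`. -/
abbrev mu : Fin 27 := 0
/-- The parameter `α`. -/
abbrev alpha : Fin 27 := 1
/-- The parameter `U`. -/
abbrev radius : Fin 27 := 2
/-- The parameter `Y`. -/
abbrev bound : Fin 27 := 3
/-- The current instance. -/
abbrev inst : Fin 27 := 4
/-- The current label. -/
abbrev label : Fin 27 := 5
/-- The prediction. -/
abbrev out : Fin 27 := 6
/-- The buffer. -/
abbrev buf : Fin 27 := 7
/-- The matrix `A`. -/
abbrev cov : Fin 27 := 8
/-- The weight vector. -/
abbrev weight : Fin 27 := 9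
/-- The whitening matrix of the buffer. -/
abbrev whit : Fin 27 := 10
/-- The inverse of `A`. -/
abbrev covInv : Fin 27 := 11
/-- Positive as soon as the buffer and the weight vector have their sizes. -/
abbrev flag : Fin 27 := 12
/-- The step size. -/
abbrev eta : Fin 27 := 13
/-- The feature vector of the instance, later the gradient. -/
abbrev feat : Fin 27 := 14
/-- The feature vector as a row. -/
abbrev featT : Fin 27 := 15
/-- A column of kernel values. -/
abbrev col : Fin 27 := 16
/-- The gradient as a row. -/
abbrev row : Fin 27 := 17
/-- A temporary vector. -/
abbrev vec : Fin 27 := 18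
/-- A temporary scalar. -/
abbrev s1 : Fin 27 := 19
/-- A temporary scalar. -/
abbrev s2 : Fin 27 := 20
/-- A temporary scalar. -/
abbrev s3 : Fin 27 := 21
/-- The enlarged buffer. -/
abbrev newBuf : Fin 27 := 22
/-- A temporary matrix. -/
abbrev m1 : Fin 27 := 23
/-- A temporary matrix. -/
abbrev m2 : Fin 27 := 24
/-- A temporary matrix. -/
abbrev m3 : Fin 27 := 25
/-- A temporary matrix. -/
abbrev m4 : Fin 27 := 26

end Reg

/-! ### The program -/

/-- Compute the step size. -/
def etaCode : Code 27 := .block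
  [(Reg.s1, .mul Reg.radius Reg.radius), (Reg.s2, .mul Reg.bound Reg.bound),
   (Reg.s1, .add Reg.s1 Reg.s2), (Reg.s2, .num 4), (Reg.s1, .mul Reg.s2 Reg.s1),
   (Reg.eta, .inv Reg.s1)]

/-- In the first round, give the empty buffer and the weight vector their sizes. -/
def startupCode : Code 27 := .ifPos Reg.flag .skip (.block
  [(Reg.buf, .empty Reg.inst), (Reg.weight, .kernel Reg.buf Reg.inst), (Reg.flag, .num 1)])

/-- Compute the feature vector of the instance. -/
def featureCode : Code 27 := .block
  [(Reg.col, .kernel Reg.buf Reg.inst), (Reg.feat, .mul Reg.whit Reg.col),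
   (Reg.featT, .transpose Reg.feat)]

/-- Compute the ingredients of the projection. -/
def preClipCode : Code 27 := .block
  [(Reg.s1, .mul Reg.featT Reg.weight), (Reg.vec, .mul Reg.covInv Reg.feat),
   (Reg.s3, .mul Reg.featT Reg.vec), (Reg.s2, .sub Reg.s1 Reg.radius)]

/-- Compute the excess of the unconstrained prediction `q` over the interval `[-U, U]`. At the
start, the registers `s1` and `s2` hold `q` and `q - U`. -/
def clipCode : Code 27 := .ifPos Reg.s2 .skip (.seq
  (.block [(Reg.s2, .add Reg.s1 Reg.radius), (Reg.s1, .num 0), (Reg.s1, .sub Reg.s1 Reg.s2)])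
  (.ifPos Reg.s1 .skip (.block [(Reg.s2, .num 0)])))

/-- Subtract the excess along `A⁻¹ φ`. -/
def postClipCode : Code 27 := .block
  [(Reg.s3, .inv Reg.s3), (Reg.s2, .mul Reg.s2 Reg.s3), (Reg.vec, .smul Reg.s2 Reg.vec),
   (Reg.weight, .sub Reg.weight Reg.vec)]

/-- Compute `α_t - α`. -/
def aldCode : Code 27 := .block
  [(Reg.s1, .kernel Reg.inst Reg.inst), (Reg.s2, .mul Reg.featT Reg.feat),
   (Reg.s1, .sub Reg.s1 Reg.s2), (Reg.s1, .sub Reg.s1 Reg.alpha)]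

/-- Compute the whitening matrix of the enlarged buffer. -/
def whitenCode : Code 27 := .block
  [(Reg.m1, .kernel Reg.newBuf Reg.newBuf), (Reg.m2, .svdSigma Reg.m1), (Reg.m2, .sqrt Reg.m2),
   (Reg.m2, .inv Reg.m2), (Reg.m2, .diag Reg.m2), (Reg.m3, .svdU Reg.m1),
   (Reg.m3, .transpose Reg.m3), (Reg.m3, .mul Reg.m2 Reg.m3)]

/-- Compute the transition matrix and its transpose. -/
def transitionCode : Code 27 := .block
  [(Reg.m1, .kernel Reg.newBuf Reg.buf), (Reg.m1, .mul Reg.m3 Reg.m1),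
   (Reg.m2, .transpose Reg.whit), (Reg.m1, .mul Reg.m1 Reg.m2), (Reg.m2, .transpose Reg.m1)]

/-- Transport `A` and the weight vector to the new feature space. -/
def transportCode : Code 27 := .block
  [(Reg.m4, .one Reg.cov), (Reg.m4, .smul Reg.mu Reg.m4), (Reg.m4, .sub Reg.cov Reg.m4),
   (Reg.m4, .mul Reg.m1 Reg.m4), (Reg.m4, .mul Reg.m4 Reg.m2), (Reg.m2, .one Reg.m4),
   (Reg.m2, .smul Reg.mu Reg.m2), (Reg.cov, .add Reg.m2 Reg.m4),
   (Reg.weight, .mul Reg.m1 Reg.weight)]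

/-- Compute the inverse of `A` from its singular value decomposition. -/
def inverseCode : Code 27 := .block
  [(Reg.m1, .svdU Reg.cov), (Reg.m2, .svdSigma Reg.cov), (Reg.m2, .inv Reg.m2),
   (Reg.m2, .diag Reg.m2), (Reg.m4, .transpose Reg.m1), (Reg.m1, .mul Reg.m1 Reg.m2),
   (Reg.covInv, .mul Reg.m1 Reg.m4)]

/-- Replace the buffer and its whitening matrix. -/
def replaceCode : Code 27 := .block
  [(Reg.whit, .copy Reg.m3), (Reg.buf, .copy Reg.newBuf)]

/-- The part of a growth step after the enlargement of the buffer. -/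
def regrowCode : Code 27 :=
  .seq whitenCode (.seq transitionCode (.seq transportCode (.seq inverseCode
    (.seq replaceCode featureCode))))

/-- A growth step. -/
def growCode : Code 27 := .seq (.set Reg.newBuf (.hcat Reg.buf Reg.inst)) regrowCode

/-- Compute the feature vector, project the weight vector, and compute `α_t - α`. -/
def projectCode : Code 27 :=
  .seq featureCode (.seq preClipCode (.seq clipCode (.seq postClipCode aldCode)))

/-- Update `A`. -/
def covCode : Code 27 := .block
  [(Reg.s1, .sub Reg.out Reg.label), (Reg.s2, .num 2), (Reg.s1, .mul Reg.s2 Reg.s1),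
   (Reg.feat, .smul Reg.s1 Reg.feat), (Reg.row, .transpose Reg.feat),
   (Reg.m1, .mul Reg.feat Reg.row), (Reg.m1, .smul Reg.eta Reg.m1),
   (Reg.cov, .add Reg.cov Reg.m1)]

/-- Update the inverse of `A` by the Sherman–Morrison formula. -/
def covInvCode : Code 27 := .block
  [(Reg.vec, .mul Reg.covInv Reg.feat), (Reg.featT, .transpose Reg.vec),
   (Reg.s1, .mul Reg.row Reg.vec), (Reg.s1, .mul Reg.eta Reg.s1), (Reg.s2, .num 1),
   (Reg.s1, .add Reg.s2 Reg.s1), (Reg.s1, .inv Reg.s1), (Reg.s1, .mul Reg.eta Reg.s1),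
   (Reg.m1, .mul Reg.vec Reg.featT), (Reg.m1, .smul Reg.s1 Reg.m1),
   (Reg.covInv, .sub Reg.covInv Reg.m1)]

/-- Update the weight vector. -/
def weightCode : Code 27 := .block
  [(Reg.vec, .mul Reg.covInv Reg.feat), (Reg.weight, .sub Reg.weight Reg.vec)]

/-- The second half of a round. -/
def updateCode : Code 27 := .seq covCode (.seq covInvCode weightCode)

/-- The first half of a round, up to the decision whether the buffer grows. -/
def testCode : Code 27 := .seq startupCode projectCode

/-- Compute the prediction. -/
def outCode : Code 27 := .set Reg.out (.mul Reg.featT Reg.weight)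

/-- A program for NONS-ALD. It keeps the inverse of `A`, which is updated by the Sherman–Morrison
formula, and recomputed when the buffer grows. -/
def program : Program where
  n := 27
  muReg := Reg.mu
  alphaReg := Reg.alpha
  radReg := Reg.radius
  boundReg := Reg.bound
  xReg := Reg.inst
  yReg := Reg.label
  outReg := Reg.out
  bufReg := Reg.buf
  covReg := Reg.cov
  weightReg := Reg.weight
  init := etaCode
  predictCode := .seq testCode (.seq (.ifPos Reg.s1 growCode .skip) outCode)
  updateCode := updateCode

/-! ### Shapes of the registers -/

/-- The shapes of the registers of the program. -/
def shapes : Fin 27 → Dim × Dim :=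
  ![(.one, .one), (.one, .one), (.one, .one), (.one, .one), (.pt, .one), (.one, .one), (.one, .one),
    (.pt, .buf), (.buf, .buf), (.buf, .one), (.buf, .buf), (.buf, .buf), (.one, .one), (.one, .one),
    (.buf, .one), (.one, .buf), (.buf, .one), (.one, .buf), (.buf, .one), (.one, .one),
    (.one, .one), (.one, .one), (.pt, .buf), (.buf, .buf), (.buf, .buf), (.buf, .buf), (.buf, .buf)]

theorem shapes_ne : ∀ a, shapes a ≠ (.pt, .pt) := by decide

theorem wellTyped_etaCode : etaCode.wellTyped true shapes := by decide

theorem wellTyped_testCode : testCode.wellTyped true shapes := by decide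

theorem wellTyped_regrowCode : regrowCode.wellTyped false shapes := by decide

theorem wellTyped_outCode : outCode.wellTyped true shapes := by decide

theorem wellTyped_updateCode : updateCode.wellTyped true shapes := by decide

/-! ### The values computed by the parts of the program -/

section Values

variable (svd : SVDRoutine) {d : ℕ}
  (κ : EuclideanSpace ℝ (Fin d) → EuclideanSpace ℝ (Fin d) → ℝ) {R : Fin 27 → Mat} {n : ℕ}
  {p : Fin n → EuclideanSpace ℝ (Fin d)} {x : EuclideanSpace ℝ (Fin d)}

theorem regs_etaCode {par : Params} (hU : R Reg.radius = Mat.scalar par.U)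
    (hY : R Reg.bound = Mat.scalar par.Y) :
    etaCode.regs svd κ R Reg.eta = Mat.scalar par.η := by
  simp +decide [etaCode, Code.block, Code.regs, hU, hY, Params.η, sq]

theorem regs_featureCode (hb : R Reg.buf = Mat.ofPoints p)
    (hM : R Reg.whit = Mat.of (whiten svd κ p)) (hx : R Reg.inst = Mat.ofPoint x) :
    featureCode.regs svd κ R Reg.feat = Mat.ofVec (feature svd κ p x) ∧
      featureCode.regs svd κ R Reg.featT = Mat.ofRow (feature svd κ p x) := by
  simp +decide [featureCode, Code.block, Code.regs, hb, hM, hx, feature]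

theorem regs_preClipCode {A' : Matrix (Fin n) (Fin n) ℝ} {φ w : Fin n → ℝ} {U : ℝ}
    (hφ : R Reg.feat = Mat.ofVec φ) (hφ' : R Reg.featT = Mat.ofRow φ)
    (hA : R Reg.covInv = Mat.of A') (hw : R Reg.weight = Mat.ofVec w)
    (hU : R Reg.radius = Mat.scalar U) :
    preClipCode.regs svd κ R Reg.s1 = Mat.scalar (φ ⬝ᵥ w) ∧
      preClipCode.regs svd κ R Reg.vec = Mat.ofVec (A' *ᵥ φ) ∧
      preClipCode.regs svd κ R Reg.s3 = Mat.scalar (φ ⬝ᵥ (A' *ᵥ φ)) ∧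
      preClipCode.regs svd κ R Reg.s2 = Mat.scalar (φ ⬝ᵥ w - U) := by
  simp +decide [preClipCode, Code.block, Code.regs, hφ, hφ', hA, hw, hU]

/-- The two tests of the code distinguish whether the value exceeds `U`, is below `-U`, or lies
between. -/
theorem regs_clipCode {q U : ℝ} (hU0 : 0 ≤ U) (h1 : R Reg.s1 = Mat.scalar q)
    (h2 : R Reg.s2 = Mat.scalar (q - U)) (hU : R Reg.radius = Mat.scalar U) :
    clipCode.regs svd κ R Reg.s2 = Mat.scalar (excess U q) := by
  rw [clipCode, Code.regs]
  by_cases hq : 0 < q - U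
  · rw [if_pos (by rwa [h2, Mat.entry_scalar]), Code.regs, h2, excess, min_eq_left (by linarith),
      max_eq_right (by linarith)]
  · rw [if_neg (by rwa [h2, Mat.entry_scalar]), Code.regs]
    set B : Code 27 := .block
      [(Reg.s2, .add Reg.s1 Reg.radius), (Reg.s1, .num 0), (Reg.s1, .sub Reg.s1 Reg.s2)] with hB
    have hb1 : B.regs svd κ R Reg.s1 = Mat.scalar (0 - (q + U)) := by
      simp +decide [hB, Code.block, Code.regs, h1, hU]
    have hb2 : B.regs svd κ R Reg.s2 = Mat.scalar (q + U) := by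
      simp +decide [hB, Code.block, Code.regs, h1, hU]
    rw [Code.regs]
    by_cases hq' : 0 < 0 - (q + U)
    · rw [if_pos (by rwa [hb1, Mat.entry_scalar]), Code.regs, hb2, excess,
        min_eq_right (by linarith), max_eq_left (by linarith), sub_neg_eq_add]
    · rw [if_neg (by rwa [hb1, Mat.entry_scalar]), excess, min_eq_right (by linarith),
        max_eq_right (by linarith)]
      simp [Code.block, Code.regs]

theorem regs_postClipCode {v w : Fin n → ℝ} {c q : ℝ} (hv : R Reg.vec = Mat.ofVec v)
    (hw : R Reg.weight = Mat.ofVec w) (hc : R Reg.s2 = Mat.scalar c)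
    (hq : R Reg.s3 = Mat.scalar q) :
    postClipCode.regs svd κ R Reg.weight = Mat.ofVec (w - (c * q⁻¹) • v) := by
  simp +decide [postClipCode, Code.block, Code.regs, hv, hw, hc, hq]

theorem regs_aldCode {φ : Fin n → ℝ} {α : ℝ} (hφ : R Reg.feat = Mat.ofVec φ)
    (hφ' : R Reg.featT = Mat.ofRow φ) (hx : R Reg.inst = Mat.ofPoint x)
    (hα : R Reg.alpha = Mat.scalar α) :
    aldCode.regs svd κ R Reg.s1 = Mat.scalar (κ x x - φ ⬝ᵥ φ - α) := by
  simp +decide [aldCode, Code.block, Code.regs, hφ, hφ', hx, hα]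

theorem regs_whitenCode (hb : R Reg.newBuf = Mat.ofPoints p) :
    whitenCode.regs svd κ R Reg.m3 = Mat.of (whiten svd κ p) := by
  simp +decide [whitenCode, Code.block, Code.regs, hb, whiten, gram]

theorem regs_transitionCode {m : ℕ} {p' : Fin m → EuclideanSpace ℝ (Fin d)}
    (hb : R Reg.buf = Mat.ofPoints p) (hb' : R Reg.newBuf = Mat.ofPoints p')
    (hM : R Reg.whit = Mat.of (whiten svd κ p)) (hM' : R Reg.m3 = Mat.of (whiten svd κ p')) :
    transitionCode.regs svd κ R Reg.m1 = Mat.of (transition svd κ p' p) ∧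
      transitionCode.regs svd κ R Reg.m2 = Mat.of (transition svd κ p' p)ᵀ := by
  simp +decide [transitionCode, Code.block, Code.regs, hb, hb', hM, hM',
    transition]

theorem regs_transportCode {m : ℕ} {Q : Matrix (Fin m) (Fin n) ℝ} {A : Matrix (Fin n) (Fin n) ℝ}
    {w : Fin n → ℝ} {μ : ℝ} (hQ : R Reg.m1 = Mat.of Q) (hQ' : R Reg.m2 = Mat.of Qᵀ)
    (hA : R Reg.cov = Mat.of A) (hw : R Reg.weight = Mat.ofVec w)
    (hμ : R Reg.mu = Mat.scalar μ) :
    transportCode.regs svd κ R Reg.cov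
        = Mat.of (μ • (1 : Matrix _ _ ℝ) + Q * (A - μ • (1 : Matrix _ _ ℝ)) * Qᵀ) ∧
      transportCode.regs svd κ R Reg.weight = Mat.ofVec (Q *ᵥ w) := by
  simp +decide [transportCode, Code.block, Code.regs, hQ, hQ', hA, hw, hμ]

theorem regs_inverseCode {A : Matrix (Fin n) (Fin n) ℝ} (hA : A.PosDef)
    (h : R Reg.cov = Mat.of A) : inverseCode.regs svd κ R Reg.covInv = Mat.of A⁻¹ := by
  simp +decide [inverseCode, Code.block, Code.regs, h, svd.inv_eq hA]

theorem regs_covCode {A : Matrix (Fin n) (Fin n) ℝ} {φ : Fin n → ℝ} {q b η : ℝ}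
    (hA : R Reg.cov = Mat.of A) (hφ : R Reg.feat = Mat.ofVec φ) (hq : R Reg.out = Mat.scalar q)
    (hb : R Reg.label = Mat.scalar b) (hη : R Reg.eta = Mat.scalar η) :
    covCode.regs svd κ R Reg.feat = Mat.ofVec ((2 * (q - b)) • φ) ∧
      covCode.regs svd κ R Reg.row = Mat.ofRow ((2 * (q - b)) • φ) ∧
      covCode.regs svd κ R Reg.cov
        = Mat.of (A + η • vecMulVec ((2 * (q - b)) • φ) ((2 * (q - b)) • φ)) := by
  simp +decide [covCode, Code.block, Code.regs, hA, hφ, hq, hb, hη]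

theorem regs_covInvCode {A : Matrix (Fin n) (Fin n) ℝ} (hA : A.PosDef) {g : Fin n → ℝ} {η : ℝ}
    (hη0 : 0 ≤ η) (hA' : R Reg.covInv = Mat.of A⁻¹) (hg : R Reg.feat = Mat.ofVec g)
    (hg' : R Reg.row = Mat.ofRow g) (hη : R Reg.eta = Mat.scalar η) :
    covInvCode.regs svd κ R Reg.covInv = Mat.of (A + η • vecMulVec g g)⁻¹ := by
  simp +decide [covInvCode, Code.block, Code.regs, hA', hg, hg', hη,
    inv_add_vecMulVec hA hη0]

theorem regs_weightCode {A' : Matrix (Fin n) (Fin n) ℝ} {g w : Fin n → ℝ}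
    (hA : R Reg.covInv = Mat.of A') (hg : R Reg.feat = Mat.ofVec g)
    (hw : R Reg.weight = Mat.ofVec w) :
    weightCode.regs svd κ R Reg.weight = Mat.ofVec (w - A' *ᵥ g) := by
  simp +decide [weightCode, Code.block, Code.regs, hA, hg, hw]

end Values

/-! ### Correctness of the program -/

section Correctness

variable (svd : SVDRoutine) {d : ℕ}
  (κ : EuclideanSpace ℝ (Fin d) → EuclideanSpace ℝ (Fin d) → ℝ) (par : Params)

/-- The registers hold the parameters, the state of the algorithm, and what the program keeps in
addition: the whitening matrix and the inverse of `A`. -/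
structure Stores (R : Fin 27 → Mat) (s : State (EuclideanSpace ℝ (Fin d))) : Prop where
  mu : R Reg.mu = Mat.scalar par.μ
  alpha : R Reg.alpha = Mat.scalar par.α
  radius : R Reg.radius = Mat.scalar par.U
  eta : R Reg.eta = Mat.scalar par.η
  flag : R Reg.flag = Mat.scalar 1
  buf : R Reg.buf = Mat.ofPoints s.pts
  cov : R Reg.cov = Mat.of s.A
  weight : R Reg.weight = Mat.ofVec s.w
  whit : R Reg.whit = Mat.of (whiten svd κ s.pts)
  covInv : R Reg.covInv = Mat.of s.A⁻¹

variable {svd κ par} {R : Fin 27 → Mat} {s : State (EuclideanSpace ℝ (Fin d))}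
  {x : EuclideanSpace ℝ (Fin d)}

theorem Stores.update (h : Stores svd κ par R s) {a : Fin 27} (M : Mat)
    (ha : a = Reg.inst ∨ a = Reg.label ∨ a = Reg.out ∨ a = Reg.newBuf) :
    Stores svd κ par (Function.update R a M) s := by
  obtain ⟨h1, h2, h3, h4, h5, h6, h7, h8, h9, h10⟩ := h
  rcases ha with rfl | rfl | rfl | rfl <;> constructor <;> simpa +decide

theorem Stores.regs_projectCode (h : Stores svd κ par R s) (hx : R Reg.inst = Mat.ofPoint x)
    (hA : s.A.PosDef) (hU : 0 ≤ par.U) :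
    Stores svd κ par (projectCode.regs svd κ R) (s.projected svd κ par x) ∧
      projectCode.regs svd κ R Reg.feat = Mat.ofVec (feature svd κ s.pts x) ∧
      projectCode.regs svd κ R Reg.featT = Mat.ofRow (feature svd κ s.pts x) ∧
      projectCode.regs svd κ R Reg.s1 = Mat.scalar
        (κ x x - feature svd κ s.pts x ⬝ᵥ feature svd κ s.pts x - par.α) := by
  have fr : ∀ {p : Code 27} {a : Fin 27}, a ∉ p.writes → ∀ R : Fin 27 → Mat,
      p.regs svd κ R a = R a := fun h R => Code.regs_of_notMem_writes svd κ h R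
  set φ := feature svd κ s.pts x with hφ
  obtain ⟨f1, f2⟩ := regs_featureCode svd κ h.buf h.whit hx
  set R1 := featureCode.regs svd κ R with hR1
  obtain ⟨g1, g2, g3, g4⟩ := regs_preClipCode svd κ (R := R1) f1 f2
    ((fr (by decide) R).trans h.covInv) ((fr (by decide) R).trans h.weight)
    ((fr (by decide) R).trans h.radius)
  set R2 := preClipCode.regs svd κ R1 with hR2
  have hrad : R2 Reg.radius = Mat.scalar par.U :=
    (fr (by decide) R1).trans ((fr (by decide) R).trans h.radius)
  have hw2 : R2 Reg.weight = Mat.ofVec s.w :=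
    (fr (by decide) R1).trans ((fr (by decide) R).trans h.weight)
  have c1 := regs_clipCode svd κ (R := R2) hU g1 g4 hrad
  set R3 := clipCode.regs svd κ R2 with hR3
  have w1 := regs_postClipCode svd κ (R := R3) ((fr (by decide) R2).trans g2)
    ((fr (by decide) R2).trans hw2) c1 ((fr (by decide) R2).trans g3)
  set R4 := postClipCode.regs svd κ R3 with hR4
  have hf4 : R4 Reg.feat = Mat.ofVec φ :=
    (fr (by decide) R3).trans ((fr (by decide) R2).trans ((fr (by decide) R1).trans f1))
  have hf4' : R4 Reg.featT = Mat.ofRow φ :=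
    (fr (by decide) R3).trans ((fr (by decide) R2).trans ((fr (by decide) R1).trans f2))
  have e1 := regs_aldCode svd κ (R := R4) (x := x) (α := par.α) hf4 hf4'
    ((fr (by decide) R3).trans ((fr (by decide) R2).trans ((fr (by decide) R1).trans
      ((fr (by decide) R).trans hx))))
    ((fr (by decide) R3).trans ((fr (by decide) R2).trans ((fr (by decide) R1).trans
      ((fr (by decide) R).trans h.alpha))))
  have hfin : projectCode.regs svd κ R = aldCode.regs svd κ R4 := rfl
  refine ⟨⟨(fr (by decide) R).trans h.mu, (fr (by decide) R).trans h.alpha,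
    (fr (by decide) R).trans h.radius, (fr (by decide) R).trans h.eta,
    (fr (by decide) R).trans h.flag, (fr (by decide) R).trans h.buf, (fr (by decide) R).trans h.cov,
    ?_, (fr (by decide) R).trans h.whit, (fr (by decide) R).trans h.covInv⟩, ?_, ?_, ?_⟩
  · rw [hfin, fr (by decide) R4, w1]
    exact congrArg Mat.ofVec (project_eq hA hU φ s.w).symm
  · rw [hfin, fr (by decide) R4, hf4]
  · rw [hfin, fr (by decide) R4, hf4']
  · exact e1

theorem Stores.regs_regrowCode (h : Stores svd κ par R s) (hx : R Reg.inst = Mat.ofPoint x)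
    (hb : R Reg.newBuf = Mat.ofPoints (Fin.snoc s.pts x : Fin (s.j + 1) → _))
    (hA : (s.grow svd κ par x).A.PosDef) :
    Stores svd κ par (regrowCode.regs svd κ R) (s.grow svd κ par x) ∧
      regrowCode.regs svd κ R Reg.feat
        = Mat.ofVec (feature svd κ (s.grow svd κ par x).pts x) ∧
      regrowCode.regs svd κ R Reg.featT
        = Mat.ofRow (feature svd κ (s.grow svd κ par x).pts x) := by
  have fr : ∀ {p : Code 27} {a : Fin 27}, a ∉ p.writes → ∀ R : Fin 27 → Mat,
      p.regs svd κ R a = R a := fun h R => Code.regs_of_notMem_writes svd κ h R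
  have a1 := regs_whitenCode svd κ hb
  set R1 := whitenCode.regs svd κ R with hR1
  obtain ⟨b1, b2⟩ := regs_transitionCode svd κ (R := R1) ((fr (by decide) R).trans h.buf)
    ((fr (by decide) R).trans hb) ((fr (by decide) R).trans h.whit) a1
  set R2 := transitionCode.regs svd κ R1 with hR2
  obtain ⟨c1, c2⟩ := regs_transportCode svd κ (R := R2) b1 b2
    ((fr (by decide) R1).trans ((fr (by decide) R).trans h.cov))
    ((fr (by decide) R1).trans ((fr (by decide) R).trans h.weight))
    ((fr (by decide) R1).trans ((fr (by decide) R).trans h.mu))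
  set R3 := transportCode.regs svd κ R2 with hR3
  have d1 := regs_inverseCode svd κ (R := R3) hA c1
  set R4 := inverseCode.regs svd κ R3 with hR4
  have hm : R4 Reg.m3 = Mat.of (whiten svd κ (Fin.snoc s.pts x : Fin (s.j + 1) → _)) :=
    (fr (by decide) R3).trans ((fr (by decide) R2).trans ((fr (by decide) R1).trans a1))
  have hn : R4 Reg.newBuf = Mat.ofPoints (Fin.snoc s.pts x : Fin (s.j + 1) → _) :=
    (fr (by decide) R3).trans ((fr (by decide) R2).trans ((fr (by decide) R1).trans
      ((fr (by decide) R).trans hb)))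
  have hi : R4 Reg.inst = Mat.ofPoint x :=
    (fr (by decide) R3).trans ((fr (by decide) R2).trans ((fr (by decide) R1).trans
      ((fr (by decide) R).trans hx)))
  have e1 : replaceCode.regs svd κ R4 Reg.whit
      = Mat.of (whiten svd κ (Fin.snoc s.pts x : Fin (s.j + 1) → _)) := by
    simp +decide [replaceCode, Code.block, Code.regs, hm]
  have e2 : replaceCode.regs svd κ R4 Reg.buf
      = Mat.ofPoints (Fin.snoc s.pts x : Fin (s.j + 1) → _) := by
    simp +decide [replaceCode, Code.block, Code.regs, hn]
  obtain ⟨f1, f2⟩ := regs_featureCode svd κ e2 e1 ((fr (by decide) R4).trans hi)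
  set R5 := replaceCode.regs svd κ R4 with hR5
  have fr' : ∀ {a : Fin 27}, a ∉ regrowCode.writes → regrowCode.regs svd κ R a = R a :=
    fun h => fr h R
  have hfin : regrowCode.regs svd κ R = featureCode.regs svd κ R5 := rfl
  have k1 : R5 Reg.cov = Mat.of (s.grow svd κ par x).A :=
    (fr (by decide) R4).trans ((fr (by decide) R3).trans c1)
  have k2 : R5 Reg.weight = Mat.ofVec (s.grow svd κ par x).w :=
    (fr (by decide) R4).trans ((fr (by decide) R3).trans c2)
  have k3 : R5 Reg.covInv = Mat.of (s.grow svd κ par x).A⁻¹ := (fr (by decide) R4).trans d1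
  clear_value R5
  refine ⟨⟨(fr' (by decide)).trans h.mu, (fr' (by decide)).trans h.alpha,
    (fr' (by decide)).trans h.radius, (fr' (by decide)).trans h.eta,
    (fr' (by decide)).trans h.flag, ?_, ?_, ?_, ?_, ?_⟩, ?_, ?_⟩
  · rw [hfin, fr (by decide) R5]
    exact e2
  · rw [hfin, fr (by decide) R5]
    exact k1
  · rw [hfin, fr (by decide) R5]
    exact k2
  · rw [hfin, fr (by decide) R5]
    exact e1
  · rw [hfin, fr (by decide) R5]
    exact k3
  · rw [hfin]
    exact f1
  · rw [hfin]
    exact f2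

theorem Stores.regs_updateCode (h : Stores svd κ par R s) {b : ℝ}
    (hf : R Reg.feat = Mat.ofVec (feature svd κ s.pts x))
    (hq : R Reg.out = Mat.scalar (s.predict svd κ x)) (hb : R Reg.label = Mat.scalar b)
    (hA : s.A.PosDef) (hη : 0 ≤ par.η) :
    Stores svd κ par (updateCode.regs svd κ R) (s.newton svd κ par x b) := by
  have fr : ∀ {p : Code 27} {a : Fin 27}, a ∉ p.writes → ∀ R : Fin 27 → Mat,
      p.regs svd κ R a = R a := fun h R => Code.regs_of_notMem_writes svd κ h R
  obtain ⟨a1, a2, a3⟩ := regs_covCode svd κ h.cov hf hq hb h.eta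
  set R1 := covCode.regs svd κ R with hR1
  have b1 := regs_covInvCode svd κ (R := R1) hA hη ((fr (by decide) R).trans h.covInv) a1 a2
    ((fr (by decide) R).trans h.eta)
  set R2 := covInvCode.regs svd κ R1 with hR2
  have c1 := regs_weightCode svd κ (R := R2) b1 ((fr (by decide) R1).trans a1)
    ((fr (by decide) R1).trans ((fr (by decide) R).trans h.weight))
  have fr' : ∀ {a : Fin 27}, a ∉ updateCode.writes →
      updateCode.regs svd κ R a = R a := fun h => fr h R
  exact ⟨(fr' (by decide)).trans h.mu, (fr' (by decide)).trans h.alpha,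
    (fr' (by decide)).trans h.radius, (fr' (by decide)).trans h.eta, (fr' (by decide)).trans h.flag,
    (fr' (by decide)).trans h.buf, (fr (by decide) R2).trans ((fr (by decide) R1).trans a3), c1,
    (fr' (by decide)).trans h.whit, (fr (by decide) R2).trans b1⟩

theorem Stores.regs_startupCode (h : Stores svd κ par R s) :
    startupCode.regs svd κ R = R := by
  rw [startupCode, Code.regs, if_pos (by rw [h.flag, Mat.entry_scalar]; exact one_pos)]
  rfl

/-- The first round starts with the initial state of the algorithm. -/
theorem stores_startupCode_initial (hmu : R Reg.mu = Mat.scalar par.μ)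
    (hα : R Reg.alpha = Mat.scalar par.α) (hU : R Reg.radius = Mat.scalar par.U)
    (hη : R Reg.eta = Mat.scalar par.η) (hflag : R Reg.flag = ⟨0, 0, 0⟩)
    (hcov : R Reg.cov = ⟨0, 0, 0⟩) (hwhit : R Reg.whit = ⟨0, 0, 0⟩)
    (hinv : R Reg.covInv = ⟨0, 0, 0⟩) (hx : R Reg.inst = Mat.ofPoint x) :
    Stores svd κ par (startupCode.regs svd κ R) (State.initial _) := by
  have hneg : ¬ 0 < (R Reg.flag).entry 0 0 := by
    rw [hflag]
    simp [Mat.entry]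
  rw [startupCode, Code.regs, if_neg hneg]
  have h0 : ∀ A : Matrix (Fin 0) (Fin 0) ℝ, (⟨0, 0, 0⟩ : Mat) = Mat.of A := fun A =>
    congrArg Mat.of (Subsingleton.elim _ _)
  refine ⟨?_, ?_, ?_, ?_, ?_, ?_, ?_, ?_, ?_, ?_⟩
  · simpa +decide [Code.block, Code.regs]
  · simpa +decide [Code.block, Code.regs]
  · simpa +decide [Code.block, Code.regs]
  · simpa +decide [Code.block, Code.regs]
  · simp +decide [Code.block, Code.regs]
  · simp +decide [Code.block, Code.regs, hx]
    rfl
  · refine Eq.trans ?_ (h0 _)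
    simpa +decide [Code.block, Code.regs]
  · simp +decide [Code.block, Code.regs, hx]
    exact congrArg Mat.ofVec (Subsingleton.elim (α := Fin 0 → ℝ) _ _)
  · refine Eq.trans ?_ (h0 _)
    simpa +decide [Code.block, Code.regs]
  · refine Eq.trans ?_ (h0 _)
    simpa +decide [Code.block, Code.regs]

end Correctness

/-! ### The first half of a round -/

section Rounds

variable {svd : SVDRoutine} {d : ℕ} {H : Type*} [NormedAddCommGroup H] [InnerProductSpace ℝ H]
  [CompleteSpace H] [RKHS ℝ H (EuclideanSpace ℝ (Fin d)) ℝ] {par : Params} {R : Fin 27 → Mat}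
  {s : State (EuclideanSpace ℝ (Fin d))} {a : EuclideanSpace ℝ (Fin d)}

/-- What the first half of a round needs: once the buffer has its size, the registers hold the state
and the instance, and the matrices that occur are positive definite. -/
structure RoundReady (svd : SVDRoutine) (H : Type*) [NormedAddCommGroup H] [InnerProductSpace ℝ H]
    [CompleteSpace H] [RKHS ℝ H (EuclideanSpace ℝ (Fin d)) ℝ] (par : Params) (R : Fin 27 → Mat)
    (s : State (EuclideanSpace ℝ (Fin d))) (a : EuclideanSpace ℝ (Fin d)) : Prop where
  stores : Stores svd (scalarKernel H) par (startupCode.regs svd (scalarKernel H) R) s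
  inst : startupCode.regs svd (scalarKernel H) R Reg.inst = Mat.ofPoint a
  gram_posDef : (gram (scalarKernel H) s.pts).PosDef
  cov_posDef : s.A.PosDef
  ready_posDef : (s.ready svd (scalarKernel H) par a).A.PosDef
  radius_nonneg : 0 ≤ par.U

theorem RoundReady.regs_testCode (h : RoundReady svd H par R s a) :
    Stores svd (scalarKernel H) par (testCode.regs svd (scalarKernel H) R)
        (s.projected svd (scalarKernel H) par a) ∧
      testCode.regs svd (scalarKernel H) R Reg.feat
        = Mat.ofVec (feature svd (scalarKernel H) s.pts a) ∧
      testCode.regs svd (scalarKernel H) R Reg.featT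
        = Mat.ofRow (feature svd (scalarKernel H) s.pts a) ∧
      (0 < (testCode.regs svd (scalarKernel H) R Reg.s1).entry 0 0 ↔
        par.α < aldError (scalarKernel H) s.pts a) ∧
      testCode.regs svd (scalarKernel H) R Reg.inst = Mat.ofPoint a := by
  obtain ⟨h1, h2, h3, h4⟩ := h.stores.regs_projectCode h.inst h.cov_posDef h.radius_nonneg
  refine ⟨h1, h2, h3, ?_, ?_⟩
  · change 0 < (projectCode.regs svd (scalarKernel H)
      (startupCode.regs svd (scalarKernel H) R) Reg.s1).entry 0 0 ↔ _
    rw [h4, Mat.entry_scalar, aldError_eq svd h.gram_posDef, sub_pos]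
  · exact (Code.regs_of_notMem_writes svd (scalarKernel H) (p := projectCode) (by decide) _).trans
      h.inst

theorem Stores.regs_outCode {κ : EuclideanSpace ℝ (Fin d) → EuclideanSpace ℝ (Fin d) → ℝ}
    (h : Stores svd κ par R s) (hf : R Reg.feat = Mat.ofVec (feature svd κ s.pts a))
    (hf' : R Reg.featT = Mat.ofRow (feature svd κ s.pts a)) :
    Stores svd κ par (outCode.regs svd κ R) s ∧
      outCode.regs svd κ R Reg.feat = Mat.ofVec (feature svd κ s.pts a) ∧
      outCode.regs svd κ R Reg.out = Mat.scalar (s.predict svd κ a) := by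
  refine ⟨h.update _ (.inr (.inr (.inl rfl))), ?_, ?_⟩
  · simp +decide [outCode, Code.regs, hf]
  · simp +decide [outCode, Code.regs, hf', h.weight, State.predict, dotProduct_comm]

/-- The first half of a round leaves the state with which the prediction is made, the feature vector
of the instance, and the prediction. -/
theorem RoundReady.regs_predictCode (h : RoundReady svd H par R s a) :
    let R' := program.predictCode.regs svd (scalarKernel H) R
    let s' := s.ready svd (scalarKernel H) par a
    Stores svd (scalarKernel H) par R' s' ∧
      R' Reg.feat = Mat.ofVec (feature svd (scalarKernel H) s'.pts a) ∧
      R' Reg.out = Mat.scalar (s'.predict svd (scalarKernel H) a) := by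
  intro R' s'
  obtain ⟨h1, h2, h3, h4, h5⟩ := h.regs_testCode
  set R1 := testCode.regs svd (scalarKernel H) R with hR1
  have hR' : R' = outCode.regs svd (scalarKernel H)
      ((Code.ifPos Reg.s1 growCode .skip).regs svd (scalarKernel H) R1) := rfl
  have hA := h.ready_posDef
  by_cases hald : par.α < aldError (scalarKernel H) s.pts a
  · have hs' : s' = (s.projected svd (scalarKernel H) par a).grow svd (scalarKernel H) par a :=
      ready_of_lt hald
    rw [ready_of_lt hald] at hA
    rw [hR', Code.regs, if_pos (h4.mpr hald), hs']
    have hcat : (R1 Reg.buf).hcat (R1 Reg.inst)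
        = Mat.ofPoints (Fin.snoc s.pts a : Fin (s.j + 1) → _) := by
      rw [h1.buf, h5]
      exact Mat.hcat_ofPoints s.pts a
    have hgrow : growCode.regs svd (scalarKernel H) R1 = regrowCode.regs svd (scalarKernel H)
        (Function.update R1 Reg.newBuf ((R1 Reg.buf).hcat (R1 Reg.inst))) := rfl
    rw [hgrow]
    obtain ⟨k1, k2, k3⟩ := (h1.update ((R1 Reg.buf).hcat (R1 Reg.inst))
      (.inr (.inr (.inr rfl)))).regs_regrowCode (x := a)
      (by rw [Function.update_of_ne (by decide)]; exact h5)
      (by rw [Function.update_self]; exact hcat) hA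
    exact k1.regs_outCode k2 k3
  · have hs' : s' = s.projected svd (scalarKernel H) par a := ready_of_not_lt hald
    rw [hR', Code.regs, if_neg (fun hh => hald (h4.mp hh)), hs']
    exact h1.regs_outCode h2 h3

/-- The first half of a round takes a quadratic number of steps, and a cubic number more if the
buffer grows. -/
theorem RoundReady.bounded_predictCode {N b : ℕ} (hN : 1 ≤ N) {cfg : Config 27}
    (h : RoundReady svd H par cfg.reg s a)
    (hj : (s.ready svd (scalarKernel H) par a).j ≤ N)
    (hb : cfg.Bounded shapes d N
      (b + s.j * ((regrowCode.length + 1) * stepCost false d N))) :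
    (program.predictCode.exec svd (scalarKernel H) cfg).Bounded shapes d N
      (b + (testCode.length + 2) * stepCost true d N
        + (s.ready svd (scalarKernel H) par a).j
          * ((regrowCode.length + 1) * stepCost false d N)) := by
  obtain ⟨h1, -, -, h4, h5⟩ := h.regs_testCode
  have hb1 := hb.exec hN shapes_ne svd (scalarKernel H) wellTyped_testCode
  rw [← Code.exec_reg] at h1 h4 h5
  set cfg1 := testCode.exec svd (scalarKernel H) cfg with hcfg1
  have hexec : program.predictCode.exec svd (scalarKernel H) cfg
      = outCode.exec svd (scalarKernel H)
        ((Code.ifPos Reg.s1 growCode .skip).exec svd (scalarKernel H) cfg1) := rfl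
  have hc := one_le_stepCost true d N
  have hout : outCode.length = 1 := rfl
  have hb2 : Config.Bounded shapes d N _ ⟨cfg1.reg, cfg1.time + 1, cfg1.space⟩ :=
    ⟨hb1.within, Nat.succ_le_succ hb1.time_le, hb1.space_le⟩
  rw [hexec, Code.exec]
  by_cases hald : par.α < aldError (scalarKernel H) s.pts a
  · have hjr : (s.ready svd (scalarKernel H) par a).j = s.j + 1 := by
      rw [ready_of_lt hald]
      rfl
    rw [if_pos (h4.mpr hald), hjr]
    rw [hjr] at hj
    have hbr : (cfg1.reg Reg.buf).r = d ∧ (cfg1.reg Reg.buf).c = s.j := by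
      rw [h1.buf]
      exact ⟨rfl, rfl⟩
    have hir : (cfg1.reg Reg.inst).c = 1 := by
      rw [h5]
      rfl
    have hb3 := hb2.set (dst := Reg.newBuf) (op := .hcat Reg.buf Reg.inst)
      (c := stepCost false d N) hN shapes_ne svd (scalarKernel H)
      (by change (cfg1.reg Reg.buf).r ≤ d; rw [hbr.1])
      (by change (cfg1.reg Reg.buf).c + (cfg1.reg Reg.inst).c ≤ N; rwa [hbr.2, hir])
      (by
        change (cfg1.reg Reg.buf).r * ((cfg1.reg Reg.buf).c + (cfg1.reg Reg.inst).c) + 1 ≤ _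
        rw [hbr.1, hbr.2, hir]
        exact le_stepCost hN ((Nat.mul_le_mul_left d hj).trans (Nat.le_add_left _ _)))
    have hb4 := hb3.exec hN shapes_ne svd (scalarKernel H) wellTyped_regrowCode
    refine (hb4.exec hN shapes_ne svd (scalarKernel H) wellTyped_outCode).mono ?_
    rw [hout]
    nlinarith
  · have hjr : (s.ready svd (scalarKernel H) par a).j = s.j := by
      rw [ready_of_not_lt hald]
      rfl
    rw [if_neg (fun hh => hald (h4.mp hh)), hjr, Code.exec]
    refine (hb2.exec hN shapes_ne svd (scalarKernel H) wellTyped_outCode).mono ?_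
    rw [hout]
    nlinarith

end Rounds

/-! ### The whole run -/

section Run

variable {d : ℕ} {H : Type*} [NormedAddCommGroup H] [InnerProductSpace ℝ H]
  [CompleteSpace H] [RKHS ℝ H (EuclideanSpace ℝ (Fin d)) ℝ] {par : Params}

/-- The registers after the parameters have been loaded. -/
def inputRegs (par : Params) : Fin 27 → Mat :=
  Function.update (Function.update (Function.update (Function.update (fun _ => ⟨0, 0, 0⟩)
    Reg.mu (Mat.scalar par.μ)) Reg.alpha (Mat.scalar par.α)) Reg.radius (Mat.scalar par.U))
    Reg.bound (Mat.scalar par.Y)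

theorem inputRegs_of_lt (par : Params) {a : Fin 27} (ha : Reg.bound < a) :
    inputRegs par a = ⟨0, 0, 0⟩ := by
  have h : ∀ b : Fin 27, b ≤ Reg.bound → a ≠ b := fun b hb => (hb.trans_lt ha).ne'
  rw [inputRegs, Function.update_of_ne (h _ (by decide)), Function.update_of_ne (h _ (by decide)),
    Function.update_of_ne (h _ (by decide)), Function.update_of_ne (h _ (by decide))]

theorem inputRegs_mu (par : Params) : inputRegs par Reg.mu = Mat.scalar par.μ := by
  rw [inputRegs, Function.update_of_ne (by decide), Function.update_of_ne (by decide),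
    Function.update_of_ne (by decide), Function.update_self]

theorem inputRegs_alpha (par : Params) : inputRegs par Reg.alpha = Mat.scalar par.α := by
  rw [inputRegs, Function.update_of_ne (by decide), Function.update_of_ne (by decide),
    Function.update_self]

theorem inputRegs_radius (par : Params) : inputRegs par Reg.radius = Mat.scalar par.U := by
  rw [inputRegs, Function.update_of_ne (by decide), Function.update_self]

theorem inputRegs_bound (par : Params) : inputRegs par Reg.bound = Mat.scalar par.Y :=
  Function.update_self _ _ _

theorem start_reg (svd : SVDRoutine)
    (κ : EuclideanSpace ℝ (Fin d) → EuclideanSpace ℝ (Fin d) → ℝ) (par : Params) :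
    (program.start svd κ par).reg = etaCode.regs svd κ (inputRegs par) :=
  Code.exec_reg svd κ etaCode _

/-- After the start of the program and the arrival of the first instance, the registers hold the
initial state. -/
theorem stores_startupCode_start (svd : SVDRoutine)
    (κ : EuclideanSpace ℝ (Fin d) → EuclideanSpace ℝ (Fin d) → ℝ) (par : Params)
    (a : EuclideanSpace ℝ (Fin d)) :
    Stores svd κ par (startupCode.regs svd κ
      (Function.update (etaCode.regs svd κ (inputRegs par)) Reg.inst (Mat.ofPoint a)))
      (State.initial _) := by
  have hup : ∀ {b : Fin 27}, b ≠ Reg.inst → b ∉ etaCode.writes →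
      Function.update (etaCode.regs svd κ (inputRegs par)) Reg.inst (Mat.ofPoint a) b
        = inputRegs par b := fun h1 h2 => by
    rw [Function.update_of_ne h1]
    exact Code.regs_of_notMem_writes svd κ h2 _
  refine stores_startupCode_initial (x := a)
    ((hup (by decide) (by decide)).trans (inputRegs_mu par))
    ((hup (by decide) (by decide)).trans (inputRegs_alpha par))
    ((hup (by decide) (by decide)).trans (inputRegs_radius par)) ?_
    ((hup (by decide) (by decide)).trans (inputRegs_of_lt par (by decide)))
    ((hup (by decide) (by decide)).trans (inputRegs_of_lt par (by decide)))
    ((hup (by decide) (by decide)).trans (inputRegs_of_lt par (by decide)))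
    ((hup (by decide) (by decide)).trans (inputRegs_of_lt par (by decide)))
    (Function.update_self _ _ _)
  rw [Function.update_of_ne (by decide)]
  exact regs_etaCode svd κ (inputRegs_radius par) (inputRegs_bound par)

theorem Params.eta_nonneg (par : Params) : 0 ≤ par.η := by
  rw [Params.η]
  positivity

/-- A round takes the state of the algorithm to the next one. -/
theorem stores_configAt_succ (svd : SVDRoutine) {x : ℕ → EuclideanSpace ℝ (Fin d)} {y : ℕ → ℝ}
    {t : ℕ} (h : RoundReady svd H par (Function.update
      (program.configAt svd (scalarKernel H) par x y t).reg Reg.inst (Mat.ofPoint (x t)))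
      (stateAt svd (scalarKernel H) par x y t) (x t)) :
    Stores svd (scalarKernel H) par (program.configAt svd (scalarKernel H) par x y (t + 1)).reg
        (stateAt svd (scalarKernel H) par x y (t + 1)) := by
  obtain ⟨h1, h2, h3⟩ := h.regs_predictCode
  have hreg : (program.configAt svd (scalarKernel H) par x y (t + 1)).reg
      = updateCode.regs svd (scalarKernel H) (Function.update
        (program.predictCode.regs svd (scalarKernel H) (Function.update
          (program.configAt svd (scalarKernel H) par x y t).reg Reg.inst (Mat.ofPoint (x t))))
        Reg.label (Mat.scalar (y t))) := by
    refine (Code.exec_reg svd (scalarKernel H) updateCode _).trans ?_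
    exact congrArg (fun R => updateCode.regs svd (scalarKernel H)
      (Function.update R Reg.label (Mat.scalar (y t))))
      (Code.exec_reg svd (scalarKernel H) program.predictCode _)
  rw [hreg]
  exact (h1.update _ (.inr (.inl rfl))).regs_updateCode (x := x t)
    ((Function.update_of_ne (by decide) _ _).trans h2)
    ((Function.update_of_ne (by decide) _ _).trans h3) (Function.update_self _ _ _)
    h.ready_posDef par.eta_nonneg

/-- Before every round the registers hold the state of the algorithm. -/
theorem roundReady (svd : SVDRoutine) (hμ : 0 < par.μ) (hα : 0 < par.α) (hU : 0 ≤ par.U)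
    (x : ℕ → EuclideanSpace ℝ (Fin d)) (y : ℕ → ℝ) (t : ℕ) :
    RoundReady svd H par (Function.update
      (program.configAt svd (scalarKernel H) par x y t).reg Reg.inst (Mat.ofPoint (x t)))
      (stateAt svd (scalarKernel H) par x y t) (x t) := by
  have hinv := invariant_stateAt (H := H) svd hμ hα par.eta_nonneg x y
  suffices h : Stores svd (scalarKernel H) par (startupCode.regs svd (scalarKernel H)
      (Function.update (program.configAt svd (scalarKernel H) par x y t).reg Reg.inst
        (Mat.ofPoint (x t)))) (stateAt svd (scalarKernel H) par x y t) from
    ⟨h, (Code.regs_of_notMem_writes svd (scalarKernel H) (p := startupCode) (by decide) _).trans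
      (Function.update_self _ _ _), (hinv t).gram_posDef, (hinv t).cov_posDef,
      ((hinv t).ready hμ hα).cov_posDef, hU⟩
  cases t with
  | zero =>
    rw [show program.configAt svd (scalarKernel H) par x y 0
      = program.start svd (scalarKernel H) par from rfl, start_reg]
    exact stores_startupCode_start svd (scalarKernel H) par (x 0)
  | succ t =>
    have hs := (stores_configAt_succ svd (roundReady svd hμ hα hU x y t)).update
      (Mat.ofPoint (x (t + 1))) (.inl rfl)
    rwa [hs.regs_startupCode]

theorem implements (svd : SVDRoutine) (hμ : 0 < par.μ) (hα : 0 < par.α) (hU : 0 ≤ par.U)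
    (x : ℕ → EuclideanSpace ℝ (Fin d)) (y : ℕ → ℝ) (T : ℕ) :
    program.Implements svd (scalarKernel H) par x y T := by
  intro t _
  have hr := roundReady (H := H) svd hμ hα hU x y t
  have hs := stores_configAt_succ svd hr
  refine ⟨?_, hs.buf, hs.cov, hs.weight⟩
  have h : (program.halfRound svd (scalarKernel H)
      (program.configAt svd (scalarKernel H) par x y t) (x t)).reg Reg.out
      = Mat.scalar (prediction svd (scalarKernel H) par x y t) :=
    (congrFun (Code.exec_reg svd (scalarKernel H) program.predictCode _) Reg.out).trans
      hr.regs_predictCode.2.2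
  exact (congrArg (fun M => M.entry 0 0) h).trans (Mat.entry_scalar _)

/-- The number of instructions of a round which does not let the buffer grow; each of the two
inputs counts as one. -/
def roundLength : ℕ := testCode.length + updateCode.length + 4

/-- Every round costs a number of cheap operations, and every growth of the buffer a number of
expensive ones. -/
theorem bounded_configAt (svd : SVDRoutine) (hμ : 0 < par.μ) (hα : 0 < par.α) (hU : 0 ≤ par.U)
    (x : ℕ → EuclideanSpace ℝ (Fin d)) (y : ℕ → ℝ) {N T : ℕ} (hN : 1 ≤ N)
    (hj : ∀ t ≤ T, (stateAt svd (scalarKernel H) par x y t).j ≤ N) {t : ℕ} (ht : t ≤ T) :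
    (program.configAt svd (scalarKernel H) par x y t).Bounded shapes d N
      ((etaCode.length + 4 + t * roundLength) * stepCost true d N
        + (stateAt svd (scalarKernel H) par x y t).j
          * ((regrowCode.length + 1) * stepCost false d N)) := by
  induction t with
  | zero =>
    have h0 : Config.Bounded shapes d N 0
        ({ reg := fun _ => ⟨0, 0, 0⟩, time := 0, space := 27 } : Config 27) := by
      refine ⟨fun a => ⟨Nat.zero_le _, Nat.zero_le _⟩, le_rfl, ?_⟩
      change 27 ≤ (27 + 1) * (N ^ 2 + d * N + 1)
      omega
    have h1 := (((h0.load (dst := Reg.mu) (M := Mat.scalar par.μ) hN shapes_ne le_rfl le_rfl).load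
      (dst := Reg.alpha) (M := Mat.scalar par.α) hN shapes_ne le_rfl le_rfl).load
      (dst := Reg.radius) (M := Mat.scalar par.U) hN shapes_ne le_rfl le_rfl).load
      (dst := Reg.bound) (M := Mat.scalar par.Y) hN shapes_ne le_rfl le_rfl
    refine (h1.exec hN shapes_ne svd (scalarKernel H) wellTyped_etaCode).mono ?_
    exact Nat.le_add_right_of_le (le_of_eq (by ring))
  | succ t ih =>
    have h1 := (ih (by omega)).load (dst := Reg.inst) (M := Mat.ofPoint (x t)) hN shapes_ne le_rfl
      le_rfl
    have hjr : ((stateAt svd (scalarKernel H) par x y t).ready svd (scalarKernel H) par (x t)).j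
      = (stateAt svd (scalarKernel H) par x y (t + 1)).j := rfl
    have hr := roundReady (H := H) svd hμ hα hU x y t
    have h2 := RoundReady.bounded_predictCode (b := (etaCode.length + 4 + t * roundLength)
      * stepCost true d N + stepCost true d N) hN
      (cfg := (program.configAt svd (scalarKernel H) par x y t).load Reg.inst (Mat.ofPoint (x t)))
      hr (by rw [hjr]; exact hj _ ht) (h1.mono (by omega))
    have h3 := h2.load (dst := Reg.label) (M := Mat.scalar (y t)) hN shapes_ne le_rfl le_rfl
    refine (h3.exec hN shapes_ne svd (scalarKernel H) wellTyped_updateCode).mono ?_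
    rw [hjr, roundLength]
    nlinarith

end Run

/-! ### Bounds in terms of `ln T` -/

section Asymptotics

/-- This is what makes the cost of the growth steps, a fourth power of `ln T` in total, negligible
on average. -/
theorem sq_log_le {T : ℕ} (hT : 2 ≤ T) : Real.log T ^ 2 ≤ 4 * T := by
  have hT0 : (0 : ℝ) ≤ T := T.cast_nonneg
  have h1 : Real.log T ≤ 2 * √T := by
    have h := Real.log_le_self (Real.sqrt_nonneg T)
    rw [Real.log_sqrt hT0] at h
    linarith
  calc Real.log T ^ 2 ≤ (2 * √T) ^ 2 := pow_le_pow_left₀ (by linarith [half_lt_log hT]) h1 2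
    _ = 4 * T := by rw [mul_pow, Real.sq_sqrt hT0]; norm_num

/-- The constant in the regret bound. The three terms belong to the initial potential, to the
log-determinant divided by `η`, and to the projection errors. -/
def regretConst (r c₂ μ U Y : ℝ) : ℝ :=
  μ + 4 * (U ^ 2 + Y ^ 2) * (bufferConst r c₂ * (1 + 2 * Real.log (1 + 2 / μ))) + 8 * U ^ 2

/-- The regret bound, for the size `j` of the buffer, the final potential `pot`, and the
log-determinant `ld`. -/
theorem regret_le {r c₂ μ U Y : ℝ} (hr : 0 < r) (hr1 : r < 1) (hμ : 0 < μ) {T j : ℕ} (hT : 2 ≤ T)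
    (hj : (j : ℝ) ≤ bufferConst r c₂ * Real.log T) {reg pot ld η α F : ℝ} (hF : 0 ≤ F)
    (hα : α = Real.log T ^ 4 / (T : ℝ) ^ 4) (hη : η = 1 / (4 * (U ^ 2 + Y ^ 2))) (hpot : 0 ≤ pot)
    (hld : ld ≤ j * Real.log (T * (1 + 2 / μ)))
    (h : 2 * reg + pot ≤ μ * F + ld / η + T * (8 * U ^ 2 * √α)) :
    reg ≤ regretConst r c₂ μ U Y * (F + Real.log T ^ 2) := by
  have hB := bufferConst_nonneg hr hr1 c₂
  have hL := half_lt_log hT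
  have hT1 : (1 : ℝ) ≤ T := by exact_mod_cast (show 1 ≤ T by omega)
  have hT0 : (0 : ℝ) < T := by linarith
  have hq : 1 ≤ 1 + 2 / μ := le_add_of_nonneg_right (by positivity)
  set ℓ := Real.log (1 + 2 / μ) with hℓ
  have hℓ0 : 0 ≤ ℓ := Real.log_nonneg hq
  rw [Real.log_mul hT0.ne' (by linarith), ← hℓ] at hld
  rw [regretConst, ← hℓ]
  set L := Real.log T with hLdef
  set B := bufferConst r c₂ with hBdef
  have h1 : ld ≤ B * (1 + 2 * ℓ) * L ^ 2 := by
    calc ld ≤ j * (L + ℓ) := hld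
      _ ≤ B * L * (L + ℓ) := mul_le_mul_of_nonneg_right hj (by linarith)
      _ ≤ B * L * (L + 2 * ℓ * L) := by
        refine mul_le_mul_of_nonneg_left ?_ (mul_nonneg hB (by linarith))
        nlinarith
      _ = B * (1 + 2 * ℓ) * L ^ 2 := by ring
  have h2 : ld / η ≤ 4 * (U ^ 2 + Y ^ 2) * (B * (1 + 2 * ℓ)) * L ^ 2 := by
    rw [hη, one_div, div_inv_eq_mul]
    calc ld * (4 * (U ^ 2 + Y ^ 2)) ≤ B * (1 + 2 * ℓ) * L ^ 2 * (4 * (U ^ 2 + Y ^ 2)) :=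
          mul_le_mul_of_nonneg_right h1 (by positivity)
      _ = _ := by ring
  have h3 : √α = L ^ 2 / T ^ 2 := by
    rw [hα, ← Real.sqrt_sq (show 0 ≤ L ^ 2 / (T : ℝ) ^ 2 by positivity)]
    congr 1
    field_simp
  have h4 : T * (8 * U ^ 2 * √α) ≤ 8 * U ^ 2 * L ^ 2 := by
    rw [h3, show (T : ℝ) * (8 * U ^ 2 * (L ^ 2 / T ^ 2)) = 8 * U ^ 2 * L ^ 2 / T by field_simp]
    exact div_le_self (by positivity) hT1
  have h5 : 0 ≤ 4 * (U ^ 2 + Y ^ 2) * (B * (1 + 2 * ℓ)) := by positivity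
  have h6 : 0 ≤ L ^ 2 := sq_nonneg L
  have h7 : 0 ≤ 8 * U ^ 2 := by positivity
  have h8 := mul_nonneg hμ.le hF
  have h9 := mul_nonneg hμ.le h6
  have h10 := mul_nonneg h5 hF
  have h11 := mul_nonneg h5 h6
  have h12 := mul_nonneg h7 hF
  have h13 := mul_nonneg h7 h6
  linear_combination (1 / 2) * h + (1 / 2) * h2 + (1 / 2) * h4 + (1 / 2) * hpot + (1 / 2) * h8
    + h9 + h10 + (1 / 2) * h11 + h12 + (1 / 2) * h13

variable {d N T : ℕ} {b : ℝ}

theorem stepCost_true_le (hT : 2 ≤ T) (hb : 0 ≤ b) (hN : (N : ℝ) ≤ b * Real.log T) :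
    (stepCost true d N : ℝ) ≤ (3 * b ^ 2 + 3 * b + 4) * (d * Real.log T + Real.log T ^ 2) := by
  have hL := half_lt_log hT
  have hd : (0 : ℝ) ≤ d := d.cast_nonneg
  have hN0 : (0 : ℝ) ≤ N := N.cast_nonneg
  set L := Real.log T
  have h1 : (N : ℝ) ^ 2 ≤ b ^ 2 * L ^ 2 := by
    rw [← mul_pow]
    exact pow_le_pow_left₀ hN0 hN 2
  have h2 : (N : ℝ) * d ≤ b * L * d := mul_le_mul_of_nonneg_right hN hd
  have h3 : b * L ≤ b * (2 * L ^ 2) := mul_le_mul_of_nonneg_left (by nlinarith) hb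
  have h4 : 1 ≤ 4 * L ^ 2 := by nlinarith
  have h5 : 0 ≤ d * L := mul_nonneg hd (by linarith)
  have h6 : 0 ≤ (3 * b ^ 2 + 2 * b + 4) * (d * L) := by positivity
  have h7 : 0 ≤ b * L ^ 2 := by positivity
  simp only [stepCost, if_true]
  push_cast
  linear_combination 3 * h1 + h2 + hN + h3 + h4 + h6 + h7

/-- The total cost of `N` expensive operations. -/
theorem mul_stepCost_false_le (hT : 2 ≤ T) (hb : 0 ≤ b) (hN : (N : ℝ) ≤ b * Real.log T) :
    N * (stepCost false d N : ℝ)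
      ≤ T * ((12 * b ^ 4 + 12 * b ^ 3 + 2 * b) * (d * Real.log T + Real.log T ^ 2)) := by
  have hL := half_lt_log hT
  have hLT := sq_log_le hT
  have hd : (0 : ℝ) ≤ d := d.cast_nonneg
  have hN0 : (0 : ℝ) ≤ N := N.cast_nonneg
  have hT1 : (1 : ℝ) ≤ T := by exact_mod_cast (show 1 ≤ T by omega)
  set L := Real.log T
  have hL0 : 0 ≤ L := by linarith
  have h4 : (N : ℝ) ^ 4 ≤ b ^ 4 * (4 * T * L ^ 2) := by
    calc (N : ℝ) ^ 4 ≤ (b * L) ^ 4 := pow_le_pow_left₀ hN0 hN 4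
      _ = b ^ 4 * (L ^ 2 * L ^ 2) := by ring
      _ ≤ _ := by gcongr
  have h3 : (N : ℝ) ^ 3 ≤ b ^ 3 * (4 * T * L) := by
    calc (N : ℝ) ^ 3 ≤ (b * L) ^ 3 := pow_le_pow_left₀ hN0 hN 3
      _ = b ^ 3 * (L ^ 2 * L) := by ring
      _ ≤ _ := by gcongr
  have h3d : (N : ℝ) ^ 3 * d ≤ b ^ 3 * (4 * T * L) * d := mul_le_mul_of_nonneg_right h3 hd
  have hLL : L ≤ 2 * L ^ 2 := by nlinarith
  have h3' : b ^ 3 * (4 * T * L) ≤ b ^ 3 * (4 * T * (2 * L ^ 2)) := by gcongr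
  have h1 : b * L ≤ b * (T * (2 * L ^ 2)) := by
    refine mul_le_mul_of_nonneg_left (hLL.trans ?_) hb
    exact le_mul_of_one_le_left (by positivity) hT1
  have h5 : 0 ≤ T * ((12 * b ^ 4 + 8 * b ^ 3 + 2 * b) * (d * L)) := by positivity
  have h6 : 0 ≤ T * (4 * b ^ 3 * L ^ 2) := by positivity
  simp only [stepCost, Bool.false_eq_true, if_false]
  push_cast
  linear_combination 3 * h4 + h3d + h3 + h3' + hN + h1 + h5 + h6

theorem spaceBound_le (n : ℕ) (hT : 2 ≤ T) (hb : 0 ≤ b) (hN : (N : ℝ) ≤ b * Real.log T) :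
    (spaceBound n d N : ℝ)
      ≤ (n + 1) * ((b ^ 2 + b + 4) * (d * Real.log T + Real.log T ^ 2)) := by
  have hL := half_lt_log hT
  have hd : (0 : ℝ) ≤ d := d.cast_nonneg
  have hN0 : (0 : ℝ) ≤ N := N.cast_nonneg
  set L := Real.log T
  have h1 : (N : ℝ) ^ 2 ≤ b ^ 2 * L ^ 2 := by
    rw [← mul_pow]
    exact pow_le_pow_left₀ hN0 hN 2
  have h2 : (d : ℝ) * N ≤ d * (b * L) := mul_le_mul_of_nonneg_left hN hd
  have h4 : 1 ≤ 4 * L ^ 2 := by nlinarith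
  have h5 : 0 ≤ d * L := mul_nonneg hd (by linarith)
  have h6 : 0 ≤ (b ^ 2 + 4) * (d * L) := by positivity
  have h7 : 0 ≤ b * L ^ 2 := by positivity
  rw [spaceBound]
  push_cast
  refine mul_le_mul_of_nonneg_left ?_ (by positivity)
  linear_combination h1 + h2 + h4 + h6 + h7

/-- The constant in the time bound, for buffers of size at most `b * log T`. -/
def timeConst (b : ℝ) : ℝ :=
  (etaCode.length + 4 + roundLength) * (3 * b ^ 2 + 3 * b + 4)
    + (regrowCode.length + 1) * (12 * b ^ 4 + 12 * b ^ 3 + 2 * b)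

theorem time_div_le (hT : 2 ≤ T) (hb : 0 ≤ b) (hN : (N : ℝ) ≤ b * Real.log T) {j t : ℕ} (hj : j ≤ N)
    (ht : t ≤ (etaCode.length + 4 + T * roundLength) * stepCost true d N
      + j * ((regrowCode.length + 1) * stepCost false d N)) :
    (t : ℝ) / T ≤ timeConst b * (d * Real.log T + Real.log T ^ 2) := by
  have hT1 : (1 : ℝ) ≤ T := by exact_mod_cast (show 1 ≤ T by omega)
  have h1 := stepCost_true_le (d := d) hT hb hN
  have h2 := mul_stepCost_false_le (d := d) hT hb hN
  have ht' : (t : ℝ) ≤ (etaCode.length + 4 + T * roundLength) * stepCost true d N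
      + j * ((regrowCode.length + 1) * stepCost false d N) := by exact_mod_cast ht
  have hj' : (j : ℝ) ≤ N := by exact_mod_cast hj
  set D := d * Real.log T + Real.log T ^ 2
  rw [div_le_iff₀ (by linarith), timeConst]
  have hs0 : (0 : ℝ) ≤ stepCost true d N := Nat.cast_nonneg _
  have hs1 : (0 : ℝ) ≤ stepCost false d N := Nat.cast_nonneg _
  have hE : (0 : ℝ) ≤ etaCode.length := Nat.cast_nonneg _
  have hG : (0 : ℝ) ≤ regrowCode.length := Nat.cast_nonneg _
  have hR : (0 : ℝ) ≤ roundLength := Nat.cast_nonneg _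
  calc (t : ℝ) ≤ _ := ht'
    _ ≤ T * (etaCode.length + 4 + roundLength) * stepCost true d N
        + (regrowCode.length + 1) * (N * stepCost false d N) := by
      refine add_le_add (mul_le_mul_of_nonneg_right (by nlinarith) hs0) ?_
      rw [mul_left_comm]
      gcongr
    _ ≤ T * (etaCode.length + 4 + roundLength) * ((3 * b ^ 2 + 3 * b + 4) * D)
        + (regrowCode.length + 1) * (T * ((12 * b ^ 4 + 12 * b ^ 3 + 2 * b) * D)) := by
      gcongr
    _ = _ := by ring

end Asymptotics

end NonsALD

end

theorem mainTheorem3 :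
    ∃ P : NonsALD.Program,
    ∀ (r c₁ c₂ μ U Y : ℝ), 0 < r → r < 1 → 0 < c₁ → c₁ ≤ c₂ → 0 < μ → 0 ≤ Y → Y ≤ U → 0 < U →
    ∃ C : ℝ, 0 < C ∧
    ∀ (d : ℕ) (H : Type*) [NormedAddCommGroup H] [InnerProductSpace ℝ H] [CompleteSpace H]
      [RKHS ℝ H (EuclideanSpace ℝ (Fin d)) ℝ],
      (∀ a : EuclideanSpace ℝ (Fin d), NonsALD.scalarKernel H a a = 1) →
    ∀ (svd : NonsALD.SVDRoutine) (T : ℕ), 2 ≤ T →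
    ∀ (x : ℕ → EuclideanSpace ℝ (Fin d)) (y : ℕ → ℝ), (∀ t < T, |y t| ≤ Y) →
    ∀ R₀ : ℝ, c₁ * T ≤ R₀ → R₀ ≤ c₂ * T →
      (∀ i : Fin (Fintype.card (Fin T)),
        (NonsALD.gram_isHermitian H (fun t : Fin T => x t)).eigenvalues₀ i
          ≤ R₀ * r ^ ((i : ℕ) + 1)) →
    ∀ par : NonsALD.Params, par = ⟨μ, Real.log T ^ 4 / (T : ℝ) ^ 4, U, Y⟩ →
      (∀ f : H, ‖f‖ ≤ U →
        NonsALD.regret x y T (NonsALD.prediction svd (NonsALD.scalarKernel H) par x y) f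
          ≤ C * (‖f‖ ^ 2 + Real.log T ^ 2)) ∧
      P.Implements svd (NonsALD.scalarKernel H) par x y T ∧
      (P.time svd (NonsALD.scalarKernel H) par x y T : ℝ) / T
        ≤ C * (d * Real.log T + Real.log T ^ 2) ∧
      (P.space svd (NonsALD.scalarKernel H) par x y T : ℝ)
        ≤ C * (d * Real.log T + Real.log T ^ 2) := by
  open NonsALD in
  refine ⟨program, fun r c₁ c₂ μ U Y hr hr1 hc₁ _ hμ hY hYU hU => ?_⟩
  have hB := bufferConst_nonneg hr hr1 c₂
  set b := bufferConst r c₂ + 2 with hbdef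
  have hb : 0 ≤ b := by linarith
  have hℓ : 0 ≤ Real.log (1 + 2 / μ) :=
    Real.log_nonneg (le_add_of_nonneg_right (by positivity))
  have hC1 : 0 < regretConst r c₂ μ U Y := by
    rw [regretConst]
    positivity
  have hC2 : 0 ≤ timeConst b := by
    rw [timeConst]
    positivity
  have hC3 : 0 ≤ ((27 : ℕ) + 1 : ℝ) * (b ^ 2 + b + 4) := by positivity
  refine ⟨regretConst r c₂ μ U Y + timeConst b + ((27 : ℕ) + 1 : ℝ) * (b ^ 2 + b + 4),
    by linarith, ?_⟩
  intro d H _ _ _ _ hker svd T hT x y hy R₀ hR₁ hR₂ heig par hpar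
  have hL := half_lt_log hT
  have hD : 0 ≤ d * Real.log T + Real.log T ^ 2 :=
    add_nonneg (mul_nonneg d.cast_nonneg (by linarith)) (sq_nonneg _)
  have hμ' : 0 < par.μ := by rw [hpar]; exact hμ
  have hU' : 0 < par.U := by rw [hpar]; exact hU
  have hα : par.α = Real.log T ^ 4 / (T : ℝ) ^ 4 := by rw [hpar]
  have hα' : 0 < par.α := by
    rw [hα]
    have : 0 < Real.log T := by linarith
    have : (0 : ℝ) < T := by exact_mod_cast (show 0 < T by omega)
    positivity
  have hinv := invariant_stateAt (H := H) svd hμ' hα' par.eta_nonneg x y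
  have hcard : ∀ t ≤ T, ((stateAt svd (scalarKernel H) par x y t).j : ℝ)
      ≤ bufferConst r c₂ * Real.log T := fun t ht =>
    (hinv t).card_le ht hT hα hr hr1 hc₁ hR₁ hR₂ heig
  refine ⟨fun f hf => ?_, implements svd hμ' hα' hU'.le x y T, ?_⟩
  · have hy' : ∀ t < T, |y t| ≤ par.Y := by rw [hpar]; exact hy
    have hYU' : par.Y ≤ par.U := by rw [hpar]; exact hYU
    have hf' : ‖f‖ ≤ par.U := by rw [hpar]; exact hf
    have h1 := regret_add_potential_le (x := x) svd hker hμ' hα' hU' hYU' hy' hf'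
    have h2 := logDet_le (hinv T) hμ' (trace_stateAt_le (x := x) svd hker hμ' hα' hU' hy')
    have h3 : regret x y T (prediction svd (scalarKernel H) par x y) f
        ≤ regretConst r c₂ par.μ par.U par.Y * (‖f‖ ^ 2 + Real.log T ^ 2) :=
      regret_le hr hr1 hμ' hT (hcard T le_rfl) (sq_nonneg _) hα rfl
        (potential_nonneg (hinv T) hμ' f) h2 h1
    have hpc : regretConst r c₂ par.μ par.U par.Y = regretConst r c₂ μ U Y := by rw [hpar]
    rw [hpc] at h3
    exact h3.trans (mul_le_mul_of_nonneg_right (by linarith) (by positivity))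
  · -- `N` bounds the size of all buffers; it has to be positive for the bounds by shapes
    set N := ⌊bufferConst r c₂ * Real.log T⌋₊ + 1 with hNdef
    have hN : (N : ℝ) ≤ b * Real.log T := by
      rw [hNdef, Nat.cast_add, Nat.cast_one]
      have := Nat.floor_le (mul_nonneg hB (by linarith : 0 ≤ Real.log T))
      rw [hbdef]
      linarith
    have hj : ∀ t ≤ T, (stateAt svd (scalarKernel H) par x y t).j ≤ N := fun t ht =>
      (Nat.le_floor (hcard t ht)).trans (Nat.le_succ _)
    have h := bounded_configAt svd hμ' hα' hU'.le x y (Nat.le_add_left 1 _) hj le_rfl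
    have ht := time_div_le hT hb hN (hj T le_rfl) h.time_le
    have hs : ((program.configAt svd (scalarKernel H) par x y T).space : ℝ) ≤ _ :=
      (Nat.cast_le.mpr h.space_le).trans (spaceBound_le 27 hT hb hN)
    refine ⟨ht.trans (mul_le_mul_of_nonneg_right (by linarith) hD), hs.trans ?_⟩
    rw [← mul_assoc]
    exact mul_le_mul_of_nonneg_right (by linarith) hD
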